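/- For $f\colon\mathbb N\to\mathbb N$, say that $f$ is subexponential if for every $\epsilon>0$ there is $R_0\in\mathbb N$ such that $f(R)<\exp(\epsilon R)$ for all integers $R\ge R_0$. The function $f$ bounds the growth of a graph $G$ if, for every vertex $v$ and every $R\in\mathbb N$, at most $f(R)$ vertices are reachable from $v$ by a path with at most $R$ edges. Let $\log^* n$ be the number of times the (natural) logarithm must be applied to $n$ before the result is at most $1$. In the deterministic $\mathsf{LOCAL}$ model, all vertices of a finite $n$-vertex graph $G$ execute the same deterministic algorithm. The vertices are given distinct identifiers from $\{1,\dots,n\}$, and initially each vertex knows only its own identifier. The computation proceeds in synchronous rounds: in each round every vertex broadcasts a message of arbitrary length to its neighbors, receives their messages, and performs an arbitrary local computation. After a number of rounds $T(n)$ that depends only on $n$ (and the algorithm), every vertex outputs the colors of the edges incident to it. The algorithm finds a proper $q$-edge-coloring of $G$ if, for every assignment of the identifiers, the outputs of the vertices are those given by a proper $q$-edge-coloring of $G$. **Theorem.** Let $f\colon\mathbb N\to\mathbb N$ be a subexponential function. There is a constant $C_f>0$ depending only on $f$ such that for every $\Delta\in\mathbb N$ there is a deterministic $\mathsf{LOCAL}$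 algorithm that, for every $n$, finds a proper $(\Delta+1)$-edge-coloring of every $n$-vertex graph $G$ of maximum degree at most $\Delta$ whose growth is bounded by $f$, in $T(n)\le C_f\log^* n$ rounds. -/

import Mathlib

/-- The growth function `f : ℕ → ℕ` is subexponential: for every `ε > 0`, eventually
`f R < exp (ε R)`. -/
def Subexponential (f : ℕ → ℕ) : Prop :=
  ∀ ε : ℝ, 0 < ε → ∃ R₀ : ℕ, ∀ R : ℕ, R₀ ≤ R → (f R : ℝ) < Real.exp (ε * R)

/-- The closed `R`-neighborhood of `v`: all vertices reachable from `v` by a path with at most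
`R` edges. -/
def closedNeighborhood {V : Type*} (G : SimpleGraph V) (v : V) (R : ℕ) : Set V :=
  {u | ∃ p : G.Walk v u, p.IsPath ∧ p.length ≤ R}

/-- `f` bounds the growth of `G`. -/
def BoundsGrowth {V : Type*} (f : ℕ → ℕ) (G : SimpleGraph V) : Prop :=
  ∀ (v : V) (R : ℕ), (closedNeighborhood G v R).encard ≤ f R

/-- The class of finite graphs of maximum degree at most `Δ` and growth bounded by `f`. -/
def InGrowthClass (Δ : ℕ) (f : ℕ → ℕ) {V : Type*} [Fintype V] (G : SimpleGraph V)
    [DecidableRel G.Adj] : Prop :=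
  G.maxDegree ≤ Δ ∧ BoundsGrowth f G

/-- The logarithm can be iterated, starting from any real number, until the result is at most `1`;
so the set whose infimum is taken in `logStar` below is never empty. -/
theorem exists_iterate_log_le_one (x : ℝ) : ∃ k : ℕ, Real.log^[k] x ≤ 1 := by
  by_contra! h
  have key : ∀ k : ℕ, Real.log^[k] x ≤ x - k / 2 := by
    intro k
    induction k with
    | zero => simp
    | succ k ih =>
      have h1 : 1 < Real.log (Real.log^[k] x) := by
        have := h (k + 1)
        rwa [Function.iterate_succ_apply'] at this
      have h0 := h k
      rw [Function.iterate_succ_apply']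
      set y := Real.log^[k] x
      have hy : 2 < y := by
        have := Real.log_le_sub_one_of_pos (show 0 < y by linarith)
        linarith
      have h2 : Real.log y = 2 * Real.log (y / 2) / 2 + Real.log 2 := by
        rw [Real.log_div (by linarith) (by norm_num)]; ring
      have h3 := Real.log_le_sub_one_of_pos (show 0 < y / 2 by linarith)
      have h4 := Real.log_two_lt_d9
      push_cast
      linarith
  obtain ⟨k, hk⟩ := exists_nat_gt (2 * x)
  have h1 := key k
  have h2 := h k
  linarith

/-- The iterated logarithm `log* x`: the number of times that the natural logarithm has to be
applied to `x` before the result becomes at most `1`. -/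
noncomputable def logStar (x : ℝ) : ℕ :=
  sInf {k : ℕ | Real.log^[k] x ≤ 1}

/-- A deterministic distributed algorithm in the LOCAL model, whose vertices produce outputs of
type `Out`. Every vertex executes the same algorithm and knows only its own identifier at the
start. In each round every vertex broadcasts one message to all its neighbors, receives the
messages of its neighbors (as a multiset) and performs a local computation. Messages and memory
states are elements of arbitrary types, and local computations are arbitrary functions. -/
structure LocalAlgorithm (Out : Type) : Type 1 where
  /-- The possible contents of the memory of a vertex. -/
  State : Type
  /-- The possible messages. -/
  Msg : Type
  /-- The initial state of a vertex, as a function of its identifier. -/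
  init : ℕ → State
  /-- The message broadcast by a vertex in a given state. -/
  send : State → Msg
  /-- The new state of a vertex, from its old state and the messages from its neighbors. -/
  update : State → Multiset Msg → State
  /-- The output of a vertex when the algorithm stops. -/
  output : State → Out

namespace LocalAlgorithm

variable {Out : Type} (A : LocalAlgorithm Out) {V : Type*} [Fintype V] (G : SimpleGraph V)
  [DecidableRel G.Adj] (ident : V → ℕ)

/-- `A.stateAfter G ident t v` is the state of the vertex `v` after `t` communication rounds of `A`
on the graph `G` with identifiers `ident`. -/
def stateAfter : ℕ → V → A.State
  | 0, v => A.init (ident v)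
  | t + 1, v => A.update (stateAfter t v)
      ((G.neighborFinset v).val.map fun u => A.send (stateAfter t u))

/-- The output of the vertex `v` when `A` is run on `G` for `t` communication rounds. -/
def outputAfter (t : ℕ) (v : V) : Out :=
  A.output (A.stateAfter G ident t v)

end LocalAlgorithm

/-- An admissible assignment of identifiers on an `n`-vertex graph: distinct numbers in
`{1, …, n}`. -/
def IsIdAssignment {V : Type*} [Fintype V] (ident : V → ℕ) : Prop :=
  Function.Injective ident ∧ ∀ v, 1 ≤ ident v ∧ ident v ≤ Fintype.card V

/-- Each vertex `v` outputs the colors of the edges at `v`, as a function `out v` that sends the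
identifier of a neighbor `u` to the color of the edge `uv` (values at other arguments are
irrelevant). The outputs encode a proper `q`-edge-coloring of `G` if there is a proper coloring `φ`
of the edges (a proper vertex coloring of the line graph) such that both endpoints of every edge
report its color under `φ`. -/
def EncodesProperEdgeColoring {V : Type*} (G : SimpleGraph V) (ident : V → ℕ) (q : ℕ)
    (out : V → ℕ → Fin q) : Prop :=
  ∃ φ : G.lineGraph.Coloring (Fin q),
    ∀ (v u : V) (h : G.Adj v u), out v (ident u) = φ ⟨s(v, u), h⟩

/-!
An edge-colouring is built in a constant number of stages, each of which colours the remaining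
edges at all vertices of one class of a vertex partition. What makes this possible is that an
uncoloured edge can always be coloured by changing the colours within a *constant* distance, when
`Δ + 1` colours are available and the growth is subexponential (`exists_augmentation_radius`).

This is shown with multi-step Vizing chains. Vizing's argument either colours the uncoloured edge
`xy` by changes near `x`, or yields a fan around `x` and from one of its leaves an alternating path
longer than a given constant `ℓ` (`exists_extension`). Shifting colours along the fan and along an
initial part of the path, of any length less than `ℓ`, moves the uncoloured edge elsewhere, where
the argument can be repeated. If the original edge cannot be coloured by local changes, this does
not stop within `M` steps. A chain is prolonged only as long as its next alternating path avoids
everything that was touched before, except the path of the last step, which is handled by the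
choice of colours: the new colours are either both different from the last ones or the same. Such a
path is therefore an alternating path of the original colouring (`ChainBase.Valid.isAltPath`).
Hence the uncoloured edge before a step is determined by the uncoloured edge after it, up to a
number `C` of possibilities that depends on `Δ` only: follow the path of the original colouring
back to its end, which is a leaf of the fan (`mem_candidates`). Chains with a given last edge
therefore number at most `C ^ (M - 1)`. On the other hand, a chain whose next path meets what was
touched `d + 1` steps ago is determined up to about `ℓ * C ^ (d + 1)` possibilities by its
beginning, so that Rosenfeld's counting argument shows that the number of chains grows by a factor
of at least `ℓ / 2` in every step (`ChainBase.Blocked.mul_card_chains_le`). Comparing the two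
counts, a ball of radius `ℓ * M` has exponentially many vertices in `M`
(`ChainBase.Blocked.two_pow_le`), which contradicts subexponential growth for a suitable constant
`M`.

For the distributed algorithm, a colouring of the vertices in which vertices at distance at most
`2 * R` get different colours is computed from the identifiers in `log* n` rounds of colour reduction
on a power of the graph, whose degrees are bounded (`exists_reducedColor_lt`). The number of its
colours is constant. Its colour classes are processed one after the other; the vertices of one
class are so far apart that the recolourings around them do not interfere (`recolorClass_spec`).
All this is expressed by local functions of graphs on the set of identifiers, and such functions
can be computed by collecting the neighbourhood (`outputAfter_gatherAlgorithm`). Since degrees are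
bounded by `f 1`, only `min Δ (f 1)` matters, and one constant in the number of rounds suffices for
all `Δ`.
-/

/-! ### Partial edge-colourings and shifts -/

section PartialColoring

variable {V κ : Type*}

/-- A proper partial edge-colouring of `G`, encoded as a symmetric function of two vertices:
`φ u v = some c` says that `uv` is an edge of colour `c`, and `φ u v = none` that `uv` is
uncoloured (or not an edge). -/
structure IsPartialColoring (G : SimpleGraph V) (φ : V → V → Option κ) : Prop where
  symm : ∀ u v, φ u v = φ v u
  adj : ∀ {u v c}, φ u v = some c → G.Adj u v
  inj : ∀ {u v w c}, φ u v = some c → φ u w = some c → v = w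

/-- The colour `c` is not used on any edge at `v`. -/
def Missing (φ : V → V → Option κ) (v : V) (c : κ) : Prop := ∀ w, φ v w ≠ some c

/-- Every edge coloured by `φ` is coloured by `ψ`, and so is `e`. -/
def Covers (G : SimpleGraph V) (φ : V → V → Option κ) (e : Sym2 V) (ψ : V → V → Option κ) : Prop :=
  ∀ u v, G.Adj u v → ψ u v = none → φ u v = none ∧ s(u, v) ≠ e

/-- Every edge coloured by `φ` is coloured by `ψ`, and so is `e`, with the possible exception
of `e'`: the place of the uncoloured edge has moved from `e` to `e'`. -/
def Shifted (G : SimpleGraph V) (φ : V → V → Option κ) (e : Sym2 V) (ψ : V → V → Option κ)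
    (e' : Sym2 V) : Prop :=
  ∀ u v, G.Adj u v → ψ u v = none → s(u, v) = e' ∨ (φ u v = none ∧ s(u, v) ≠ e)

variable {G : SimpleGraph V} {φ ψ χ : V → V → Option κ} {e e' e'' : Sym2 V}

theorem Shifted.refl : Shifted G φ e φ e := fun u v _ h => by
  by_cases he : s(u, v) = e
  · exact Or.inl he
  · exact Or.inr ⟨h, he⟩

theorem Shifted.trans (h₁ : Shifted G φ e ψ e') (h₂ : Shifted G ψ e' χ e'') :
    Shifted G φ e χ e'' := fun u v ha h => by
  rcases h₂ u v ha h with h | ⟨h, h'⟩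
  · exact Or.inl h
  · rcases h₁ u v ha h with h | h
    · exact absurd h h'
    · exact Or.inr h

theorem Shifted.covers (h₁ : Shifted G φ e ψ e') (h₂ : Covers G ψ e' χ) : Covers G φ e χ :=
  fun u v ha h => by
  obtain ⟨h, h'⟩ := h₂ u v ha h
  exact (h₁ u v ha h).resolve_left h'

theorem IsPartialColoring.eq_of_sym2 (hφ : IsPartialColoring G φ) {u v a b : V}
    (h : s(u, v) = s(a, b)) : φ u v = φ a b := by
  rcases Sym2.eq_iff.1 h with ⟨rfl, rfl⟩ | ⟨rfl, rfl⟩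
  · rfl
  · exact hφ.symm _ _

open Classical in
/-- The colouring `φ` with the colour of the edge `ab` replaced by `o`. -/
noncomputable def recolor (φ : V → V → Option κ) (a b : V) (o : Option κ) : V → V → Option κ :=
  fun u v => if s(u, v) = s(a, b) then o else φ u v

theorem recolor_self (a b : V) (o : Option κ) : recolor φ a b o a b = o := by simp [recolor]

theorem recolor_of_eq {a b u v : V} (h : s(u, v) = s(a, b)) (o : Option κ) :
    recolor φ a b o u v = o := by simp only [recolor, if_pos h]

theorem recolor_of_ne {a b u v : V} (h : s(u, v) ≠ s(a, b)) (o : Option κ) :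
    recolor φ a b o u v = φ u v := by simp only [recolor, if_neg h]

theorem IsPartialColoring.uncolor (hφ : IsPartialColoring G φ) (a b : V) :
    IsPartialColoring G (recolor φ a b none) := by
  have key : ∀ {u v c}, recolor φ a b none u v = some c → φ u v = some c := by
    intro u v c h
    by_cases he : s(u, v) = s(a, b)
    · rw [recolor_of_eq he] at h; cases h
    · rwa [recolor_of_ne he] at h
  refine ⟨fun u v => ?_, fun h => hφ.adj (key h), fun h h' => hφ.inj (key h) (key h')⟩
  unfold recolor; rw [show s(u, v) = s(v, u) from Sym2.eq_swap, hφ.symm u v]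

theorem IsPartialColoring.color (hφ : IsPartialColoring G φ) {a b : V} {c : κ} (hab : G.Adj a b)
    (ha : Missing φ a c) (hb : Missing φ b c) : IsPartialColoring G (recolor φ a b (some c)) := by
  refine ⟨fun u v => ?_, fun {u v d} h => ?_, fun {u v w d} h h' => ?_⟩
  · unfold recolor; rw [show s(u, v) = s(v, u) from Sym2.eq_swap, hφ.symm u v]
  · by_cases he : s(u, v) = s(a, b)
    · rcases Sym2.eq_iff.1 he with ⟨rfl, rfl⟩ | ⟨rfl, rfl⟩
      exacts [hab, hab.symm]
    · rw [recolor_of_ne he] at h; exact hφ.adj h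
  · by_cases he : s(u, v) = s(a, b) <;> by_cases he' : s(u, w) = s(a, b)
    · exact Sym2.congr_right.1 (he.trans he'.symm)
    · rw [recolor_of_eq he] at h
      rw [recolor_of_ne he'] at h'
      cases h
      rcases Sym2.eq_iff.1 he with ⟨rfl, rfl⟩ | ⟨rfl, rfl⟩
      exacts [absurd h' (ha _), absurd h' (hb _)]
    · rw [recolor_of_eq he'] at h'
      rw [recolor_of_ne he] at h
      cases h'
      rcases Sym2.eq_iff.1 he' with ⟨rfl, rfl⟩ | ⟨rfl, rfl⟩
      exacts [absurd h (ha _), absurd h (hb _)]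
    · rw [recolor_of_ne he] at h
      rw [recolor_of_ne he'] at h'
      exact hφ.inj h h'

theorem covers_recolor (a b : V) (c : κ) :
    Covers G φ s(a, b) (recolor φ a b (some c)) := by
  intro u v _ h
  by_cases he : s(u, v) = s(a, b)
  · rw [recolor_of_eq he] at h; cases h
  · rw [recolor_of_ne he] at h; exact ⟨h, he⟩

/-- The elementary shift: if `uv` is uncoloured and the colour of `vw` is missing at `u`, then this
colour can be moved from `vw` to `uv`. -/
theorem IsPartialColoring.exists_shift (hφ : IsPartialColoring G φ) {u v w : V} {c : κ}
    (huv : G.Adj u v) (h0 : φ u v = none) (hc : φ v w = some c) (hu : Missing φ u c) :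
    ∃ ψ, IsPartialColoring G ψ ∧ Shifted G φ s(u, v) ψ s(v, w) ∧ ψ u v = some c ∧ ψ v w = none ∧
      ∀ a b, s(a, b) ≠ s(u, v) → s(a, b) ≠ s(v, w) → ψ a b = φ a b := by
  have hne : s(v, w) ≠ s(u, v) := fun h => by
    rw [hφ.eq_of_sym2 h, h0] at hc; cases hc
  have h1 := hφ.uncolor v w
  have hm : ∀ {a b d}, recolor φ v w none a b = some d → φ a b = some d ∧ s(a, b) ≠ s(v, w) := by
    intro a b d h
    by_cases he : s(a, b) = s(v, w)
    · rw [recolor_of_eq he] at h; cases h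
    · rw [recolor_of_ne he] at h; exact ⟨h, he⟩
  refine ⟨recolor (recolor φ v w none) u v (some c), h1.color huv (fun b hb => hu b (hm hb).1)
    (fun b hb => (hm hb).2 (by rw [hφ.inj (hm hb).1 hc])), ?_, recolor_self _ _ _, ?_, ?_⟩
  · intro a b _ h
    by_cases he : s(a, b) = s(u, v)
    · rw [recolor_of_eq he] at h; cases h
    · rw [recolor_of_ne he] at h
      by_cases he' : s(a, b) = s(v, w)
      · exact Or.inl he'
      · rw [recolor_of_ne he'] at h; exact Or.inr ⟨h, he⟩
  · rw [recolor_of_ne hne, recolor_self]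
  · intro a b h h'
    rw [recolor_of_ne h, recolor_of_ne h']

/-- Shifting along a fan: the leaves are `y 0, …, y k`, the edge `x (y 0)` is uncoloured and the
colour of `x (y (l + 1))` is missing at `y l`. -/
theorem IsPartialColoring.exists_fan_shift (hφ : IsPartialColoring G φ) {x : V} (y : ℕ → V)
    (μ : ℕ → κ) (h0 : G.Adj x (y 0)) (hn : φ x (y 0) = none) (k : ℕ)
    (hy : Set.InjOn y (Set.Iic k)) (hμ : ∀ l < k, φ x (y (l + 1)) = some (μ l))
    (hmiss : ∀ l < k, Missing φ (y l) (μ l)) :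
    ∃ ψ, IsPartialColoring G ψ ∧ Shifted G φ s(x, y 0) ψ s(x, y k) ∧ ψ x (y k) = none ∧
      (∀ u v, u ≠ x → v ≠ x → ψ u v = φ u v) ∧ (∀ w, (∀ l ≤ k, w ≠ y l) → ψ x w = φ x w) ∧
      (∀ c, Missing φ x c → Missing ψ x c) ∧ ∀ l < k, ψ x (y l) = some (μ l) := by
  induction k with
  | zero => exact ⟨φ, hφ, Shifted.refl, hn, fun _ _ _ _ => rfl, fun _ _ => rfl, fun _ h => h,
      fun l hl => absurd hl (by omega)⟩
  | succ k ih =>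
    obtain ⟨ψ, hψ, hsh, hnone, hoff, hleaf, hm, hcols⟩ := ih
      (hy.mono (Set.Iic_subset_Iic.2 k.le_succ)) (fun l hl => hμ l (by omega))
      (fun l hl => hmiss l (by omega))
    have hxk : G.Adj x (y k) := by
      cases k with
      | zero => exact h0
      | succ k => exact hφ.adj (hμ k (by omega))
    have hcol : ψ x (y (k + 1)) = some (μ k) := by
      rw [hleaf, hμ k (by omega)]
      intro l hl h
      have := hy (Set.mem_Iic.2 le_rfl) (Set.mem_Iic.2 (by omega)) h
      omega
    have hyx : ∀ l ≤ k, y l ≠ x := by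
      intro l hl h
      cases l with
      | zero => exact h0.ne h.symm
      | succ l => exact (hφ.adj (hμ l (by omega))).ne h.symm
    have hmk : Missing ψ (y k) (μ k) := by
      intro w h
      by_cases hw : w = x
      · rw [hw, hψ.symm, hnone] at h; cases h
      · rw [hoff _ _ (hyx k le_rfl) hw] at h
        exact hmiss k (by omega) w h
    obtain ⟨χ, hχ, hsh', hc1, hc2, hoff'⟩ := hψ.exists_shift hxk.symm
      (by rw [hψ.symm, hnone]) hcol hmk
    rw [Sym2.eq_swap] at hsh'
    refine ⟨χ, hχ, hsh.trans hsh', hc2, ?_, ?_, ?_, ?_⟩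
    · intro u v hu hv
      rw [hoff', hoff u v hu hv]
      · intro h; rcases Sym2.eq_iff.1 h with ⟨_, h⟩ | ⟨h, _⟩ <;> contradiction
      · intro h; rcases Sym2.eq_iff.1 h with ⟨h, _⟩ | ⟨_, h⟩ <;> contradiction
    · intro w hw
      rw [hoff', hleaf w fun l hl => hw l (by omega)]
      · rw [Sym2.eq_swap (a := y k)]
        exact fun h => hw k (by omega) (Sym2.congr_right.1 h)
      · exact fun h => hw (k + 1) le_rfl (Sym2.congr_right.1 h)
    · intro c hc w h
      by_cases h1 : s(x, w) = s(y k, x)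
      · rw [hχ.eq_of_sym2 h1, hc1, ← hcol] at h
        exact hm c hc _ h
      · by_cases h2 : s(x, w) = s(x, y (k + 1))
        · rw [hχ.eq_of_sym2 h2, hc2] at h; cases h
        · rw [hoff' _ _ h1 h2] at h
          exact hm c hc _ h
    · intro l hl
      rcases Nat.lt_succ_iff_lt_or_eq.1 hl with h | rfl
      · rw [hoff', hcols l h]
        · rw [Sym2.eq_swap (a := y k)]
          intro he
          have := hy (Set.mem_Iic.2 (by omega)) (Set.mem_Iic.2 (by omega)) (Sym2.congr_right.1 he)
          omega
        · intro he
          have := hy (Set.mem_Iic.2 (by omega)) (Set.mem_Iic.2 le_rfl) (Sym2.congr_right.1 he)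
          omega
      · rw [hχ.symm]; exact hc1

/-- Shifting along an alternating path `p 0, p 1, …` whose first edge is uncoloured and whose
`t`-th edge has colour `d t`, where `d` is periodic of period `2`. After `k` shifts the `k`-th edge
is the uncoloured one. -/
theorem IsPartialColoring.exists_path_shift (hφ : IsPartialColoring G φ) (p : ℕ → V) (d : ℕ → κ)
    (hd : ∀ t, d (t + 2) = d t) (hdne : ∀ t, d t ≠ d (t + 1))
    (h0 : G.Adj (p 0) (p 1)) (hn : φ (p 0) (p 1) = none)
    (hm0 : Missing φ (p 0) (d 1)) (hm1 : Missing φ (p 1) (d 0)) (k : ℕ)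
    (hp : Set.InjOn p (Set.Iic (k + 1)))
    (hcol : ∀ t < k, φ (p (t + 1)) (p (t + 2)) = some (d (t + 1))) :
    ∃ ψ, IsPartialColoring G ψ ∧ Shifted G φ s(p 0, p 1) ψ s(p k, p (k + 1)) ∧
      ψ (p k) (p (k + 1)) = none ∧ (∀ t < k, ψ (p t) (p (t + 1)) = some (d (t + 1))) ∧
      (∀ u v, (∀ t ≤ k, s(u, v) ≠ s(p t, p (t + 1))) → ψ u v = φ u v) ∧
      Missing ψ (p k) (d (k + 1)) ∧ Missing ψ (p (k + 1)) (d k) := by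
  induction k with
  | zero =>
    exact ⟨φ, hφ, Shifted.refl, hn, fun t ht => absurd ht (by omega), fun _ _ _ => rfl, hm0, hm1⟩
  | succ k ih =>
    obtain ⟨ψ, hψ, hsh, hnone, hedge, hoff, hmk, hmk1⟩ := ih
      (hp.mono (Set.Iic_subset_Iic.2 (by omega))) (fun t ht => hcol t (by omega))
    have hinj : ∀ s t, s ≤ k + 2 → t ≤ k + 2 → p s = p t → s = t := fun s t hs ht h =>
      hp (Set.mem_Iic.2 hs) (Set.mem_Iic.2 ht) h
    have hedge_ne : ∀ s t, s < t → t ≤ k + 1 → s(p t, p (t + 1)) ≠ s(p s, p (s + 1)) := by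
      intro s t hst ht h
      rcases Sym2.eq_iff.1 h with ⟨h, _⟩ | ⟨_, h⟩
      · have := hinj _ _ (by omega) (by omega) h; omega
      · have := hinj _ _ (by omega) (by omega) h; omega
    have hc : ψ (p (k + 1)) (p (k + 2)) = some (d (k + 1)) := by
      rw [hoff, hcol k (by omega)]
      exact fun t ht => hedge_ne t (k + 1) (by omega) le_rfl
    have hadj : G.Adj (p k) (p (k + 1)) := by
      cases k with
      | zero => exact h0
      | succ k => exact hφ.adj (hcol k (by omega))
    obtain ⟨χ, hχ, hsh', hc1, hc2, hoff'⟩ := hψ.exists_shift hadj hnone hc hmk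
    refine ⟨χ, hχ, hsh.trans hsh', hc2, ?_, ?_, ?_, ?_⟩
    · intro t ht
      rcases Nat.lt_succ_iff_lt_or_eq.1 ht with h | rfl
      · rw [hoff', hedge t h]
        · exact (hedge_ne t k h (by omega)).symm
        · exact (hedge_ne t (k + 1) (by omega) le_rfl).symm
      · exact hc1
    · intro u v h
      rw [hoff' _ _ (h k (by omega)) (h (k + 1) le_rfl), hoff _ _ fun t ht => h t (by omega)]
    · intro w h
      by_cases h1 : s(p (k + 1), w) = s(p k, p (k + 1))
      · rw [hχ.eq_of_sym2 h1, hc1] at h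
        exact hdne _ (Option.some.inj h)
      · by_cases h2 : s(p (k + 1), w) = s(p (k + 1), p (k + 2))
        · rw [hχ.eq_of_sym2 h2, hc2] at h; cases h
        · rw [hoff' _ _ h1 h2, hd] at h
          exact hmk1 w h
    · intro w h
      by_cases h2 : s(p (k + 2), w) = s(p (k + 1), p (k + 2))
      · rw [hχ.eq_of_sym2 h2, hc2] at h; cases h
      · have h1 : s(p (k + 2), w) ≠ s(p k, p (k + 1)) := by
          intro h1
          rcases Sym2.eq_iff.1 h1 with ⟨h, _⟩ | ⟨h, _⟩
          · have := hinj _ _ (by omega) (by omega) h; omega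
          · have := hinj _ _ (by omega) (by omega) h; omega
        rw [hoff' _ _ h1 h2] at h
        refine h2 ?_
        rw [hψ.symm] at hc
        rw [hψ.inj h hc, Sym2.eq_swap]

end PartialColoring

/-! ### Alternating walks -/

section AlternatingWalk

variable {V κ : Type*}

/-- The alternating sequence of colours `c, c', c, c', …`. -/
def alt (c c' : κ) (t : ℕ) : κ := if Even t then c else c'

theorem alt_zero (c c' : κ) : alt c c' 0 = c := by simp [alt]

theorem alt_one (c c' : κ) : alt c c' 1 = c' := by simp [alt]

theorem alt_congr (c c' : κ) {s t : ℕ} (h : Even s ↔ Even t) : alt c c' s = alt c c' t := by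
  simp only [alt, h]

theorem alt_add_two (c c' : κ) (t : ℕ) : alt c c' (t + 2) = alt c c' t :=
  alt_congr c c' (by simp [Nat.even_add])

theorem alt_ne {c c' : κ} (h : c ≠ c') {s t : ℕ} (hst : ¬(Even s ↔ Even t)) :
    alt c c' s ≠ alt c c' t := by
  unfold alt
  by_cases hs : Even s <;> by_cases ht : Even t <;> simp_all [h.symm]

theorem alt_ne_succ {c c' : κ} (h : c ≠ c') (t : ℕ) : alt c c' t ≠ alt c c' (t + 1) :=
  alt_ne h (by rw [Nat.even_add_one]; tauto)

theorem alt_mem (c c' : κ) (t : ℕ) : alt c c' t = c ∨ alt c c' t = c' := by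
  unfold alt; split_ifs <;> simp

theorem alt_alt (c c' : κ) (i s : ℕ) :
    alt (alt c c' i) (alt c c' (i + 1)) s = alt c c' (i + s) := by
  by_cases hs : Even s
  · rw [alt, if_pos hs]; exact alt_congr _ _ (by simp [Nat.even_add, hs])
  · rw [alt, if_neg hs]; exact alt_congr _ _ (by simp [Nat.even_add, hs])

open Classical in
/-- The neighbour of `v` along the edge of colour `c`, or `v` itself if `c` is missing at `v`. -/
noncomputable def colorNbr (φ : V → V → Option κ) (c : κ) (v : V) : V :=
  if h : ∃ w, φ v w = some c then h.choose else v

/-- The walk from `v` along edges of the colours `c, c', c, c', …`; a step whose colour is missing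
does not move. -/
noncomputable def altWalk (φ : V → V → Option κ) (c c' : κ) (v : V) : ℕ → V
  | 0 => v
  | t + 1 => colorNbr φ (alt c c' t) (altWalk φ c c' v t)

open Classical in
/-- The vertex at which the alternating walk from `w` gets stuck for the first time. If an
alternating path passes `w`, this recovers one of its ends from `w`. -/
noncomputable def walkEnd (φ : V → V → Option κ) (c c' : κ) (w : V) : V :=
  if h : ∃ t, Missing φ (altWalk φ c c' w t) (alt c c' t) then altWalk φ c c' w (Nat.find h) else w

/-- `W 0, …, W n` is an alternating path whose edges have the colours `c, c', c, …` and which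
cannot be prolonged beyond `W 0`. -/
structure IsAltPath (φ : V → V → Option κ) (c c' : κ) (W : ℕ → V) (n : ℕ) : Prop where
  ne : c ≠ c'
  start : Missing φ (W 0) c'
  edge : ∀ t < n, φ (W t) (W (t + 1)) = some (alt c c' t)

variable {G : SimpleGraph V} {φ ψ : V → V → Option κ} {c c' : κ} {W : ℕ → V} {n : ℕ}

theorem colorNbr_eq (hφ : IsPartialColoring G φ) {v w : V} (h : φ v w = some c) :
    colorNbr φ c v = w := by
  have h' : ∃ w, φ v w = some c := ⟨w, h⟩
  rw [colorNbr, dif_pos h']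
  exact hφ.inj h'.choose_spec h

theorem colorNbr_spec {v : V} (h : ¬ Missing φ v c) : φ v (colorNbr φ c v) = some c := by
  have h' : ∃ w, φ v w = some c := by simpa [Missing] using h
  rw [colorNbr, dif_pos h']
  exact h'.choose_spec

theorem altWalk_eq (hφ : IsPartialColoring G φ)
    (h : ∀ t < n, φ (W t) (W (t + 1)) = some (alt c c' t)) :
    ∀ t ≤ n, altWalk φ c c' (W 0) t = W t := by
  intro t
  induction t with
  | zero => exact fun _ => rfl
  | succ t ih =>
    intro ht
    rw [altWalk, ih (by omega)]
    exact colorNbr_eq hφ (h t (by omega))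

theorem walkEnd_eq_of_missing (hφ : IsPartialColoring G φ)
    (h : ∀ t < n, φ (W t) (W (t + 1)) = some (alt c c' t)) (hn : Missing φ (W n) (alt c c' n)) :
    walkEnd φ c c' (W 0) = W n := by
  classical
  have hwalk := altWalk_eq hφ h
  rw [← hwalk n le_rfl] at hn
  have hex : ∃ t, Missing φ (altWalk φ c c' (W 0) t) (alt c c' t) := ⟨n, hn⟩
  have hfind : Nat.find hex = n := by
    rw [Nat.find_eq_iff]
    refine ⟨hn, fun s hs hmiss => ?_⟩
    rw [hwalk s hs.le] at hmiss
    exact hmiss _ (h s hs)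
  unfold walkEnd
  rw [dif_pos hex, ← hwalk n le_rfl]
  convert rfl using 2
  convert hfind.symm

theorem IsAltPath.walkEnd_eq (hφ : IsPartialColoring G φ) (h : IsAltPath φ c c' W n) :
    walkEnd φ (alt c c' (n + 1)) (alt c c' n) (W n) = W 0 := by
  have halt : ∀ s, alt (alt c c' (n + 1)) (alt c c' n) s = alt c c' (n + 1 + s) := by
    intro s
    rw [← alt_add_two c c' n]
    exact alt_alt c c' (n + 1) s
  have hstep : ∀ s < n, φ (W (n - s)) (W (n - (s + 1))) =
      some (alt (alt c c' (n + 1)) (alt c c' n) s) := by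
    intro s hs
    have := h.edge (n - (s + 1)) (by omega)
    rw [show n - (s + 1) + 1 = n - s by omega, hφ.symm] at this
    rw [this, halt]
    refine congrArg some (alt_congr _ _ ?_)
    rw [show n + 1 + s = (n - (s + 1)) + 2 * (s + 1) by omega]
    simp [Nat.even_add]
  have hn : Missing φ (W (n - n)) (alt (alt c c' (n + 1)) (alt c c' n) n) := by
    rw [halt, Nat.sub_self, show n + 1 + n = 2 * n + 1 by ring,
      show alt c c' (2 * n + 1) = c' by simp [alt]]
    exact h.start
  have := walkEnd_eq_of_missing (W := fun s => W (n - s)) hφ hstep hn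
  simpa using this

theorem IsAltPath.injOn (hφ : IsPartialColoring G φ) (h : IsAltPath φ c c' W n) :
    Set.InjOn W (Set.Iic n) := by
  have hloop : ∀ t < n, W t ≠ W (t + 1) := fun t ht => (hφ.adj (h.edge t ht)).ne
  -- equal parity: move both indices down
  have hsame : ∀ s k, s + 2 * k ≤ n → 0 < k → W s ≠ W (s + 2 * k) := by
    intro s
    induction s with
    | zero =>
      intro k hk hk0 he
      obtain ⟨k, rfl⟩ : ∃ j, k = j + 1 := ⟨k - 1, by omega⟩
      have := h.edge (2 * k + 1) (by omega)
      rw [hφ.symm, show 2 * k + 1 + 1 = 0 + 2 * (k + 1) by ring, ← he,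
        show alt c c' (2 * k + 1) = c' by simp [alt]] at this
      exact h.start _ this
    | succ s ih =>
      intro k hk hk0 he
      have h1 := h.edge s (by omega)
      have h2 := h.edge (s + 2 * k) (by omega)
      rw [hφ.symm] at h1 h2
      rw [show s + 2 * k + 1 = s + 1 + 2 * k by ring, ← he,
        alt_congr c c' (s := s + 2 * k) (t := s) (by simp [Nat.even_add])] at h2
      exact ih k (by omega) hk0 (hφ.inj h1 h2)
  -- different parity: move the indices towards each other
  have hdiff : ∀ k s, s + (2 * k + 1) ≤ n → W s ≠ W (s + (2 * k + 1)) := by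
    intro k
    induction k with
    | zero => exact fun s hs => hloop s (by omega)
    | succ k ih =>
      intro s hs he
      have h1 := h.edge s (by omega)
      have h2 := h.edge (s + 2 * (k + 1)) (by omega)
      rw [hφ.symm] at h2
      rw [show s + 2 * (k + 1) + 1 = s + (2 * (k + 1) + 1) by ring, ← he,
        alt_congr c c' (s := s + 2 * (k + 1)) (t := s) (by simp [Nat.even_add])] at h2
      have := hφ.inj h1 h2
      rw [show s + 2 * (k + 1) = s + 1 + (2 * k + 1) by ring] at this
      exact ih (s + 1) (by omega) this
  have hlt : ∀ s t, s < t → t ≤ n → W s ≠ W t := by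
    intro s t hst ht
    rcases Nat.even_or_odd' (t - s) with ⟨k, hk | hk⟩
    · rw [show t = s + 2 * k by omega]; exact hsame s k (by omega) (by omega)
    · rw [show t = s + (2 * k + 1) by omega]; exact hdiff k s (by omega)
  intro s hs t ht he
  rcases lt_trichotomy s t with hst | hst | hst
  · exact absurd he (hlt s t hst ht)
  · exact hst
  · exact absurd he.symm (hlt t s hst hs)

/-- The oriented edges `(x, y)` such that a neighbour of `x` is `w` or an end of an alternating
path through `w`. -/
noncomputable def candidates [DecidableEq V] [Fintype κ] (nb : V → Finset V)
    (φ : V → V → Option κ) (w : V) : Finset (V × V) :=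
  (insert w (Finset.univ.image fun p : κ × κ => walkEnd φ p.1 p.2 w)).biUnion fun z =>
    (nb z).biUnion fun x => (nb x).image fun y => (x, y)

theorem card_candidates_le [DecidableEq V] [Fintype κ] {nb : V → Finset V} {D : ℕ}
    (hD : ∀ v, (nb v).card ≤ D) (φ : V → V → Option κ) (w : V) :
    (candidates nb φ w).card ≤ (Fintype.card κ ^ 2 + 1) * D ^ 2 := by
  unfold candidates
  refine (Finset.card_biUnion_le_card_mul _ _ (D ^ 2) fun z _ => ?_).trans ?_
  · refine (Finset.card_biUnion_le_card_mul _ _ D fun x _ =>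
      Finset.card_image_le.trans (hD x)).trans ?_
    rw [pow_two]
    exact Nat.mul_le_mul_right _ (hD z)
  · refine Nat.mul_le_mul_right _ ((Finset.card_insert_le _ _).trans ?_)
    refine Nat.add_le_add_right (Finset.card_image_le.trans ?_) 1
    simp [pow_two]

theorem mem_candidates [DecidableEq V] [Fintype κ] {nb : V → Finset V}
    {x y z : V} (hz : x ∈ nb z) (hy : y ∈ nb x) : (x, y) ∈ candidates nb φ z := by
  simp only [candidates, Finset.mem_biUnion, Finset.mem_image]
  exact ⟨z, Finset.mem_insert_self _ _, x, hz, y, hy, rfl⟩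

theorem IsAltPath.mem_candidates [DecidableEq V] [Fintype κ] {nb : V → Finset V}
    (hφ : IsPartialColoring G φ) (h : IsAltPath φ c c' W n)
    {x y : V} (hz : x ∈ nb (W 0)) (hy : y ∈ nb x) : (x, y) ∈ candidates nb φ (W n) := by
  simp only [candidates, Finset.mem_biUnion, Finset.mem_image]
  refine ⟨W 0, Finset.mem_insert_of_mem ?_, x, hz, y, hy, rfl⟩
  exact Finset.mem_image.2 ⟨(_, _), Finset.mem_univ _, h.walkEnd_eq hφ⟩

end AlternatingWalk

/-! ### Vizing chains -/

section VizingChain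

variable {V κ : Type*}

/-- The ball of radius `r` around `x` in `G`, given by walks of length at most `r`. -/
def graphBall (G : SimpleGraph V) (x : V) (r : ℕ) : Set V := {y | ∃ p : G.Walk x y, p.length ≤ r}

theorem mem_graphBall_self (G : SimpleGraph V) (x : V) (r : ℕ) : x ∈ graphBall G x r :=
  ⟨SimpleGraph.Walk.nil, by simp⟩

theorem graphBall_mono (G : SimpleGraph V) (x : V) {r s : ℕ} (h : r ≤ s) :
    graphBall G x r ⊆ graphBall G x s := fun _ ⟨p, hp⟩ => ⟨p, hp.trans h⟩

theorem graphBall_trans {G : SimpleGraph V} {x y z : V} {r s : ℕ} (h : y ∈ graphBall G x r)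
    (h' : z ∈ graphBall G y s) : z ∈ graphBall G x (r + s) := by
  obtain ⟨p, hp⟩ := h
  obtain ⟨q, hq⟩ := h'
  exact ⟨p.append q, by rw [SimpleGraph.Walk.length_append]; omega⟩

theorem graphBall_symm {G : SimpleGraph V} {x y : V} {r : ℕ} (h : y ∈ graphBall G x r) :
    x ∈ graphBall G y r := by
  obtain ⟨p, hp⟩ := h
  exact ⟨p.reverse, by simpa using hp⟩

theorem mem_graphBall_one {G : SimpleGraph V} {x y : V} (h : G.Adj x y) : y ∈ graphBall G x 1 :=
  ⟨h.toWalk, by simp⟩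

theorem graphBall_adj {G : SimpleGraph V} {x y z : V} {r : ℕ} (h : y ∈ graphBall G x r)
    (h' : G.Adj y z) : z ∈ graphBall G x (r + 1) := graphBall_trans h (mem_graphBall_one h')

/-- The uncoloured edge `xy` can be coloured by changing `φ` only inside the ball of radius `r`
around `x`, without uncolouring any edge. -/
def Augmentable (G : SimpleGraph V) (φ : V → V → Option κ) (x y : V) (r : ℕ) : Prop :=
  ∃ ψ, IsPartialColoring G ψ ∧
    (∀ u v, ¬(u ∈ graphBall G x r ∧ v ∈ graphBall G x r) → ψ u v = φ u v) ∧
    Covers G φ s(x, y) ψ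

/-- The sequence `x, W 0, W 1, …`. -/
def prepend (x : V) (W : ℕ → V) : ℕ → V
  | 0 => x
  | t + 1 => W t

/-- `ψ` arises from `φ` by moving the uncoloured edge from `xy` to `xz`, changing colours at `x`
only, and the colour `γ` remains missing at `x`. -/
structure IsFanShift (G : SimpleGraph V) (φ : V → V → Option κ) (x y z : V) (γ : κ)
    (ψ : V → V → Option κ) : Prop where
  coloring : IsPartialColoring G ψ
  shifted : Shifted G φ s(x, y) ψ s(x, z)
  uncolored : ψ x z = none
  off : ∀ u v, u ≠ x → v ≠ x → ψ u v = φ u v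
  missing : Missing ψ x γ

variable {G : SimpleGraph V} {φ ψ : V → V → Option κ} {x y z : V} {γ δ : κ} {W : ℕ → V} {k : ℕ}

/-- A fan shift followed by `k` shifts along an alternating path that starts at the last leaf of the
fan and avoids the centre `x`. -/
theorem IsFanShift.exists_chain_shift (hψ : IsFanShift G φ x y (W 0) γ ψ) (hxz : G.Adj x (W 0))
    (hW : IsAltPath φ γ δ W k) (hφ : IsPartialColoring G φ) (hx : ∀ t ≤ k, W t ≠ x) :
    ∃ χ, IsPartialColoring G χ ∧
      Shifted G φ s(x, y) χ s(prepend x W k, W k) ∧ χ (prepend x W k) (W k) = none ∧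
      (∀ t < k, χ (prepend x W t) (W t) = some (alt γ δ t)) ∧
      (∀ u v, u ≠ x → v ≠ x → (∀ t < k, s(u, v) ≠ s(W t, W (t + 1))) → χ u v = φ u v) ∧
      (∀ v, v ≠ W 0 → χ x v = ψ x v) ∧
      Missing χ (prepend x W k) (alt γ δ k) ∧ Missing χ (W k) (alt γ δ (k + 1)) := by
  have hinj := hW.injOn hφ
  have hp : Set.InjOn (prepend x W) (Set.Iic (k + 1)) := by
    intro s hs t ht h
    simp only [Set.mem_Iic] at hs ht
    cases s with
    | zero =>
      cases t with
      | zero => rfl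
      | succ t => exact absurd h.symm (hx t (by omega))
    | succ s =>
      cases t with
      | zero => exact absurd h (hx s (by omega))
      | succ t => exact congrArg _ (hinj (Set.mem_Iic.2 (by omega)) (Set.mem_Iic.2 (by omega)) h)
  have hd2 : ∀ t, alt γ δ (t + 1 + 1) = alt γ δ t := alt_add_two γ δ
  obtain ⟨χ, h1, h2, h3, h4, h5, h6, h7⟩ := hψ.coloring.exists_path_shift (prepend x W)
    (fun t => alt γ δ (t + 1)) (fun t => alt_add_two γ δ (t + 1)) (fun t => alt_ne_succ hW.ne _)
    hxz hψ.uncolored (by simpa only [hd2, alt_zero, prepend] using hψ.missing)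
    (by
      rw [alt_one]
      intro w hw
      by_cases hwx : w = x
      · rw [hwx, hψ.coloring.symm] at hw
        change ψ x (W 0) = _ at hw
        rw [hψ.uncolored] at hw; cases hw
      · exact hW.start w ((hψ.off _ _ (hx 0 (Nat.zero_le _)) hwx).symm.trans hw)) k hp
    (by
      intro t ht
      change ψ (W t) (W (t + 1)) = _
      rw [hψ.off _ _ (hx t ht.le) (hx (t + 1) ht), hW.edge t ht, hd2])
  simp only [hd2] at h4 h6 h7
  refine ⟨χ, h1, hψ.shifted.trans h2, h3, h4, ?_, ?_, h6, h7⟩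
  · intro u v hu hv h
    rw [h5, hψ.off u v hu hv]
    intro t ht he
    cases t with
    | zero => rcases Sym2.eq_iff.1 he with ⟨h, _⟩ | ⟨_, h⟩ <;> contradiction
    | succ t => exact h t (by omega) he
  · intro v hv
    refine h5 _ _ fun t ht he => ?_
    cases t with
    | zero => exact hv (Sym2.congr_right.1 he)
    | succ t =>
      rcases Sym2.eq_iff.1 he with ⟨h, _⟩ | ⟨h, _⟩
      · exact hx t (by omega) h.symm
      · exact hx (t + 1) (by omega) h.symm

theorem mem_graphBall_of_walk (hxz : G.Adj x (W 0)) (hφ : IsPartialColoring G φ)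
    (hW : ∀ t < k, φ (W t) (W (t + 1)) = some (alt γ δ t)) :
    ∀ t ≤ k, W t ∈ graphBall G x (t + 1) := by
  intro t
  induction t with
  | zero => exact fun _ => mem_graphBall_one hxz
  | succ t ih => exact fun ht => graphBall_adj (ih (by omega)) (hφ.adj (hW t (by omega)))

/-- Colours are changed by a chain shift near `x` only. -/
theorem mem_graphBall_of_change {χ : V → V → Option κ} (hφ : IsPartialColoring G φ)
    (hχ : IsPartialColoring G χ) (hxz : G.Adj x (W 0))
    (hW : ∀ t < k, φ (W t) (W (t + 1)) = some (alt γ δ t))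
    {u v : V} (h : χ u v ≠ φ u v)
    (hc : u = x ∨ v = x ∨ ∃ t < k, s(u, v) = s(W t, W (t + 1))) :
    u ∈ graphBall G x (k + 1) ∧ v ∈ graphBall G x (k + 1) := by
  have hadj : G.Adj u v := by
    cases h1 : χ u v with
    | some c => exact hχ.adj h1
    | none =>
      cases h2 : φ u v with
      | some c => exact hφ.adj h2
      | none => exact absurd (h1.trans h2.symm) h
  have hb := mem_graphBall_of_walk hxz hφ hW
  have h1 := mem_graphBall_self G x (k + 1)
  rcases hc with rfl | rfl | ⟨t, ht, he⟩
  · exact ⟨h1, graphBall_mono _ _ (by omega) (mem_graphBall_one hadj)⟩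
  · exact ⟨graphBall_mono _ _ (by omega) (mem_graphBall_one hadj.symm), h1⟩
  · have h2 := graphBall_mono G x (show t + 1 ≤ k + 1 by omega) (hb t ht.le)
    have h3 := graphBall_mono G x (show t + 1 + 1 ≤ k + 1 by omega) (hb (t + 1) ht)
    rcases Sym2.eq_iff.1 he with ⟨rfl, rfl⟩ | ⟨rfl, rfl⟩
    exacts [⟨h2, h3⟩, ⟨h3, h2⟩]

/-- If the alternating path from the last leaf of a fan ends before reaching the centre, then
shifting the whole chain makes room for the uncoloured edge. -/
theorem IsFanShift.augmentable (hψ : IsFanShift G φ x y (W 0) γ ψ) (hxz : G.Adj x (W 0))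
    (hW : IsAltPath φ γ δ W k) (hφ : IsPartialColoring G φ) (hx : ∀ t ≤ k, W t ≠ x)
    (hend : Missing φ (W k) (alt γ δ k)) (hψend : ψ x (W k) ≠ some (alt γ δ k)) :
    Augmentable G φ x y (k + 1) := by
  obtain ⟨χ, h1, h2, h3, h4, h5, h6, h7, h8⟩ := hψ.exists_chain_shift hxz hW hφ hx
  have hinj := hW.injOn hφ
  have hadj : G.Adj (prepend x W k) (W k) := by
    cases k with
    | zero => exact hxz
    | succ k => exact hφ.adj (hW.edge k (by omega))
  have hm : Missing χ (W k) (alt γ δ k) := by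
    intro w hw
    by_cases he : s(W k, w) = s(prepend x W k, W k)
    · rw [h1.eq_of_sym2 he, h3] at hw; cases hw
    · by_cases hwx : w = x
      · rw [hwx, h1.symm] at hw
        by_cases hk : W k = W 0
        · have : k = 0 := hinj (Set.mem_Iic.2 le_rfl) (Set.mem_Iic.2 (by omega)) hk
          subst this
          exact he (by rw [hwx, Sym2.eq_swap]; rfl)
        · rw [h6 _ hk] at hw
          exact hψend hw
      · rw [h5 _ _ (hx k le_rfl) hwx] at hw
        · exact hend w hw
        · intro t ht ht'
          rcases Sym2.eq_iff.1 ht' with ⟨h, _⟩ | ⟨h, h'⟩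
          · have := hinj (Set.mem_Iic.2 le_rfl) (Set.mem_Iic.2 (by omega)) h; omega
          · have : k = t + 1 := hinj (Set.mem_Iic.2 le_rfl) (Set.mem_Iic.2 (by omega)) h
            subst this
            exact he (by rw [h', Sym2.eq_swap]; rfl)
  have hχ' := h1.color hadj h7 hm
  refine ⟨_, hχ', fun u v huv => ?_, h2.covers (covers_recolor _ _ _)⟩
  by_contra hne
  refine huv (mem_graphBall_of_change hφ hχ' hxz hW.edge hne ?_)
  by_contra! hcon
  refine hne ?_
  rw [recolor_of_ne, h5 u v hcon.1 hcon.2.1 hcon.2.2]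
  intro he
  cases k with
  | zero => rcases Sym2.eq_iff.1 he with ⟨h, _⟩ | ⟨_, h⟩
            exacts [hcon.1 h, hcon.2.1 h]
  | succ k => exact hcon.2.2 k (by omega) he

end VizingChain

/-! ### The existence of long Vizing chains -/

section VizingExtension

variable {V κ : Type*} {G : SimpleGraph V} {φ ψ : V → V → Option κ} {x y z : V} {γ δ : κ}
  {W : ℕ → V} {ℓ : ℕ}

/-- Data for prolonging a multi-step Vizing chain from the uncoloured edge `xy`: a fan around `x`
that ends with the leaf `z`, and an alternating walk from `z` in the colours `γ, δ, γ, …` that does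
not get stuck within `ℓ` steps before reaching `x`.

The optional pair `ab = (α, β)` holds the colours of the preceding alternating path, `α` being
missing at `x` and `β` at `y`. Either the new colours are different from them, or they are the same
in the same order and the fan is not trivial; the second case is the one in which the new walk
may run into `x`. -/
structure IsExtension (G : SimpleGraph V) (φ : V → V → Option κ) (x y : V) (ab : Option (κ × κ))
    (ℓ : ℕ) (z : V) (γ δ : κ) : Prop where
  adj : G.Adj x z
  start : Missing φ z δ
  center : Missing φ x γ
  ne : γ ≠ δ
  shift : ∃ ψ, IsFanShift G φ x y z γ ψ
  edge : ∀ t < ℓ, (∀ s ≤ t, altWalk φ γ δ z s ≠ x) →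
    φ (altWalk φ γ δ z t) (altWalk φ γ δ z (t + 1)) = some (alt γ δ t)
  colors : ((∀ t ≤ ℓ, altWalk φ γ δ z t ≠ x) ∧
      ∀ α β, ab = some (α, β) → γ ≠ α ∧ γ ≠ β ∧ δ ≠ α ∧ δ ≠ β) ∨
    ∃ α β, ab = some (α, β) ∧ γ = α ∧ δ = β ∧ z ≠ y

theorem Augmentable.mono {r s : ℕ} (h : Augmentable G φ x y r) (hrs : r ≤ s) :
    Augmentable G φ x y s := by
  obtain ⟨ψ, h1, h2, h3⟩ := h
  exact ⟨ψ, h1, fun u v huv => h2 u v fun h =>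
    huv ⟨graphBall_mono _ _ hrs h.1, graphBall_mono _ _ hrs h.2⟩, h3⟩

theorem augmentable_of_missing (hφ : IsPartialColoring G φ) (hxy : G.Adj x y) {c : κ}
    (hx : Missing φ x c) (hy : Missing φ y c) : Augmentable G φ x y 1 := by
  refine ⟨_, hφ.color hxy hx hy, fun u v huv => recolor_of_ne (fun he => huv ?_) _,
    covers_recolor _ _ _⟩
  have h1 := mem_graphBall_self G x 1
  have h2 := mem_graphBall_one hxy
  rcases Sym2.eq_iff.1 he with ⟨rfl, rfl⟩ | ⟨rfl, rfl⟩
  exacts [⟨h1, h2⟩, ⟨h2, h1⟩]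

theorem exists_missing [DecidableEq V] [Fintype κ] (φ : V → V → Option κ) (v : V) (A : Finset V)
    (hA : ∀ w c, φ v w = some c → w ∈ A) (F : Finset κ) (h : A.card + F.card < Fintype.card κ) :
    ∃ c, c ∉ F ∧ Missing φ v c := by
  classical
  by_contra! hcon
  have hsub : (Finset.univ : Finset (Option κ)) ⊆
      insert none (F.image some ∪ A.image (φ v)) := by
    intro o _
    cases o with
    | none => exact Finset.mem_insert_self _ _
    | some c =>
      refine Finset.mem_insert_of_mem (Finset.mem_union.2 ?_)
      by_cases hc : c ∈ F
      · exact Or.inl (Finset.mem_image_of_mem _ hc)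
      · have := hcon c hc
        simp only [Missing, not_forall, not_not] at this
        obtain ⟨w, hw⟩ := this
        exact Or.inr (Finset.mem_image.2 ⟨w, hA w c hw, hw⟩)
  have h1 := Finset.card_le_card hsub
  have h2 := Finset.card_insert_le none (F.image some ∪ A.image (φ v))
  have h3 := Finset.card_union_le (F.image some) (A.image (φ v))
  have h4 : (F.image some).card ≤ F.card := Finset.card_image_le
  have h5 : (A.image (φ v)).card ≤ A.card := Finset.card_image_le
  rw [Finset.card_univ, Fintype.card_option] at h1
  omega

/-- After a fan shift to `z`, the alternating walk from `z` cannot get stuck before reaching the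
centre, unless it ends at an earlier leaf of the fan that received the colour `δ`. -/
theorem IsFanShift.altWalk_edge (hψ : IsFanShift G φ x y z γ ψ) (hφ : IsPartialColoring G φ)
    (hxz : G.Adj x z) (hz : Missing φ z δ) (hne : γ ≠ δ)
    (hn : ¬ Augmentable G φ x y (ℓ + 1))
    (hfresh : ∀ t < ℓ, IsAltPath φ γ δ (altWalk φ γ δ z) t → (∀ s ≤ t, altWalk φ γ δ z s ≠ x) →
      alt γ δ t = δ → Missing φ (altWalk φ γ δ z t) δ → ψ x (altWalk φ γ δ z t) ≠ some δ) :
    ∀ t < ℓ, (∀ s ≤ t, altWalk φ γ δ z s ≠ x) →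
      φ (altWalk φ γ δ z t) (altWalk φ γ δ z (t + 1)) = some (alt γ δ t) := by
  intro t
  induction t using Nat.strong_induction_on with
  | _ t ih =>
    intro ht hx
    have hW : IsAltPath φ γ δ (altWalk φ γ δ z) t :=
      ⟨hne, hz, fun s hs => ih s hs (by omega) fun r hr => hx r (by omega)⟩
    by_contra hcon
    have hm : Missing φ (altWalk φ γ δ z t) (alt γ δ t) := by
      by_contra hm
      exact hcon (colorNbr_spec hm)
    refine hn ((IsFanShift.augmentable (W := altWalk φ γ δ z) hψ hxz hW hφ hx hm ?_).mono
      (by omega))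
    rcases alt_mem γ δ t with h | h
    · rw [h, hψ.coloring.symm]
      intro h'
      rw [hψ.coloring.symm] at h'
      exact hψ.missing _ h'
    · rw [h]
      rw [h] at hm
      exact hfresh t ht hW hx h hm

/-- The sequence of leaves of a maximal fan around `x`: each leaf is joined to `x` by the colour
that `μ` chooses at the preceding leaf. -/
noncomputable def fanSeq (φ : V → V → Option κ) (μ : V → κ) (x y : V) : ℕ → V
  | 0 => y
  | k + 1 => colorNbr φ (μ (fanSeq φ μ x y k)) x

/-- The first `k + 1` leaves form a fan. -/
structure IsFan (φ : V → V → Option κ) (μ : V → κ) (x y : V) (k : ℕ) : Prop where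
  injOn : Set.InjOn (fanSeq φ μ x y) (Set.Iic k)
  edge : ∀ l < k, φ x (fanSeq φ μ x y (l + 1)) = some (μ (fanSeq φ μ x y l))

variable {μ : V → κ} {k : ℕ}

theorem IsFan.mono {l : ℕ} (h : IsFan φ μ x y k) (hl : l ≤ k) : IsFan φ μ x y l :=
  ⟨h.injOn.mono (Set.Iic_subset_Iic.2 hl), fun i hi => h.edge i (by omega)⟩

theorem IsFan.adj (h : IsFan φ μ x y k) (hφ : IsPartialColoring G φ) (hxy : G.Adj x y) :
    G.Adj x (fanSeq φ μ x y k) := by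
  cases k with
  | zero => exact hxy
  | succ k => exact hφ.adj (h.edge k (by omega))

theorem IsFan.exists_fanShift (h : IsFan φ μ x y k) (hφ : IsPartialColoring G φ) (hxy : G.Adj x y)
    (hn : φ x y = none) (hμ : ∀ v, Missing φ v (μ v)) (hγ : Missing φ x γ) :
    ∃ ψ, IsFanShift G φ x y (fanSeq φ μ x y k) γ ψ ∧
      ∀ v c, Missing φ v c → ψ x v = some c → ∃ l < k, v = fanSeq φ μ x y l ∧ μ v = c := by
  obtain ⟨ψ, h1, h2, h3, h4, h5, h6, h7⟩ := hφ.exists_fan_shift (fanSeq φ μ x y)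
    (fun l => μ (fanSeq φ μ x y l)) hxy hn k h.injOn h.edge fun l _ => hμ _
  refine ⟨ψ, ⟨h1, h2, h3, h4, h6 γ hγ⟩, fun v c hv hc => ?_⟩
  by_cases hl : ∃ l ≤ k, v = fanSeq φ μ x y l
  · obtain ⟨l, hl, rfl⟩ := hl
    rcases hl.lt_or_eq with hl | rfl
    · refine ⟨l, hl, rfl, ?_⟩
      rw [h7 l hl] at hc
      exact Option.some.inj hc
    · rw [h3] at hc; cases hc
  · push Not at hl
    rw [h5 v hl, hφ.symm] at hc
    exact absurd hc (hv x)

/-- If `xy` cannot be coloured by local changes, no leaf of a fan shares a missing colour with the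
centre. -/
theorem IsFan.not_missing (h : IsFan φ μ x y k) (hφ : IsPartialColoring G φ) (hxy : G.Adj x y)
    (hn : φ x y = none) (hμ : ∀ v, Missing φ v (μ v)) (hna : ¬ Augmentable G φ x y (ℓ + 1)) :
    ¬ Missing φ x (μ (fanSeq φ μ x y k)) := by
  intro hm
  obtain ⟨ψ, hψ, hψ'⟩ := h.exists_fanShift hφ hxy hn hμ hm
  have hxz := h.adj hφ hxy
  have hmz : Missing ψ (fanSeq φ μ x y k) (μ (fanSeq φ μ x y k)) := by
    intro w hw
    by_cases hwx : w = x
    · rw [hwx, hψ.coloring.symm, hψ.uncolored] at hw; cases hw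
    · rw [hψ.off _ _ hxz.ne' hwx] at hw
      exact hμ _ _ hw
  have hcol := hψ.coloring.color hxz hψ.missing hmz
  refine hna (Augmentable.mono (r := 1) ⟨_, hcol, fun u v huv => ?_,
    hψ.shifted.covers (covers_recolor _ _ _)⟩ (by omega))
  by_contra hne
  refine huv (mem_graphBall_of_change (W := fun _ => fanSeq φ μ x y k) (γ := μ x) (δ := μ x)
    (k := 0) hφ hcol hxz (fun t ht => absurd ht (by omega)) hne ?_)
  by_contra! hcon
  refine hne ?_
  rw [recolor_of_ne, hψ.off _ _ hcon.1 hcon.2.1]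
  intro he
  rcases Sym2.eq_iff.1 he with ⟨h, _⟩ | ⟨_, h⟩
  exacts [hcon.1 h, hcon.2.1 h]

/-- In a non-augmentable situation the fan can be continued until its last leaf repeats the chosen
colour of an earlier leaf. -/
theorem exists_fan_repetition (hφ : IsPartialColoring G φ) (hxy : G.Adj x y)
    (hn : φ x y = none) (hμ : ∀ v, Missing φ v (μ v)) (hna : ¬ Augmentable G φ x y (ℓ + 1))
    (hfin : (G.neighborSet x).Finite) :
    ∃ i j, j < i ∧ IsFan φ μ x y i ∧ μ (fanSeq φ μ x y i) = μ (fanSeq φ μ x y j) ∧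
      ∀ l < i, μ (fanSeq φ μ x y l) = μ (fanSeq φ μ x y j) → l = j := by
  have hfan : ∀ k, Set.InjOn (fanSeq φ μ x y) (Set.Iic k) → IsFan φ μ x y k := by
    intro k
    induction k with
    | zero => exact fun h => ⟨h, fun l hl => absurd hl (by omega)⟩
    | succ k ih =>
      intro h
      have hk := ih (h.mono (Set.Iic_subset_Iic.2 (by omega)))
      refine ⟨h, fun l hl => ?_⟩
      exact colorNbr_spec ((hk.mono (by omega : l ≤ k)).not_missing hφ hxy hn hμ hna)
  have hex : ∃ k, ¬ Set.InjOn (fanSeq φ μ x y) (Set.Iic k) := by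
    by_contra! hall
    refine Set.infinite_of_injective_forall_mem (f := fanSeq φ μ x y) (s := G.neighborSet x)
      (fun s t h => ?_) (fun k => (hfan k (hall k)).adj hφ hxy) hfin
    exact hall (max s t) (Set.mem_Iic.2 (le_max_left _ _)) (Set.mem_Iic.2 (le_max_right _ _)) h
  classical
  obtain ⟨hk, hlt⟩ := (Nat.find_eq_iff hex).1 rfl
  obtain ⟨i, hi⟩ : ∃ i, Nat.find hex = i + 1 := by
    refine ⟨Nat.find hex - 1, ?_⟩
    have : Nat.find hex ≠ 0 := by
      intro h0
      rw [h0] at hk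
      refine hk fun s hs t ht _ => ?_
      simp only [Set.mem_Iic] at hs ht
      omega
    omega
  rw [hi] at hk hlt
  have hinj : Set.InjOn (fanSeq φ μ x y) (Set.Iic i) := by
    by_contra h; exact hlt i (by omega) h
  have hF := hfan i hinj
  have hedge : ∀ l ≤ i, φ x (fanSeq φ μ x y (l + 1)) = some (μ (fanSeq φ μ x y l)) := fun l hl =>
    colorNbr_spec ((hF.mono hl).not_missing hφ hxy hn hμ hna)
  obtain ⟨j', hj', hje⟩ : ∃ j' ≤ i, fanSeq φ μ x y (i + 1) = fanSeq φ μ x y j' := by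
    by_contra! hcon
    refine hk fun s hs t ht h => ?_
    simp only [Set.mem_Iic] at hs ht
    rcases Nat.lt_or_ge s (i + 1) with h1 | h1 <;> rcases Nat.lt_or_ge t (i + 1) with h2 | h2
    · exact hinj (Set.mem_Iic.2 (by omega)) (Set.mem_Iic.2 (by omega)) h
    · obtain rfl : t = i + 1 := by omega
      exact absurd h.symm (hcon s (by omega))
    · obtain rfl : s = i + 1 := by omega
      exact absurd h (hcon t (by omega))
    · omega
  obtain ⟨j, rfl⟩ : ∃ j, j' = j + 1 := by
    cases j' with
    | zero =>
      have := hedge i le_rfl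
      rw [hje] at this
      change φ x y = _ at this
      rw [hn] at this; cases this
    | succ j => exact ⟨j, rfl⟩
  have hij : μ (fanSeq φ μ x y i) = μ (fanSeq φ μ x y j) := by
    have h1 := hedge i le_rfl
    rw [hje, hedge j (by omega)] at h1
    exact (Option.some.inj h1).symm
  refine ⟨i, j, by omega, hF, hij, fun l hl h => ?_⟩
  have h1 := hedge l hl.le
  rw [h, ← hedge j (by omega)] at h1
  have h2 : fanSeq φ μ x y (l + 1) = fanSeq φ μ x y (j + 1) := by
    rw [hedge j (by omega)] at h1
    exact hφ.inj h1 (hedge j (by omega))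
  have := hinj (Set.mem_Iic.2 (by omega)) (Set.mem_Iic.2 (by omega)) h2
  omega

/-- Vizing's argument, in local form: if the uncoloured edge `xy` cannot be coloured by changes near
`x`, then there is a fan around `x` followed by a long alternating walk. -/
theorem exists_extension [DecidableEq V] [Fintype κ] (hφ : IsPartialColoring G φ)
    {nb : V → Finset V} (hnb : ∀ v w, w ∈ nb v ↔ G.Adj v w)
    (hdeg : ∀ v, (nb v).card < Fintype.card κ) (hxy : G.Adj x y) (hn : φ x y = none)
    (ab : Option (κ × κ))
    (hab : ∀ α β, ab = some (α, β) → Missing φ x α ∧ Missing φ y β)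
    (hna : ¬ Augmentable G φ x y (ℓ + 1)) : ∃ z γ δ, IsExtension G φ x y ab ℓ z γ δ := by
  classical
  have hadj : ∀ v w c, φ v w = some c → w ∈ nb v := fun v w c h => (hnb v w).2 (hφ.adj h)
  have two : ∀ v u, G.Adj v u → φ v u = none → ∀ F : Finset κ, F.card ≤ 1 →
      ∃ c, c ∉ F ∧ Missing φ v c := by
    intro v u hvu h0 F hF
    refine exists_missing φ v ((nb v).erase u) (fun w c h => ?_) F ?_
    · refine Finset.mem_erase.2 ⟨?_, hadj v w c h⟩
      rintro rfl
      rw [h0] at h; cases h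
    · have h1 := Finset.card_erase_of_mem ((hnb v u).2 hvu)
      have h2 := hdeg v
      have h3 := Finset.card_pos.2 ⟨u, (hnb v u).2 hvu⟩
      omega
  have hny : φ y x = none := by rw [hφ.symm, hn]
  -- a missing colour at every vertex, different from `β` at `y`
  obtain ⟨μ, hμ, hμy⟩ : ∃ μ : V → κ, (∀ v, Missing φ v (μ v)) ∧
      ∀ α β, ab = some (α, β) → μ y ≠ β := by
    have h1 : ∀ v, ∃ c, Missing φ v c := fun v => by
      obtain ⟨c, _, h⟩ := exists_missing φ v (nb v) (hadj v) ∅ (by simpa using hdeg v)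
      exact ⟨c, h⟩
    choose μ hμ using h1
    obtain ⟨c, hcF, hc⟩ := two y x hxy.symm hny ((ab.map Prod.snd).toFinset)
      (by cases ab <;> simp)
    refine ⟨Function.update μ y c, fun v => ?_, fun α β h => ?_⟩
    · by_cases hv : v = y
      · subst hv; rwa [Function.update_self]
      · rw [Function.update_of_ne hv]; exact hμ v
    · rw [Function.update_self]
      rintro rfl
      exact hcF (by simp [h])
  obtain ⟨i, j, hji, hF, hij, hfresh⟩ := exists_fan_repetition hφ hxy hn hμ hna
    ((nb x).finite_toSet.subset fun w hw => (hnb x w).2 hw)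
  have hxmiss : ∀ l ≤ i, ¬ Missing φ x (μ (fanSeq φ μ x y l)) := fun l hl =>
    (hF.mono hl).not_missing hφ hxy hn hμ hna
  by_cases hβ : ∃ α β, ab = some (α, β) ∧ ∃ k ≤ i, μ (fanSeq φ μ x y k) = β
  · obtain ⟨α, β, rfl, hex⟩ := hβ
    obtain ⟨⟨hki, hkβ⟩, hlt⟩ := (Nat.find_eq_iff hex).1 rfl
    generalize Nat.find hex = k at hki hkβ hlt
    have hFk := hF.mono hki
    have hα := (hab α β rfl).1
    obtain ⟨ψ, hψ, hψ'⟩ := hFk.exists_fanShift hφ hxy hn hμ hα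
    have hne : α ≠ β := by
      rintro rfl; exact hxmiss k hki (hkβ ▸ hα)
    have hmz : Missing φ (fanSeq φ μ x y k) β := hkβ ▸ hμ _
    refine ⟨_, α, β, hFk.adj hφ hxy, hmz, hα, hne, ⟨ψ, hψ⟩,
      hψ.altWalk_edge hφ (hFk.adj hφ hxy) hmz hne hna ?_, Or.inr ⟨α, β, rfl, rfl, rfl, ?_⟩⟩
    · intro t _ _ _ _ hm hc
      obtain ⟨l, hl, hv, hμl⟩ := hψ' _ _ hm hc
      exact hlt l hl ⟨by omega, hv ▸ hμl⟩
    · intro h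
      have h0 : k = 0 := hFk.injOn (Set.mem_Iic.2 le_rfl) (Set.mem_Iic.2 (by omega)) h
      subst h0
      exact hμy α β rfl hkβ
  · push Not at hβ
    obtain ⟨γ, hγF, hγ⟩ := two x y hxy hn ((ab.map Prod.fst).toFinset) (by cases ab <;> simp)
    set δ := μ (fanSeq φ μ x y j) with hδ
    have hδx : ¬ Missing φ x δ := hxmiss j hji.le
    have hne : γ ≠ δ := by rintro h; exact hδx (h ▸ hγ)
    have hcolors : ∀ α β, ab = some (α, β) → γ ≠ α ∧ γ ≠ β ∧ δ ≠ α ∧ δ ≠ β := by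
      intro α β h
      refine ⟨?_, ?_, ?_, hβ α β h j hji.le⟩
      · rintro rfl; exact hγF (by simp [h])
      · rintro rfl
        exact hna ((augmentable_of_missing hφ hxy hγ (hab α γ h).2).mono (by omega))
      · intro h'
        exact hδx (h' ▸ (hab α β h).1)
    have hFj := hF.mono hji.le
    obtain ⟨ψj, hψj, hψj'⟩ := hFj.exists_fanShift hφ hxy hn hμ hγ
    obtain ⟨ψi, hψi, hψi'⟩ := hF.exists_fanShift hφ hxy hn hμ hγ
    have hzj : Missing φ (fanSeq φ μ x y j) δ := hμ _
    have hzi : Missing φ (fanSeq φ μ x y i) δ := hij ▸ hμ _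
    have hxj := hFj.adj hφ hxy
    have hxi := hF.adj hφ hxy
    have hedgej := hψj.altWalk_edge hφ hxj hzj hne hna (by
      intro t _ _ _ _ hm hc
      obtain ⟨l, hl, hv, hμl⟩ := hψj' _ _ hm hc
      have := hfresh l (by omega) (hv ▸ hμl)
      omega)
    by_cases hU : ∀ t ≤ ℓ, altWalk φ γ δ (fanSeq φ μ x y j) t ≠ x
    · exact ⟨_, γ, δ, hxj, hzj, hγ, hne, ⟨ψj, hψj⟩, hedgej, Or.inl ⟨hU, hcolors⟩⟩
    -- the walk from `y_j` ends at `x`, so the walk from `y_i` cannot meet `x` or `y_j`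
    have hends : ∀ w, G.Adj x w → (∀ t < ℓ, (∀ s ≤ t, altWalk φ γ δ w s ≠ x) →
        φ (altWalk φ γ δ w t) (altWalk φ γ δ w (t + 1)) = some (alt γ δ t)) →
        Missing φ w δ → ¬ (∀ t ≤ ℓ, altWalk φ γ δ w t ≠ x) →
        walkEnd φ γ δ w = x ∧ walkEnd φ δ γ x = w := by
      intro w hw hedge hwδ hU
      push Not at hU
      obtain ⟨⟨hsℓ, hsx⟩, hlt⟩ := (Nat.find_eq_iff hU).1 rfl
      generalize Nat.find hU = s at hsℓ hsx hlt
      have hlt' : ∀ t < s, altWalk φ γ δ w t ≠ x := fun t ht h => hlt t ht ⟨by omega, h⟩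
      have hP : IsAltPath φ γ δ (altWalk φ γ δ w) s :=
        ⟨hne, hwδ, fun t ht => hedge t (by omega) fun r hr => hlt' r (by omega)⟩
      have hs0 : s ≠ 0 := by
        rintro rfl
        exact hw.ne hsx.symm
      obtain ⟨r, rfl⟩ : ∃ r, s = r + 1 := ⟨s - 1, by omega⟩
      have hr := hP.edge r (by omega)
      rw [hsx, hφ.symm] at hr
      have hodd : ¬ Even r := fun h => hγ _ (by rw [hr, alt, if_pos h])
      have heven : Even (r + 1) := Nat.even_add_one.2 hodd
      have hstuck : Missing φ (altWalk φ γ δ w (r + 1)) (alt γ δ (r + 1)) := by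
        rw [hsx, alt, if_pos heven]; exact hγ
      refine ⟨(walkEnd_eq_of_missing hφ hP.edge hstuck).trans hsx, ?_⟩
      have := hP.walkEnd_eq hφ
      rw [hsx, alt, if_neg (fun h => hodd (by simpa [Nat.even_add_one] using h)), alt,
        if_pos heven] at this
      exact this
    have hj := hends _ hxj hedgej hzj hU
    have hedgei := hψi.altWalk_edge hφ hxi hzi hne hna (by
      intro t _ hP _ hδt hm hc
      obtain ⟨l, hl, hv, hμl⟩ := hψi' _ _ hm hc
      obtain rfl := hfresh l (by omega) (hv ▸ hμl)
      have h1 := hP.walkEnd_eq hφ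
      have hodd : ¬ Even t := by
        intro h
        rw [alt, if_pos h] at hδt
        exact hne hδt
      rw [alt, if_pos (Nat.even_add_one.2 hodd), hδt, hv, hj.1] at h1
      exact hxi.ne h1)
    by_cases hU' : ∀ t ≤ ℓ, altWalk φ γ δ (fanSeq φ μ x y i) t ≠ x
    · exact ⟨_, γ, δ, hxi, hzi, hγ, hne, ⟨ψi, hψi⟩, hedgei, Or.inl ⟨hU', hcolors⟩⟩
    · exfalso
      have hi := hends _ hxi hedgei hzi hU'
      have h2 := hi.2.symm.trans hj.2
      have := hF.injOn (Set.mem_Iic.2 le_rfl) (Set.mem_Iic.2 hji.le) h2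
      omega

end VizingExtension

/-! ### Multi-step Vizing chains -/

section Truncation

variable {V κ : Type*} {G : SimpleGraph V} {φ χ : V → V → Option κ} {x y : V} {γ δ : κ}
  {W : ℕ → V} {a : ℕ}

/-- The colouring `χ` arises from `φ` by a fan shift around `x` followed by shifting along the
alternating path `W` until its edge `W a, W (a + 1)` is uncoloured. -/
structure IsTruncation (G : SimpleGraph V) (φ : V → V → Option κ) (x y : V) (W : ℕ → V) (γ δ : κ)
    (a : ℕ) (χ : V → V → Option κ) : Prop where
  coloring : IsPartialColoring G χ
  shifted : Shifted G φ s(x, y) χ s(W a, W (a + 1))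
  uncolored : χ (W a) (W (a + 1)) = none
  change : ∀ u v, χ u v ≠ φ u v → u = x ∨ v = x ∨ ∃ t < a + 1, s(u, v) = s(W t, W (t + 1))
  first : χ x (W 0) = some γ
  edge : ∀ t < a, χ (W t) (W (t + 1)) = some (alt γ δ (t + 1))
  missing_left : Missing χ (W a) (alt γ δ (a + 1))
  missing_right : Missing χ (W (a + 1)) (alt γ δ a)

theorem exists_truncation {ψ : V → V → Option κ} (hψ : IsFanShift G φ x y (W 0) γ ψ)
    (hxz : G.Adj x (W 0)) (hW : IsAltPath φ γ δ W (a + 1)) (hφ : IsPartialColoring G φ)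
    (hx : ∀ t ≤ a + 1, W t ≠ x) : ∃ χ, IsTruncation G φ x y W γ δ a χ := by
  obtain ⟨χ, h1, h2, h3, h4, h5, -, h7, h8⟩ := hψ.exists_chain_shift hxz hW hφ hx
  refine ⟨χ, h1, h2, h3, fun u v h => ?_, h4 0 (by omega), fun t ht => h4 (t + 1) (by omega), h7,
    by rwa [alt_add_two] at h8⟩
  by_contra! hcon
  exact h (h5 u v hcon.1 hcon.2.1 hcon.2.2)

/-- A colour that becomes missing by a truncated chain shift does so near the centre of the fan or
at the end of the chain. -/
theorem IsTruncation.missing (h : IsTruncation G φ x y W γ δ a χ) (hφ : IsPartialColoring G φ)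
    (hxz : G.Adj x (W 0)) (hW : ∀ t < a + 1, φ (W t) (W (t + 1)) = some (alt γ δ t))
    {v : V} {c : κ} (hc : Missing χ v c) :
    Missing φ v c ∨ (v = x ∨ G.Adj x v) ∨ v = W a ∨ (v = W (a + 1) ∧ c = alt γ δ a) := by
  by_cases hm : Missing φ v c
  · exact Or.inl hm
  right
  simp only [Missing, not_forall, not_not] at hm
  obtain ⟨w, hw⟩ := hm
  rcases h.change v w (by rw [hw]; exact hc w) with rfl | rfl | ⟨t, ht, he⟩
  · exact Or.inl (Or.inl rfl)
  · exact Or.inl (Or.inr (hφ.adj hw).symm)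
  · have hct : c = alt γ δ t := by
      rw [hφ.eq_of_sym2 he, hW t ht] at hw
      exact (Option.some.inj hw).symm
    rcases Sym2.eq_iff.1 he with ⟨rfl, rfl⟩ | ⟨rfl, rfl⟩
    · cases t with
      | zero => exact Or.inl (Or.inr hxz)
      | succ t =>
        refine absurd ?_ (hc (W t))
        rw [h.coloring.symm, h.edge t (by omega), hct]
    · rcases lt_trichotomy (t + 1) a with h1 | h1 | h1
      · refine absurd ?_ (hc (W (t + 1 + 1)))
        rw [h.edge (t + 1) h1, hct]
        exact congrArg some (alt_add_two γ δ t)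
      · subst h1; exact Or.inr (Or.inl rfl)
      · obtain rfl : t = a := by omega
        exact Or.inr (Or.inr ⟨rfl, hct⟩)

/-- A colour on an edge that is changed by a truncated chain shift. -/
theorem IsTruncation.color (h : IsTruncation G φ x y W γ δ a χ) {u v : V} {c : κ}
    (hc : χ u v = some c) :
    φ u v = some c ∨ (u = x ∨ G.Adj x u) ∨
      ∃ t < a, s(u, v) = s(W t, W (t + 1)) ∧ c = alt γ δ (t + 1) := by
  by_cases he : φ u v = some c
  · exact Or.inl he
  right
  rcases h.change u v (by rw [hc]; exact Ne.symm he) with rfl | rfl | ⟨t, ht, he⟩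
  · exact Or.inl (Or.inl rfl)
  · exact Or.inl (Or.inr (h.coloring.adj hc).symm)
  · right
    rw [h.coloring.eq_of_sym2 he] at hc
    rcases Nat.lt_succ_iff_lt_or_eq.1 ht with h1 | rfl
    · exact ⟨t, h1, he, by rw [h.edge t h1] at hc; exact (Option.some.inj hc).symm⟩
    · rw [h.uncolored] at hc; cases hc

/-- The last colour of the path is present at every vertex of its shifted part. -/
theorem IsTruncation.not_missing (h : IsTruncation G φ x y W γ δ a χ) {k : ℕ} (hk : k ≤ a) :
    ¬ Missing χ (W k) (alt γ δ a) := by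
  intro hm
  by_cases hp : Even a ↔ Even k
  · rw [alt_congr γ δ hp] at hm
    cases k with
    | zero => exact hm x (by rw [h.coloring.symm, h.first, alt_zero])
    | succ k => exact hm (W k) (by rw [h.coloring.symm, h.edge k (by omega)])
  · have : k ≠ a := by rintro rfl; exact hp Iff.rfl
    refine hm (W (k + 1)) ?_
    rw [h.edge k (by omega)]
    exact congrArg some (alt_congr γ δ (by rw [Nat.even_add_one]; tauto))

/-- The shifted part of the path can be entered along an edge of one of the two colours only
through the centre of the fan. -/
theorem IsTruncation.neighbor (h : IsTruncation G φ x y W γ δ a χ) {k : ℕ} (hk : k ≤ a)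
    {u : V} {c : κ} (hcd : c = γ ∨ c = δ) (hc : χ u (W k) = some c) :
    u = x ∨ ∃ k' ≤ a, u = W k' := by
  rw [h.coloring.symm] at hc
  have hck : c = alt γ δ k ∨ c = alt γ δ (k + 1) := by
    unfold alt
    by_cases hp : Even k
    · rw [if_pos hp, if_neg (by simpa [Nat.even_add_one] using hp)]; exact hcd
    · rw [if_neg hp, if_pos (Nat.even_add_one.2 hp)]; exact hcd.symm
  rcases hck with rfl | rfl
  · cases k with
    | zero =>
      rw [alt_zero] at hc
      exact Or.inl (h.coloring.inj hc (by rw [h.coloring.symm, h.first]))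
    | succ k =>
      exact Or.inr ⟨k, by omega, h.coloring.inj hc (by rw [h.coloring.symm, h.edge k (by omega)])⟩
  · rcases hk.lt_or_eq with hk | rfl
    · exact Or.inr ⟨k + 1, by omega, h.coloring.inj hc (h.edge k hk)⟩
    · exact absurd hc (h.missing_left u)

end Truncation

section MultiStep

variable {V κ : Type*}

/-- The result of a multi-step Vizing chain: the current colouring, the oriented uncoloured edge
`(x, y)`, and the two colours of the last alternating path (the first one missing at `x`, the second
one at `y`). -/
structure ChainState (V κ : Type*) where
  col : V → V → Option κ
  x : V
  y : V
  ab : Option (κ × κ)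

/-- The data on which multi-step Vizing chains depend: a graph with its neighbourhoods as finite
sets, a partial colouring `φ`, an uncoloured edge `x₀y₀`, and the bound `ℓ` on the length of the
alternating paths. -/
structure ChainBase (V κ : Type*) where
  G : SimpleGraph V
  nb : V → Finset V
  φ : V → V → Option κ
  x₀ : V
  y₀ : V
  ℓ : ℕ

namespace ChainBase

variable [Nonempty κ] (B : ChainBase V κ)

/-- The chosen extension `(z, γ, δ)` of a chain. -/
noncomputable def ext (s : ChainState V κ) : V × κ × κ :=
  haveI : Nonempty V := ⟨B.x₀⟩
  Classical.epsilon fun p => IsExtension B.G s.col s.x s.y s.ab B.ℓ p.1 p.2.1 p.2.2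

theorem ext_spec {B : ChainBase V κ} {s : ChainState V κ}
    (h : ∃ z γ δ, IsExtension B.G s.col s.x s.y s.ab B.ℓ z γ δ) :
    IsExtension B.G s.col s.x s.y s.ab B.ℓ (B.ext s).1 (B.ext s).2.1 (B.ext s).2.2 := by
  obtain ⟨z, γ, δ, h⟩ := h
  exact Classical.epsilon_spec
    (p := fun p : V × κ × κ => IsExtension B.G s.col s.x s.y s.ab B.ℓ p.1 p.2.1 p.2.2)
    ⟨(z, γ, δ), h⟩

/-- The alternating walk along which a chain is prolonged. -/
noncomputable def walk (s : ChainState V κ) (t : ℕ) : V :=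
  altWalk s.col (B.ext s).2.1 (B.ext s).2.2 (B.ext s).1 t

/-- `s'` prolongs the chain `s` by its chosen extension, truncated at the `a`-th edge `e` of the
alternating walk. -/
structure IsStep (s : ChainState V κ) (e : V × V) (a : ℕ) (s' : ChainState V κ) : Prop where
  lt : a < B.ℓ
  left : e.1 = B.walk s a
  right : e.2 = B.walk s (a + 1)
  x : s'.x = e.1
  y : s'.y = e.2
  ab : s'.ab = some (alt (B.ext s).2.1 (B.ext s).2.2 (a + 1), alt (B.ext s).2.1 (B.ext s).2.2 a)
  truncation : IsTruncation B.G s.col s.x s.y (B.walk s) (B.ext s).2.1 (B.ext s).2.2 a s'.col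

open Classical in
/-- The chain `s` prolonged up to the edge `e`. -/
noncomputable def next (s : ChainState V κ) (e : V × V) : ChainState V κ :=
  haveI : Nonempty (ChainState V κ) := ⟨s⟩
  Classical.epsilon fun s' => ∃ a, B.IsStep s e a s'

/-- A multi-step chain is recorded by the list of the places of its uncoloured edge, the most recent
one first and the initial edge omitted. -/
noncomputable def state : List (V × V) → ChainState V κ
  | [] => ⟨B.φ, B.x₀, B.y₀, none⟩
  | e :: h => B.next (state h) e

variable [DecidableEq V]

/-- The closed neighbourhood of the current fan centre. -/
noncomputable def center (h : List (V × V)) : Finset V :=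
  insert (B.state h).x (B.nb (B.state h).x)

/-- All vertices that the next step of the chain may touch. -/
noncomputable def trace (h : List (V × V)) : Finset V :=
  B.center h ∪ (Finset.range (B.ℓ + 1)).image (B.walk (B.state h))

/-- All vertices touched by the steps of the chain. -/
noncomputable def touched : List (V × V) → Finset V
  | [] => ∅
  | _ :: h => B.trace h ∪ touched h

/-- The vertices that the next alternating walk should avoid: those touched by the chain, except
that of the last step only the neighbourhood of the fan centre counts. -/
noncomputable def forbidden : List (V × V) → Finset V
  | [] => ∅
  | _ :: h => B.center h ∪ B.touched h

/-- The next alternating walk avoids the forbidden vertices. -/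
def Good (h : List (V × V)) : Prop := ∀ t ≤ B.ℓ, B.walk (B.state h) t ∉ B.forbidden h

/-- Non-overlapping multi-step chains. -/
inductive IsChain : List (V × V) → Prop
  | nil : IsChain []
  | cons {h : List (V × V)} {a : ℕ} (hh : IsChain h) (hg : B.Good h) (ha : a < B.ℓ) :
      IsChain ((B.walk (B.state h) a, B.walk (B.state h) (a + 1)) :: h)

/-- Away from the touched vertices, a chain has not changed the colouring. -/
structure Traced (h : List (V × V)) : Prop where
  missing : ∀ v c, Missing (B.state h).col v c → Missing B.φ v c ∨ v ∈ B.touched h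
  color : ∀ u v c, (B.state h).col u v = some c → B.φ u v = some c ∨ u ∈ B.touched h

/-- The properties of non-overlapping chains that are maintained by induction. -/
structure Valid (h : List (V × V)) : Prop where
  coloring : IsPartialColoring B.G (B.state h).col
  adj : B.G.Adj (B.state h).x (B.state h).y
  uncolored : (B.state h).col (B.state h).x (B.state h).y = none
  ab : ∀ α β, (B.state h).ab = some (α, β) →
    Missing (B.state h).col (B.state h).x α ∧ Missing (B.state h).col (B.state h).y β
  shifted : Shifted B.G B.φ s(B.x₀, B.y₀) (B.state h).col s((B.state h).x, (B.state h).y)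
  mem_ball : (B.state h).x ∈ graphBall B.G B.x₀ (B.ℓ * h.length)
  change : ∀ u v, (B.state h).col u v ≠ B.φ u v →
    u ∈ graphBall B.G B.x₀ (B.ℓ * h.length + 1) ∧ v ∈ graphBall B.G B.x₀ (B.ℓ * h.length + 1)
  traced : B.Traced h
  extension : IsExtension B.G (B.state h).col (B.state h).x (B.state h).y (B.state h).ab B.ℓ
    (B.ext (B.state h)).1 (B.ext (B.state h)).2.1 (B.ext (B.state h)).2.2

/-- The induction hypothesis about the last step of a chain. -/
def LastStep : List (V × V) → Prop
  | [] => True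
  | e :: h => B.Valid h ∧ B.Good h ∧ (∀ t ≤ B.ℓ, B.walk (B.state h) t ≠ (B.state h).x) ∧
      ∃ a, B.IsStep (B.state h) e a (B.state (e :: h))

variable {B} {h : List (V × V)}

theorem mem_center (hnb : ∀ v w, w ∈ B.nb v ↔ B.G.Adj v w) {v : V} :
    v ∈ B.center h ↔ v = (B.state h).x ∨ B.G.Adj (B.state h).x v := by
  rw [center, Finset.mem_insert, hnb]

theorem walk_mem_trace {t : ℕ} (ht : t ≤ B.ℓ) : B.walk (B.state h) t ∈ B.trace h :=
  Finset.mem_union_right _ (Finset.mem_image_of_mem _ (Finset.mem_range.2 (by omega)))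

/-- While the alternating walk of a chain avoids the forbidden vertices, it does not meet the
current fan centre, and it is an alternating path of the original colouring. -/
theorem Valid.isAltPath (hv : B.Valid h) (hl : B.LastStep h)
    (hnb : ∀ v w, w ∈ B.nb v ↔ B.G.Adj v w) {i : ℕ} (hi : i ≤ B.ℓ + 1)
    (havoid : ∀ t < i, B.walk (B.state h) t ∉ B.forbidden h) :
    (∀ t < i, B.walk (B.state h) t ≠ (B.state h).x) ∧
      (0 < i → ∀ j ≤ i, j ≤ B.ℓ → IsAltPath B.φ (B.ext (B.state h)).2.1 (B.ext (B.state h)).2.2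
        (B.walk (B.state h)) j) := by
  have hE := hv.extension
  cases h with
  | nil =>
    have hav : ∀ t ≤ B.ℓ, B.walk (B.state []) t ≠ (B.state []).x := by
      rcases hE.colors with h | ⟨α, β, h, _⟩
      · exact h.1
      · cases h
    exact ⟨fun t ht => hav t (by omega), fun _ j hj hjℓ => ⟨hE.ne, hE.start, fun t ht =>
      hE.edge t (by omega) fun s hs => hav s (by omega)⟩⟩
  | cons e h =>
    obtain ⟨hv1, -, hav1, a, hs⟩ := hl
    have hT := hs.truncation
    have hE1 := hv1.extension
    have hW1 : ∀ t < a + 1, (B.state h).col (B.walk (B.state h) t) (B.walk (B.state h) (t + 1)) =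
        some (alt (B.ext (B.state h)).2.1 (B.ext (B.state h)).2.2 t) := fun t ht =>
      hE1.edge t (by have := hs.lt; omega) fun s hst => hav1 s (by have := hs.lt; omega)
    have hx : (B.state (e :: h)).x = B.walk (B.state h) a := hs.x.trans hs.left
    have hy : (B.state (e :: h)).y = B.walk (B.state h) (a + 1) := hs.y.trans hs.right
    have hcenter : ∀ t < i, ¬ (B.walk (B.state (e :: h)) t = (B.state h).x ∨
        B.G.Adj (B.state h).x (B.walk (B.state (e :: h)) t)) := fun t ht hc =>
      havoid t ht (Finset.mem_union_left _ ((mem_center hnb).2 hc))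
    have htouched : ∀ t < i, B.walk (B.state (e :: h)) t ∉ B.touched h := fun t ht hc =>
      havoid t ht (Finset.mem_union_right _ hc)
    have hsab := hs.ab
    generalize (B.ext (B.state h)).2.1 = γ₁ at hsab hT hE1 hW1
    generalize (B.ext (B.state h)).2.2 = δ₁ at hsab hT hE1 hW1
    have hedge' := hE.edge
    change ∀ t < B.ℓ, (∀ s ≤ t, B.walk (B.state (e :: h)) s ≠ _) → (B.state (e :: h)).col
      (B.walk (B.state (e :: h)) t) (B.walk (B.state (e :: h)) (t + 1)) = _ at hedge'
    -- with the colours of the last step, the walk does not enter the shifted part of the last path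
    have key : (∀ t < i, B.walk (B.state (e :: h)) t ≠ (B.state (e :: h)).x) ∧
        ∀ t < i, ∀ k < a, ∀ v, B.walk (B.state (e :: h)) t = v →
          (v = B.walk (B.state h) k ∨ v = B.walk (B.state h) (k + 1)) →
          alt γ₁ δ₁ (k + 1) = (B.ext (B.state (e :: h))).2.1 ∨
          alt γ₁ δ₁ (k + 1) = (B.ext (B.state (e :: h))).2.2 → False := by
      rcases hE.colors with ⟨hav, hcol⟩ | ⟨α, β, hab, hγα, hδβ, hzy⟩
      · refine ⟨fun t ht => hav t (by omega), fun t ht k hk v _ _ hcc => ?_⟩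
        obtain ⟨h1, h2, h3, h4⟩ := hcol _ _ hsab
        have : alt γ₁ δ₁ (k + 1) = alt γ₁ δ₁ (a + 1) ∨ alt γ₁ δ₁ (k + 1) = alt γ₁ δ₁ a := by
          by_cases hp : Even (k + 1) ↔ Even (a + 1)
          · exact Or.inl (alt_congr _ _ hp)
          · exact Or.inr (alt_congr _ _ (by rw [Nat.even_add_one (n := a)] at hp; tauto))
        rcases hcc with h | h <;> rcases this with h' | h'
        exacts [h1 (h.symm.trans h'), h2 (h.symm.trans h'), h3 (h.symm.trans h'),
          h4 (h.symm.trans h')]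
      · have habs := hab.symm.trans hsab
        simp only [Option.some.injEq, Prod.mk.injEq] at habs
        obtain ⟨hα, hβ⟩ := habs
        have hout : ∀ t < i, ∀ k ≤ a, B.walk (B.state (e :: h)) t ≠ B.walk (B.state h) k := by
          intro t
          induction t using Nat.strong_induction_on with
          | _ t ih =>
            intro ht k hk he
            cases t with
            | zero =>
              refine hT.not_missing hk ?_
              rw [← he, ← hβ, ← hδβ]
              exact hE.start
            | succ t =>
              have hxs : ∀ s ≤ t, B.walk (B.state (e :: h)) s ≠ (B.state (e :: h)).x := fun s hs' =>
                hx ▸ ih s (by omega) (by omega) a le_rfl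
              have hed := hedge' t (by omega) hxs
              rw [he] at hed
              have hcc : alt (B.ext (B.state (e :: h))).2.1 (B.ext (B.state (e :: h))).2.2 t = γ₁ ∨
                  alt (B.ext (B.state (e :: h))).2.1 (B.ext (B.state (e :: h))).2.2 t = δ₁ := by
                rcases alt_mem (B.ext (B.state (e :: h))).2.1 (B.ext (B.state (e :: h))).2.2 t
                  with h | h
                · rw [h, hγα, hα]; exact alt_mem _ _ _
                · rw [h, hδβ, hβ]; exact alt_mem _ _ _
              rcases hT.neighbor hk hcc hed with h | ⟨k', hk', h⟩
              · exact hcenter t (by omega) (Or.inl h)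
              · exact ih t (by omega) (by omega) k' hk' h
        refine ⟨fun t ht => hx ▸ hout t ht a le_rfl, fun t ht k hk v hv hor _ => ?_⟩
        rcases hor with h | h
        exacts [hout t ht k (by omega) (hv.trans h), hout t ht (k + 1) (by omega) (hv.trans h)]
    refine ⟨key.1, fun hi0 j hj hjℓ => ⟨hE.ne, ?_, fun t ht => ?_⟩⟩
    · rcases hT.missing hv1.coloring hE1.adj hW1 hE.start with h1 | h1 | h1 | ⟨h1, h2⟩
      · exact (hv1.traced.missing _ _ h1).resolve_right (htouched 0 hi0)
      · exact absurd h1 (hcenter 0 hi0)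
      · exact absurd (h1.trans hx.symm) (key.1 0 hi0)
      · exfalso
        rcases hE.colors with ⟨_, hcol⟩ | ⟨α, β, _, _, _, hzy⟩
        · exact (hcol _ _ hsab).2.2.2 h2
        · exact hzy (h1.trans hy.symm)
    · have hed := hedge' t (by omega) fun s hs => key.1 s (by omega)
      rcases hT.color hed with h1 | h1 | ⟨k, hk, he, hc⟩
      · exact (hv1.traced.color _ _ _ h1).resolve_right (htouched t (by omega))
      · exact absurd h1 (hcenter t (by omega))
      · exfalso
        refine key.2 t (by omega) k hk _ rfl ?_ ?_
        · rcases Sym2.eq_iff.1 he with ⟨h, _⟩ | ⟨h, _⟩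
          exacts [Or.inl h, Or.inr h]
        · rw [← hc]; exact alt_mem _ _ _

end ChainBase

end MultiStep

/-! ### Prolonging multi-step chains -/

section MultiStepExistence

variable {V κ : Type*} [Nonempty κ] [DecidableEq V] {B : ChainBase V κ} {h : List (V × V)}

namespace ChainBase

theorem Valid.walk_ne (hv : B.Valid h) (hl : B.LastStep h)
    (hnb : ∀ v w, w ∈ B.nb v ↔ B.G.Adj v w) (hg : B.Good h) :
    ∀ t ≤ B.ℓ, B.walk (B.state h) t ≠ (B.state h).x := fun t ht =>
  (hv.isAltPath hl hnb (i := B.ℓ + 1) le_rfl fun s hs => hg s (by omega)).1 t (by omega)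

theorem Valid.exists_isStep (hv : B.Valid h)
    (hx : ∀ t ≤ B.ℓ, B.walk (B.state h) t ≠ (B.state h).x) {a : ℕ} (ha : a < B.ℓ) :
    ∃ a', B.IsStep (B.state h) (B.walk (B.state h) a, B.walk (B.state h) (a + 1)) a'
      (B.state ((B.walk (B.state h) a, B.walk (B.state h) (a + 1)) :: h)) := by
  have hE := hv.extension
  obtain ⟨ψ, hψ⟩ := hE.shift
  have hW : IsAltPath (B.state h).col (B.ext (B.state h)).2.1 (B.ext (B.state h)).2.2
      (B.walk (B.state h)) (a + 1) :=
    ⟨hE.ne, hE.start, fun t ht => hE.edge t (by omega) fun s hs => hx s (by omega)⟩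
  obtain ⟨χ, hχ⟩ := exists_truncation (W := B.walk (B.state h)) hψ hE.adj hW hv.coloring
    fun t ht => hx t (by omega)
  have : Nonempty (ChainState V κ) := ⟨B.state h⟩
  exact Classical.epsilon_spec (p := fun s' => ∃ a', B.IsStep (B.state h)
    (B.walk (B.state h) a, B.walk (B.state h) (a + 1)) a' s')
    ⟨⟨χ, _, _, _⟩, a, ha, rfl, rfl, rfl, rfl, rfl, hχ⟩

/-- The uncoloured edge of a chain can be recovered, up to boundedly many possibilities, from any
vertex of the next alternating walk that is not preceded by a forbidden vertex. -/
theorem Valid.mem_candidates [Fintype κ] (hv : B.Valid h) (hl : B.LastStep h)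
    (hφ : IsPartialColoring B.G B.φ)
    (hnb : ∀ v w, w ∈ B.nb v ↔ B.G.Adj v w) {i : ℕ} (hi : i ≤ B.ℓ)
    (havoid : ∀ t < i, B.walk (B.state h) t ∉ B.forbidden h) :
    ((B.state h).x, (B.state h).y) ∈ candidates B.nb B.φ (B.walk (B.state h) i) := by
  have hz : (B.state h).x ∈ B.nb (B.walk (B.state h) 0) :=
    (hnb _ _).2 hv.extension.adj.symm
  have hy : (B.state h).y ∈ B.nb (B.state h).x := (hnb _ _).2 hv.adj
  rcases Nat.eq_zero_or_pos i with rfl | hi0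
  · exact _root_.mem_candidates hz hy
  · exact ((hv.isAltPath hl hnb (by omega) havoid).2 hi0 i le_rfl hi).mem_candidates hφ hz hy

/-- Conditions under which chains exist: `φ` is a partial colouring with more colours than the
maximum degree, and the uncoloured edge `x₀y₀` cannot be coloured by changes in a large ball. -/
structure Blocked [Fintype κ] (B : ChainBase V κ) (M : ℕ) : Prop where
  coloring : IsPartialColoring B.G B.φ
  mem_nb : ∀ v w, w ∈ B.nb v ↔ B.G.Adj v w
  card_lt : ∀ v, (B.nb v).card < Fintype.card κ
  adj : B.G.Adj B.x₀ B.y₀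
  uncolored : B.φ B.x₀ B.y₀ = none
  not_augmentable : ¬ Augmentable B.G B.φ B.x₀ B.y₀ (B.ℓ * (M + 1) + 1)

variable [Fintype κ] {M : ℕ}

/-- A chain of bounded length ends in a situation that is not augmentable, so it can be extended. -/
theorem Blocked.exists_extension (hB : B.Blocked M) {s : ChainState V κ} {m : ℕ} (hm : m ≤ M)
    (hcol : IsPartialColoring B.G s.col) (hadj : B.G.Adj s.x s.y) (hn : s.col s.x s.y = none)
    (hab : ∀ α β, s.ab = some (α, β) → Missing s.col s.x α ∧ Missing s.col s.y β)
    (hsh : Shifted B.G B.φ s(B.x₀, B.y₀) s.col s(s.x, s.y))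
    (hball : s.x ∈ graphBall B.G B.x₀ (B.ℓ * m))
    (hch : ∀ u v, s.col u v ≠ B.φ u v → u ∈ graphBall B.G B.x₀ (B.ℓ * m + 1) ∧
      v ∈ graphBall B.G B.x₀ (B.ℓ * m + 1)) :
    IsExtension B.G s.col s.x s.y s.ab B.ℓ (B.ext s).1 (B.ext s).2.1 (B.ext s).2.2 := by
  have hle : B.ℓ * m + (B.ℓ + 1) ≤ B.ℓ * (M + 1) + 1 := by
    have := Nat.mul_le_mul_left B.ℓ hm
    rw [Nat.mul_add]
    omega
  refine ext_spec (_root_.exists_extension hcol hB.mem_nb hB.card_lt hadj hn s.ab hab fun ha => ?_)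
  obtain ⟨ψ, h1, h2, h3⟩ := ha
  refine hB.not_augmentable ⟨ψ, h1, fun u v huv => ?_, hsh.covers h3⟩
  by_contra hne
  by_cases hs : u ∈ graphBall B.G s.x (B.ℓ + 1) ∧ v ∈ graphBall B.G s.x (B.ℓ + 1)
  · exact huv ⟨graphBall_mono _ _ hle (graphBall_trans hball hs.1),
      graphBall_mono _ _ hle (graphBall_trans hball hs.2)⟩
  · rw [h2 u v hs] at hne
    have := hch u v hne
    exact huv ⟨graphBall_mono _ _ (by omega) this.1, graphBall_mono _ _ (by omega) this.2⟩

theorem Blocked.valid_nil (hB : B.Blocked M) : B.Valid [] := by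
  have hball := mem_graphBall_self B.G B.x₀ (B.ℓ * 0)
  have hab : ∀ α β, (none : Option (κ × κ)) = some (α, β) →
      Missing B.φ B.x₀ α ∧ Missing B.φ B.y₀ β := fun α β h => by cases h
  have hch : ∀ u v, B.φ u v ≠ B.φ u v → u ∈ graphBall B.G B.x₀ (B.ℓ * 0 + 1) ∧
      v ∈ graphBall B.G B.x₀ (B.ℓ * 0 + 1) := fun u v h => absurd rfl h
  exact ⟨hB.coloring, hB.adj, hB.uncolored, hab, Shifted.refl, hball, hch,
    ⟨fun v c h => Or.inl h, fun u v c h => Or.inl h⟩,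
    hB.exists_extension (s := B.state []) (Nat.zero_le M) hB.coloring hB.adj hB.uncolored hab
      Shifted.refl hball hch⟩

theorem Blocked.valid_cons (hB : B.Blocked M) (hv : B.Valid h)
    (hx : ∀ t ≤ B.ℓ, B.walk (B.state h) t ≠ (B.state h).x) {e : V × V} {a : ℕ}
    (hs : B.IsStep (B.state h) e a (B.state (e :: h))) (hM : (e :: h).length ≤ M) :
    B.Valid (e :: h) := by
  have hE := hv.extension
  have hT := hs.truncation
  have ha := hs.lt
  have hex : (B.state (e :: h)).x = B.walk (B.state h) a := hs.x.trans hs.left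
  have hey : (B.state (e :: h)).y = B.walk (B.state h) (a + 1) := hs.y.trans hs.right
  have hedge : ∀ t < a + 1, (B.state h).col (B.walk (B.state h) t) (B.walk (B.state h) (t + 1)) =
      some (alt (B.ext (B.state h)).2.1 (B.ext (B.state h)).2.2 t) := fun t ht =>
    hE.edge t (by omega) fun s hst => hx s (by omega)
  have hadj : B.G.Adj (B.state (e :: h)).x (B.state (e :: h)).y := by
    rw [hex, hey]; exact hv.coloring.adj (hedge a (by omega))
  have hn : (B.state (e :: h)).col (B.state (e :: h)).x (B.state (e :: h)).y = none := by
    rw [hex, hey]; exact hT.uncolored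
  have hab : ∀ α β, (B.state (e :: h)).ab = some (α, β) →
      Missing (B.state (e :: h)).col (B.state (e :: h)).x α ∧
        Missing (B.state (e :: h)).col (B.state (e :: h)).y β := by
    intro α β h'
    have h'' := h'.symm.trans hs.ab
    simp only [Option.some.injEq, Prod.mk.injEq] at h''
    rw [h''.1, h''.2, hex, hey]
    exact ⟨hT.missing_left, hT.missing_right⟩
  have hsh : Shifted B.G B.φ s(B.x₀, B.y₀) (B.state (e :: h)).col
      s((B.state (e :: h)).x, (B.state (e :: h)).y) := by
    rw [hex, hey]; exact hv.shifted.trans hT.shifted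
  have hlen : B.ℓ * (e :: h).length = B.ℓ * h.length + B.ℓ := by
    rw [List.length_cons, Nat.mul_add, Nat.mul_one]
  have hball : (B.state (e :: h)).x ∈ graphBall B.G B.x₀ (B.ℓ * (e :: h).length) := by
    rw [hex, hlen]
    exact graphBall_trans hv.mem_ball (graphBall_mono _ _ (by omega)
      (mem_graphBall_of_walk (W := B.walk (B.state h)) hE.adj hv.coloring hedge a (by omega)))
  have hch : ∀ u v, (B.state (e :: h)).col u v ≠ B.φ u v →
      u ∈ graphBall B.G B.x₀ (B.ℓ * (e :: h).length + 1) ∧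
        v ∈ graphBall B.G B.x₀ (B.ℓ * (e :: h).length + 1) := by
    intro u v huv
    rw [hlen, Nat.add_assoc]
    by_cases h1 : (B.state (e :: h)).col u v = (B.state h).col u v
    · have := hv.change u v (by rwa [h1] at huv)
      exact ⟨graphBall_mono _ _ (by omega) this.1, graphBall_mono _ _ (by omega) this.2⟩
    · have := mem_graphBall_of_change (W := B.walk (B.state h)) hv.coloring hT.coloring hE.adj
        hedge h1 (hT.change u v h1)
      exact ⟨graphBall_trans hv.mem_ball (graphBall_mono _ _ (by omega) this.1),
        graphBall_trans hv.mem_ball (graphBall_mono _ _ (by omega) this.2)⟩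
  have hcen : ∀ v, (v = (B.state h).x ∨ B.G.Adj (B.state h).x v) → v ∈ B.touched (e :: h) :=
    fun v hv' => Finset.mem_union_left _ (Finset.mem_union_left _ ((mem_center hB.mem_nb).2 hv'))
  have hwalk : ∀ t ≤ B.ℓ, B.walk (B.state h) t ∈ B.touched (e :: h) := fun t ht =>
    Finset.mem_union_left _ (walk_mem_trace ht)
  have htr : B.Traced (e :: h) := by
    refine ⟨fun v c hm => ?_, fun u v c hc => ?_⟩
    · rcases hT.missing hv.coloring hE.adj hedge hm with h1 | h1 | rfl | ⟨rfl, -⟩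
      · exact (hv.traced.missing v c h1).imp id fun h2 => Finset.mem_union_right _ h2
      · exact Or.inr (hcen v h1)
      · exact Or.inr (hwalk a ha.le)
      · exact Or.inr (hwalk (a + 1) ha)
    · rcases hT.color hc with h1 | h1 | ⟨t, ht, h1, -⟩
      · exact (hv.traced.color u v c h1).imp id fun h2 => Finset.mem_union_right _ h2
      · exact Or.inr (hcen u h1)
      · right
        rcases Sym2.eq_iff.1 h1 with ⟨rfl, -⟩ | ⟨rfl, -⟩
        exacts [hwalk t (by omega), hwalk (t + 1) (by omega)]
  exact ⟨hT.coloring, hadj, hn, hab, hsh, hball, hch, htr,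
    hB.exists_extension hM hT.coloring hadj hn hab hsh hball hch⟩

theorem IsChain.valid (hc : B.IsChain h) (hB : B.Blocked M) (hM : h.length ≤ M) :
    B.Valid h ∧ B.LastStep h := by
  induction hc with
  | nil => exact ⟨hB.valid_nil, trivial⟩
  | @cons h a hh hg ha ih =>
    obtain ⟨hv, hl⟩ := ih (by rw [List.length_cons] at hM; omega)
    have hx := hv.walk_ne hl hB.mem_nb hg
    obtain ⟨a', hs⟩ := hv.exists_isStep hx ha
    exact ⟨hB.valid_cons hv hx hs hM, hv, hg, hx, a', hs⟩

theorem IsChain.head_eq (hB : B.Blocked M) {e : V × V} (he : B.IsChain (e :: h))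
    (hM : (e :: h).length ≤ M) : ((B.state (e :: h)).x, (B.state (e :: h)).y) = e := by
  obtain ⟨-, -, -, -, a, hs⟩ := he.valid hB hM
  rw [hs.x, hs.y]

end ChainBase

end MultiStepExistence

/-! ### Counting multi-step chains -/

section Counting

variable {V κ : Type*} [DecidableEq V]

/-- The lists of length `d` of oriented edges whose first entry lies in `A` and in which each entry
is a candidate for the first vertex of the entry before it. -/
def pathLists (cand : V → Finset (V × V)) : ℕ → Finset (V × V) → Finset (List (V × V))
  | 0, _ => {[]}
  | d + 1, A => A.biUnion fun e => (pathLists cand d (cand e.1)).image (e :: ·)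

theorem card_pathLists_le {cand : V → Finset (V × V)} {C : ℕ} (hC : ∀ w, (cand w).card ≤ C) (d : ℕ)
    (A : Finset (V × V)) : (pathLists cand (d + 1) A).card ≤ A.card * C ^ d := by
  induction d generalizing A with
  | zero =>
    refine Finset.card_biUnion_le_card_mul _ _ _ fun e _ => Finset.card_image_le.trans ?_
    simp [pathLists]
  | succ d ih =>
    refine Finset.card_biUnion_le_card_mul _ _ _ fun e _ => Finset.card_image_le.trans ?_
    refine (ih _).trans ?_
    rw [pow_succ, mul_comm]
    exact Nat.mul_le_mul_left _ (hC _)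

theorem mem_pathLists {cand : V → Finset (V × V)} {d : ℕ} {A : Finset (V × V)} {e : V × V}
    {p : List (V × V)} (he : e ∈ A) (hp : p ∈ pathLists cand d (cand e.1)) :
    e :: p ∈ pathLists cand (d + 1) A :=
  Finset.mem_biUnion.2 ⟨e, he, Finset.mem_image_of_mem _ hp⟩

namespace ChainBase

variable [Nonempty κ] (B : ChainBase V κ)

open Classical in
/-- The set of all non-overlapping chains with `m` steps. -/
noncomputable def chains : ℕ → Finset (List (V × V))
  | 0 => {[]}
  | m + 1 => ((chains m).filter B.Good).biUnion fun h =>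
      (Finset.range B.ℓ).image fun a => (B.walk (B.state h) a, B.walk (B.state h) (a + 1)) :: h

variable {B} {h : List (V × V)} {m M : ℕ}

theorem isChain_of_mem (hm : h ∈ B.chains m) : B.IsChain h ∧ h.length = m := by
  induction m generalizing h with
  | zero =>
    obtain rfl : h = [] := by simpa [chains] using hm
    exact ⟨IsChain.nil, rfl⟩
  | succ m ih =>
    simp only [chains, Finset.mem_biUnion, Finset.mem_filter, Finset.mem_image,
      Finset.mem_range] at hm
    obtain ⟨h, ⟨hh, hg⟩, a, ha, rfl⟩ := hm
    exact ⟨(ih hh).1.cons hg ha, by rw [List.length_cons, (ih hh).2]⟩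

theorem mem_chains_of_cons {e : V × V} (hm : e :: h ∈ B.chains (m + 1)) : h ∈ B.chains m := by
  simp only [chains, Finset.mem_biUnion, Finset.mem_filter, Finset.mem_image,
    Finset.mem_range] at hm
  obtain ⟨h', ⟨hh, -⟩, a, -, he⟩ := hm
  rwa [← (List.cons.inj he).2]

theorem mem_chains_of_append {p : List (V × V)} (hm : p ++ h ∈ B.chains (p.length + m)) :
    h ∈ B.chains m := by
  induction p with
  | nil => simpa using hm
  | cons e p ih =>
    rw [List.length_cons, Nat.succ_add] at hm
    exact ih (mem_chains_of_cons hm)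

theorem IsChain.of_cons {e : V × V} (h' : B.IsChain (e :: h)) : B.IsChain h := by
  cases h' with
  | cons hh _ _ => exact hh

theorem exists_of_mem_touched {w : V} (hw : w ∈ B.touched h) :
    ∃ p h₂, h = p ++ h₂ ∧ p ≠ [] ∧ w ∈ B.trace h₂ := by
  induction h with
  | nil => simp [touched] at hw
  | cons e h ih =>
    rcases Finset.mem_union.1 hw with h1 | h1
    · exact ⟨[e], h, rfl, by simp, h1⟩
    · obtain ⟨p, h₂, rfl, -, h2⟩ := ih h1
      exact ⟨e :: p, h₂, rfl, by simp, h2⟩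

variable [Fintype κ]

theorem IsChain.mem_candidates {e e' : V × V} (hc : B.IsChain (e :: e' :: h)) (hB : B.Blocked M)
    (hM : (e :: e' :: h).length ≤ M) : e' ∈ candidates B.nb B.φ e.1 := by
  have hM' : (e' :: h).length ≤ M := by
    rw [List.length_cons] at hM; omega
  obtain ⟨-, -, hg, -, a, hs⟩ := hc.valid hB hM
  obtain ⟨hv, hl⟩ := hc.of_cons.valid hB hM'
  have := hv.mem_candidates hl hB.coloring hB.mem_nb hs.lt.le fun t ht =>
    hg t (by have := hs.lt; omega)
  rwa [IsChain.head_eq hB hc.of_cons hM', ← hs.left] at this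

theorem IsChain.mem_pathLists {p : List (V × V)} (hB : B.Blocked M) (hc : B.IsChain (p ++ h))
    (hM : (p ++ h).length ≤ M) (A : Finset (V × V)) (hA : ∀ e ∈ p.head?, e ∈ A) :
    p ∈ pathLists (candidates B.nb B.φ) p.length A := by
  induction p generalizing A with
  | nil => simp [pathLists]
  | cons e p ih =>
    have hM' : (p ++ h).length ≤ M := by
      rw [List.cons_append, List.length_cons] at hM; omega
    refine _root_.mem_pathLists (hA e (by simp)) (ih hc.of_cons hM' _ fun e' he' => ?_)
    cases p with
    | nil => simp at he'
    | cons e'' p =>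
      obtain rfl : e'' = e' := by simpa using he'
      exact hc.mem_candidates hB hM

open Classical in
/-- Every good chain has `ℓ` prolongations. -/
theorem Blocked.card_chains_succ (hB : B.Blocked M) (hm : m ≤ M) :
    (B.chains (m + 1)).card = B.ℓ * ((B.chains m).filter B.Good).card := by
  classical
  have hdisj : Set.PairwiseDisjoint (((B.chains m).filter B.Good : Finset _) : Set (List (V × V)))
      fun h => (Finset.range B.ℓ).image fun a =>
        (B.walk (B.state h) a, B.walk (B.state h) (a + 1)) :: h := by
    intro h _ h' _ hne
    refine Finset.disjoint_left.2 fun l hl hl' => hne ?_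
    obtain ⟨a, -, rfl⟩ := Finset.mem_image.1 hl
    obtain ⟨b, -, hb⟩ := Finset.mem_image.1 hl'
    exact (List.cons.inj hb).2.symm
  rw [chains, Finset.card_biUnion hdisj, mul_comm, ← smul_eq_mul]
  convert Finset.sum_const B.ℓ using 1
  refine Finset.sum_congr rfl fun h hh => ?_
  obtain ⟨hh, hg⟩ := Finset.mem_filter.1 hh
  obtain ⟨hc, hlen⟩ := isChain_of_mem hh
  obtain ⟨hv, hl⟩ := hc.valid hB (by omega)
  have hE := hv.extension
  have hx := hv.walk_ne hl hB.mem_nb hg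
  have hW : IsAltPath (B.state h).col (B.ext (B.state h)).2.1 (B.ext (B.state h)).2.2
      (B.walk (B.state h)) B.ℓ :=
    ⟨hE.ne, hE.start, fun t ht => hE.edge t ht fun s hs => hx s (by omega)⟩
  rw [Finset.card_image_of_injOn, Finset.card_range]
  intro a ha b hb hab
  simp only [Finset.coe_range, Set.mem_Iio] at ha hb
  have := (Prod.mk.inj (List.cons.inj hab).1).1
  exact hW.injOn hv.coloring (Set.mem_Iic.2 ha.le) (Set.mem_Iic.2 hb.le) this

/-- A chain whose next walk meets a forbidden vertex is determined, up to few possibilities, by its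
beginning before the step that touched this vertex. -/
theorem Blocked.exists_of_not_good (hB : B.Blocked M) (hm : m ≤ M) (hh : h ∈ B.chains m)
    (hg : ¬ B.Good h) : ∃ d ∈ Finset.range m, ∃ h₂ ∈ B.chains (m - (d + 1)),
      ∃ p ∈ pathLists (candidates B.nb B.φ) (d + 1)
        ((if d = 0 then B.center h₂ else B.trace h₂).biUnion (candidates B.nb B.φ)),
        p ++ h₂ = h := by
  classical
  obtain ⟨hc, hlen⟩ := isChain_of_mem hh
  obtain ⟨hv, hl⟩ := hc.valid hB (by omega)
  have hex : ∃ t, t ≤ B.ℓ ∧ B.walk (B.state h) t ∈ B.forbidden h := by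
    simpa [Good] using hg
  obtain ⟨⟨hi, hf⟩, hlt⟩ := (Nat.find_eq_iff hex).1 rfl
  generalize Nat.find hex = i at hi hf hlt
  have hcand := hv.mem_candidates hl hB.coloring hB.mem_nb hi fun t ht hft =>
    hlt t ht ⟨by omega, hft⟩
  cases h with
  | nil => simp [forbidden] at hf
  | cons e h =>
    rw [IsChain.head_eq hB hc (by omega)] at hcand
    obtain ⟨m, rfl⟩ : ∃ k, m = k + 1 := ⟨m - 1, by rw [List.length_cons] at hlen; omega⟩
    rcases Finset.mem_union.1 hf with h1 | h1
    · refine ⟨0, Finset.mem_range.2 (by omega), h, by simpa using mem_chains_of_cons hh, [e],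
        ?_, rfl⟩
      exact IsChain.mem_pathLists (p := [e]) hB hc (by simpa [hlen] using hm) _ (by
        simp only [List.head?_cons, Option.mem_def, Option.some.injEq, forall_eq', if_true]
        exact Finset.mem_biUnion.2 ⟨_, h1, hcand⟩)
    · obtain ⟨p, h₂, rfl, hp, h2⟩ := exists_of_mem_touched h1
      have hpl : p.length ≠ 0 := by simpa using hp
      have hlen' : p.length + h₂.length = m := by simpa using hlen
      refine ⟨p.length, Finset.mem_range.2 (by omega), h₂, ?_, e :: p, ?_, rfl⟩
      · refine mem_chains_of_append (p := e :: p) ?_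
        rw [List.length_cons, show p.length + 1 + (m + 1 - (p.length + 1)) = m + 1 by omega]
        exact hh
      · rw [if_neg hpl]
        exact IsChain.mem_pathLists (p := e :: p) hB hc (by rw [List.cons_append]; omega) _ (by
          simp only [List.head?_cons, Option.mem_def, Option.some.injEq, forall_eq']
          exact Finset.mem_biUnion.2 ⟨_, h2, hcand⟩)

open Classical in
/-- The number of chains that are not good is bounded in terms of the numbers of shorter chains. -/
theorem Blocked.card_not_good_le (hB : B.Blocked M) (hm : m ≤ M) {C D : ℕ}
    (hC : ∀ w, (candidates B.nb B.φ w).card ≤ C) (hD : ∀ v, (B.nb v).card ≤ D) :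
    ((B.chains m).filter fun h => ¬ B.Good h).card ≤ ∑ d ∈ Finset.range m,
      (B.chains (m - (d + 1))).card *
        ((if d = 0 then D + 1 else B.ℓ + D + 2) * C ^ (d + 1)) := by
  classical
  have hsub : ((B.chains m).filter fun h => ¬ B.Good h) ⊆ (Finset.range m).biUnion fun d =>
      (B.chains (m - (d + 1))).biUnion fun h₂ =>
        (pathLists (candidates B.nb B.φ) (d + 1)
          ((if d = 0 then B.center h₂ else B.trace h₂).biUnion (candidates B.nb B.φ))).image
            (· ++ h₂) := by
    intro h hh
    obtain ⟨hh, hg⟩ := Finset.mem_filter.1 hh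
    obtain ⟨d, hd, h₂, hh₂, p, hp, he⟩ := hB.exists_of_not_good hm hh hg
    exact Finset.mem_biUnion.2 ⟨d, hd, Finset.mem_biUnion.2 ⟨h₂, hh₂,
      Finset.mem_image.2 ⟨p, hp, he⟩⟩⟩
  refine (Finset.card_le_card hsub).trans (Finset.card_biUnion_le.trans
    (Finset.sum_le_sum fun d _ => Finset.card_biUnion_le_card_mul _ _ _ fun h₂ _ =>
      Finset.card_image_le.trans ((card_pathLists_le hC d _).trans ?_)))
  rw [pow_succ', ← mul_assoc]
  refine Nat.mul_le_mul_right _ (Finset.card_biUnion_le_card_mul _ _ _ fun w _ => hC w)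
    |>.trans (Nat.mul_le_mul_right _ (Nat.mul_le_mul_right _ ?_))
  have hcen : (B.center h₂).card ≤ D + 1 :=
    (Finset.card_insert_le _ _).trans (Nat.add_le_add_right (hD _) 1)
  split_ifs
  · exact hcen
  · refine (Finset.card_union_le _ _).trans ((Nat.add_le_add hcen Finset.card_image_le).trans ?_)
    rw [Finset.card_range]; omega

/-- Rosenfeld's counting argument: the number of chains grows at least by the factor `ℓ / 2` in
every step. -/
theorem Blocked.mul_card_chains_le (hB : B.Blocked M) {C D : ℕ}
    (hC : ∀ w, (candidates B.nb B.φ w).card ≤ C) (hD : ∀ v, (B.nb v).card ≤ D) (hC1 : 1 ≤ C)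
    (hℓ : B.ℓ = 64 * C ^ 2 * (D + 2)) (hm : m ≤ M) :
    (B.ℓ : ℝ) * (B.chains m).card ≤ 2 * (B.chains (m + 1)).card := by
  classical
  induction m using Nat.strong_induction_on with
  | _ m ih =>
    have hC' : (1 : ℝ) ≤ C := by exact_mod_cast hC1
    have hℓ' : (B.ℓ : ℝ) = 64 * C ^ 2 * (D + 2) := by rw [hℓ]; push_cast; ring
    have hD' : (0 : ℝ) ≤ D := Nat.cast_nonneg D
    have hCC : (C : ℝ) ≤ C ^ 2 := by nlinarith
    have hℓ0 : (0 : ℝ) < B.ℓ := by rw [hℓ']; positivity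
    have hDℓ : (D : ℝ) + 2 ≤ B.ℓ := by
      rw [hℓ']; nlinarith [mul_nonneg hD' (by linarith : (0 : ℝ) ≤ (C : ℝ) ^ 2 - 1)]
    -- `ρ ^ (d + 1)` compares `C ^ (d + 1)` times the number of chains with `m - (d + 1)` steps to
    -- the number of chains with `m` steps; the value of `ℓ` makes the resulting series at most
    -- `1 / 2`
    set ρ : ℝ := 2 * C / B.ℓ with hρ
    have hρ0 : 0 ≤ ρ := by positivity
    have hρC : ρ * (32 * C * (D + 2)) = 1 := by
      rw [hρ, hℓ']; field_simp; ring
    have hρℓ : ρ * B.ℓ = 2 * C := by rw [hρ]; field_simp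
    have hρD : (D + 1) * ρ ≤ 1 / 4 := by
      nlinarith [mul_nonneg hρ0 hD',
        mul_nonneg (mul_nonneg hρ0 hD') (by linarith : (0 : ℝ) ≤ (C : ℝ) - 1),
        mul_nonneg hρ0 (by linarith : (0 : ℝ) ≤ (C : ℝ) - 1)]
    have hρ2 : ρ ≤ 1 / 2 := by nlinarith [mul_nonneg hρ0 hD']
    have hCρ : C * ρ ≤ 1 / 32 := by
      nlinarith [mul_nonneg (mul_nonneg hρ0 hD') (by linarith : (0 : ℝ) ≤ (C : ℝ))]
    -- the earlier numbers of chains, by induction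
    have hback : ∀ d ≤ m, ((B.chains (m - d)).card : ℝ) * B.ℓ ^ d ≤ 2 ^ d * (B.chains m).card := by
      intro d
      induction d with
      | zero => intro _; simp
      | succ d ihd =>
        intro hd
        have h1 := ih (m - (d + 1)) (by omega) (by omega)
        rw [show m - (d + 1) + 1 = m - d by omega] at h1
        have h2 := ihd (by omega)
        have h3 : (0 : ℝ) ≤ (B.ℓ : ℝ) ^ d := by positivity
        calc ((B.chains (m - (d + 1))).card : ℝ) * B.ℓ ^ (d + 1)
            = (B.ℓ * (B.chains (m - (d + 1))).card) * B.ℓ ^ d := by ring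
          _ ≤ (2 * (B.chains (m - d)).card) * B.ℓ ^ d := mul_le_mul_of_nonneg_right h1 h3
          _ = 2 * ((B.chains (m - d)).card * B.ℓ ^ d) := by ring
          _ ≤ 2 * (2 ^ d * (B.chains m).card) := by linarith
          _ = _ := by ring
    have hterm : ∀ d ∈ Finset.range m, ((B.chains (m - (d + 1))).card : ℝ) *
        ((if d = 0 then (D : ℝ) + 1 else B.ℓ + D + 2) * C ^ (d + 1)) ≤
          (B.chains m).card * (1 / 2) ^ (d + 2) := by
      intro d hd
      have h1 := hback (d + 1) (by rw [Finset.mem_range] at hd; omega)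
      have h2 : ((B.chains (m - (d + 1))).card : ℝ) * C ^ (d + 1) ≤
          (B.chains m).card * ρ ^ (d + 1) := by
        rw [hρ, div_pow, mul_div_assoc', le_div_iff₀ (by positivity)]
        calc ((B.chains (m - (d + 1))).card : ℝ) * C ^ (d + 1) * B.ℓ ^ (d + 1)
            = ((B.chains (m - (d + 1))).card * B.ℓ ^ (d + 1)) * C ^ (d + 1) := by ring
          _ ≤ (2 ^ (d + 1) * (B.chains m).card) * C ^ (d + 1) :=
            mul_le_mul_of_nonneg_right h1 (by positivity)
          _ = _ := by rw [mul_pow]; ring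
      have h3 : (if d = 0 then (D : ℝ) + 1 else B.ℓ + D + 2) * ρ ^ (d + 1) ≤ (1 / 2) ^ (d + 2) := by
        split_ifs with h
        · subst h
          norm_num at hρD ⊢
          linarith
        · obtain ⟨k, rfl⟩ : ∃ k, d = k + 1 := ⟨d - 1, by omega⟩
          have h4 : (B.ℓ + D + 2) * ρ ^ 2 ≤ 1 / 8 := by
            calc (B.ℓ + D + 2) * ρ ^ 2 ≤ (2 * B.ℓ) * ρ ^ 2 :=
                  mul_le_mul_of_nonneg_right (by linarith) (by positivity)
              _ = 2 * (ρ * B.ℓ) * ρ := by ring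
              _ = 4 * (C * ρ) := by rw [hρℓ]; ring
              _ ≤ 1 / 8 := by linarith
          calc (B.ℓ + D + 2) * ρ ^ (k + 1 + 1) = ((B.ℓ + D + 2) * ρ ^ 2) * ρ ^ k := by ring
            _ ≤ 1 / 8 * (1 / 2) ^ k := mul_le_mul h4 (pow_le_pow_left₀ hρ0 hρ2 k)
                (by positivity) (by norm_num)
            _ = _ := by ring
      calc ((B.chains (m - (d + 1))).card : ℝ) *
            ((if d = 0 then (D : ℝ) + 1 else B.ℓ + D + 2) * C ^ (d + 1))
          = (if d = 0 then (D : ℝ) + 1 else B.ℓ + D + 2) *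
            (((B.chains (m - (d + 1))).card : ℝ) * C ^ (d + 1)) := by ring
        _ ≤ (if d = 0 then (D : ℝ) + 1 else B.ℓ + D + 2) * ((B.chains m).card * ρ ^ (d + 1)) :=
            mul_le_mul_of_nonneg_left h2 (by split_ifs <;> positivity)
        _ = (B.chains m).card * ((if d = 0 then (D : ℝ) + 1 else B.ℓ + D + 2) * ρ ^ (d + 1)) := by
            ring
        _ ≤ _ := mul_le_mul_of_nonneg_left h3 (Nat.cast_nonneg _)
    have hgeom : ∑ d ∈ Finset.range m, ((1 : ℝ) / 2) ^ (d + 2) ≤ 1 / 2 := by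
      have : ∀ n : ℕ, ∑ d ∈ Finset.range n, ((1 : ℝ) / 2) ^ (d + 2) =
          1 / 2 - (1 / 2) ^ (n + 1) := by
        intro n
        induction n with
        | zero => norm_num
        | succ n ih => rw [Finset.sum_range_succ, ih]; ring
      rw [this]
      have : (0 : ℝ) ≤ (1 / 2) ^ (m + 1) := by positivity
      linarith
    have hbad : (((B.chains m).filter fun h => ¬ B.Good h).card : ℝ) ≤
        (B.chains m).card * (1 / 2) := by
      have h1 := hB.card_not_good_le hm hC hD
      have h2 : (((B.chains m).filter fun h => ¬ B.Good h).card : ℝ) ≤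
          ∑ d ∈ Finset.range m, ((B.chains (m - (d + 1))).card : ℝ) *
            ((if d = 0 then (D : ℝ) + 1 else B.ℓ + D + 2) * C ^ (d + 1)) := by
        refine le_trans (Nat.cast_le.2 h1) (le_of_eq ?_)
        push_cast
        rfl
      refine h2.trans ((Finset.sum_le_sum hterm).trans ?_)
      rw [← Finset.mul_sum]
      exact mul_le_mul_of_nonneg_left hgeom (Nat.cast_nonneg _)
    have hsplit := Finset.card_filter_add_card_filter_not (s := B.chains m) B.Good
    have hsplit' : (((B.chains m).filter B.Good).card : ℝ) +
        ((B.chains m).filter fun h => ¬ B.Good h).card = (B.chains m).card := by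
      exact_mod_cast hsplit
    have hgood : ((B.chains m).card : ℝ) ≤ 2 * ((B.chains m).filter B.Good).card := by linarith
    have hsucc : ((B.chains (m + 1)).card : ℝ) = B.ℓ * ((B.chains m).filter B.Good).card := by
      exact_mod_cast hB.card_chains_succ hm
    rw [hsucc]
    nlinarith

/-- If an uncoloured edge cannot be coloured by changes in a ball of radius about `ℓ * M`, then the
number of vertices of this ball is exponential in `M`. -/
theorem Blocked.two_pow_le (hB : B.Blocked M) {C D F : ℕ}
    (hCdef : C = (Fintype.card κ ^ 2 + 1) * D ^ 2) (hD : ∀ v, (B.nb v).card ≤ D)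
    (hℓ : B.ℓ = 64 * C ^ 2 * (D + 2)) (hM : 1 ≤ M)
    (hfin : (graphBall B.G B.x₀ (B.ℓ * M)).Finite)
    (hF : (graphBall B.G B.x₀ (B.ℓ * M)).ncard ≤ F) : 2 ^ M ≤ F * D := by
  classical
  have hC : ∀ w, (candidates B.nb B.φ w).card ≤ C := fun w =>
    hCdef ▸ card_candidates_le hD B.φ w
  have hD1 : 1 ≤ D := (Finset.card_pos.2 ⟨B.y₀, (hB.mem_nb _ _).2 hB.adj⟩).trans_le (hD B.x₀)
  have hC1 : 1 ≤ C := by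
    rw [hCdef]; exact Nat.mul_pos (Nat.succ_pos _) (by positivity)
  have hlow : ∀ m ≤ M, (B.ℓ : ℝ) ^ m ≤ 2 ^ m * (B.chains m).card := by
    intro m
    induction m with
    | zero => intro _; simp [chains]
    | succ m ih =>
      intro hm
      have h1 := ih (by omega)
      have h2 := hB.mul_card_chains_le hC hD hC1 hℓ (m := m) (by omega)
      calc (B.ℓ : ℝ) ^ (m + 1) = B.ℓ ^ m * B.ℓ := pow_succ _ _
        _ ≤ (2 ^ m * (B.chains m).card) * B.ℓ := mul_le_mul_of_nonneg_right h1 (Nat.cast_nonneg _)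
        _ = 2 ^ m * (B.ℓ * (B.chains m).card) := by ring
        _ ≤ 2 ^ m * (2 * (B.chains (m + 1)).card) := mul_le_mul_of_nonneg_left h2 (by positivity)
        _ = _ := by ring
  obtain ⟨m, rfl⟩ : ∃ m, M = m + 1 := ⟨M - 1, by omega⟩
  have hup : (B.chains (m + 1)).card ≤ F * D * C ^ m := by
    set A : Finset (V × V) := hfin.toFinset.biUnion fun x => (B.nb x).image fun y => (x, y) with hA
    have hAcard : A.card ≤ F * D := by
      refine (Finset.card_biUnion_le_card_mul _ _ D fun x _ =>
        Finset.card_image_le.trans (hD x)).trans (Nat.mul_le_mul_right _ ?_)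
      rwa [← Set.ncard_eq_toFinset_card _ hfin]
    refine (Finset.card_le_card fun h hh => ?_).trans ((card_pathLists_le hC m A).trans
      (Nat.mul_le_mul_right _ hAcard))
    obtain ⟨hc, hlen⟩ := isChain_of_mem hh
    have := IsChain.mem_pathLists (p := h) (h := []) hB (by simpa using hc)
      (by simpa using hlen.le) A fun e he => ?_
    · rwa [hlen] at this
    · cases h with
      | nil => simp at he
      | cons e' h =>
        obtain rfl : e' = e := by simpa using he
        obtain ⟨hv, -⟩ := hc.valid hB hlen.le
        have hhead := IsChain.head_eq hB hc hlen.le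
        refine Finset.mem_biUnion.2 ⟨e'.1, ?_, Finset.mem_image.2 ⟨e'.2, ?_, rfl⟩⟩
        · have := hv.mem_ball
          rw [hlen] at this
          rw [Set.Finite.mem_toFinset, ← hhead]
          exact this
        · have := hv.adj
          rw [hB.mem_nb, ← hhead]
          exact this
  have h1 := hlow (m + 1) le_rfl
  have h2 : ((B.chains (m + 1)).card : ℝ) ≤ F * D * C ^ m := by exact_mod_cast hup
  have hC' : (1 : ℝ) ≤ C := by exact_mod_cast hC1
  have h3 : (4 * C : ℝ) ≤ B.ℓ := by
    have hℓ' : (B.ℓ : ℝ) = 64 * C ^ 2 * (D + 2) := by rw [hℓ]; push_cast; ring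
    have hD' : (0 : ℝ) ≤ D := Nat.cast_nonneg D
    rw [hℓ']; nlinarith [mul_nonneg hD' (by positivity : (0 : ℝ) ≤ (C : ℝ) ^ 2)]
  have h4 : ((4 * C : ℝ)) ^ (m + 1) ≤ 2 ^ (m + 1) * (F * D * C ^ m) :=
    (pow_le_pow_left₀ (by positivity) h3 _).trans (h1.trans
      (mul_le_mul_of_nonneg_left h2 (by positivity)))
  have h5 : (2 : ℝ) ^ (m + 1) * (2 ^ (m + 1) * C ^ (m + 1)) ≤
      2 ^ (m + 1) * ((F * D) * C ^ (m + 1)) := by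
    calc (2 : ℝ) ^ (m + 1) * (2 ^ (m + 1) * C ^ (m + 1)) = (4 * C : ℝ) ^ (m + 1) := by
          rw [mul_pow, ← mul_assoc, ← mul_pow]; norm_num
      _ ≤ _ := h4
      _ ≤ _ := by
        refine mul_le_mul_of_nonneg_left (mul_le_mul_of_nonneg_left ?_ (by positivity))
          (by positivity)
        exact pow_le_pow_right₀ hC' (by omega)
  have h6 := le_of_mul_le_mul_left h5 (by positivity)
  have h7 := le_of_mul_le_mul_right h6 (by positivity)
  exact_mod_cast h7

end ChainBase

end Counting

/-! ### Local recolouring in graphs of subexponential growth -/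

section LocalRecoloring

variable {V κ : Type*}

/-- The maximum degree is at most `D`, and a ball of radius `r` has at most `f r + 1` vertices. The
additional `1` makes room for isolated vertices where `f r = 0`. -/
structure HasGrowth (G : SimpleGraph V) (D : ℕ) (f : ℕ → ℕ) : Prop where
  finite_neighborSet : ∀ v, (G.neighborSet v).Finite
  degree_le : ∀ v, (G.neighborSet v).ncard ≤ D
  finite_ball : ∀ v r, (graphBall G v r).Finite
  ball_le : ∀ v r, (graphBall G v r).ncard ≤ f r + 1

theorem graphBall_subset_of_le {G H : SimpleGraph V} (h : H ≤ G) (v : V) (r : ℕ) :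
    graphBall H v r ⊆ graphBall G v r := fun _ ⟨p, hp⟩ =>
  ⟨p.mapLe h, by simpa using hp⟩

theorem HasGrowth.of_le {G H : SimpleGraph V} {D : ℕ} {f : ℕ → ℕ} (hG : HasGrowth G D f)
    (h : H ≤ G) : HasGrowth H D f := by
  have h1 : ∀ v, H.neighborSet v ⊆ G.neighborSet v := fun v w hw => h hw
  exact ⟨fun v => (hG.finite_neighborSet v).subset (h1 v),
    fun v => (Set.ncard_le_ncard (h1 v) (hG.finite_neighborSet v)).trans (hG.degree_le v),
    fun v r => (hG.finite_ball v r).subset (graphBall_subset_of_le h v r),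
    fun v r => (Set.ncard_le_ncard (graphBall_subset_of_le h v r) (hG.finite_ball v r)).trans
      (hG.ball_le v r)⟩

/-- The length `M` of the chains, for alternating paths of length `ℓ`. -/
theorem Subexponential.exists_lt {f : ℕ → ℕ} (hf : Subexponential f) (ℓ D : ℕ) :
    ∃ M, 1 ≤ M ∧ (f (ℓ * M) + 1) * D < 2 ^ M := by
  rcases Nat.eq_zero_or_pos ℓ with rfl | hℓ
  · obtain ⟨M, hM⟩ := pow_unbounded_of_one_lt ((f 0 + 1) * D) (one_lt_two : (1 : ℕ) < 2)
    refine ⟨M + 1, by omega, ?_⟩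
    rw [zero_mul, pow_succ]; omega
  · have hℓ' : (0 : ℝ) < ℓ := by exact_mod_cast hℓ
    have hlog : 0 < Real.log 2 := Real.log_pos one_lt_two
    obtain ⟨R₀, hR⟩ := hf (Real.log 2 / (2 * ℓ)) (by positivity)
    obtain ⟨N, hN⟩ := pow_unbounded_of_one_lt (2 * D : ℝ)
      (Real.one_lt_exp_iff.2 (half_pos hlog))
    set M := max N (max R₀ 1) with hM
    have hM1 : 1 ≤ M := le_trans (le_max_right _ _) (le_max_right _ _)
    have hMR : R₀ ≤ ℓ * M := le_trans (le_trans (le_max_left _ _) (le_max_right _ _))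
      (Nat.le_mul_of_pos_left _ hℓ)
    have h1 := hR _ hMR
    set s : ℝ := Real.exp (Real.log 2 / 2) ^ M with hs
    have hs1 : 1 ≤ s := one_le_pow₀ (Real.one_le_exp (half_pos hlog).le)
    have hsD : 2 * (D : ℝ) < s := hN.trans_le
      (pow_le_pow_right₀ (Real.one_le_exp (half_pos hlog).le) (le_max_left _ _))
    have h2 : Real.exp (Real.log 2 / (2 * ℓ) * ((ℓ * M : ℕ) : ℝ)) = s := by
      rw [hs, ← Real.exp_nat_mul]
      congr 1
      push_cast
      field_simp
    rw [h2] at h1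
    have h3 : s * s = 2 ^ M := by
      rw [hs, ← mul_pow, ← Real.exp_add, add_halves, Real.exp_log two_pos]
    refine ⟨M, hM1, ?_⟩
    have hD : (0 : ℝ) ≤ D := Nat.cast_nonneg D
    have : ((f (ℓ * M) : ℝ) + 1) * D < 2 ^ M := by
      rw [← h3]
      calc ((f (ℓ * M) : ℝ) + 1) * D ≤ (2 * s) * D :=
            mul_le_mul_of_nonneg_right (by linarith) hD
        _ = s * (2 * D) := by ring
        _ < s * s := mul_lt_mul_of_pos_left hsD (by linarith)
    exact_mod_cast this

/-- In graphs of subexponential growth, an uncoloured edge can be coloured by changes within a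
constant distance. -/
theorem exists_augmentation_radius {f : ℕ → ℕ} (hf : Subexponential f) (D : ℕ) :
    ∃ R : ℕ, ∀ (G : SimpleGraph V), HasGrowth G D f → ∀ φ : V → V → Option (Fin (D + 1)),
      IsPartialColoring G φ → ∀ x y, G.Adj x y → φ x y = none → Augmentable G φ x y R := by
  classical
  -- `C` bounds the number of candidates, and `ℓ` is large enough for the counting of chains
  set C := (Fintype.card (Fin (D + 1)) ^ 2 + 1) * D ^ 2 with hC
  set ℓ := 64 * C ^ 2 * (D + 2) with hℓ
  obtain ⟨M, hM1, hM⟩ := hf.exists_lt ℓ D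
  refine ⟨ℓ * (M + 1) + 1, fun G hG φ hφ x y hxy hn => ?_⟩
  by_contra hna
  set B : ChainBase V (Fin (D + 1)) :=
    ⟨G, fun v => (hG.finite_neighborSet v).toFinset, φ, x, y, ℓ⟩ with hBdef
  have hcard : ∀ v, (B.nb v).card ≤ D := fun v => by
    have := hG.degree_le v
    rwa [Set.ncard_eq_toFinset_card _ (hG.finite_neighborSet v)] at this
  have hB : B.Blocked M := ⟨hφ, fun v w => by simp [hBdef],
    fun v => by rw [Fintype.card_fin]; exact Nat.lt_succ_of_le (hcard v), hxy, hn, hna⟩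
  have := hB.two_pow_le hC hcard hℓ hM1 (hG.finite_ball x _) (hG.ball_le x _)
  exact absurd hM (not_lt.2 this)

/-- In graphs of subexponential growth, all edges at a vertex can be coloured by changes within a
constant distance. -/
theorem exists_recoloring_radius {f : ℕ → ℕ} (hf : Subexponential f) (D : ℕ) :
    ∃ R : ℕ, ∀ (G : SimpleGraph V), HasGrowth G D f → ∀ φ : V → V → Option (Fin (D + 1)),
      IsPartialColoring G φ → ∀ x, ∃ ψ, IsPartialColoring G ψ ∧
        (∀ u v, ¬(u ∈ graphBall G x R ∧ v ∈ graphBall G x R) → ψ u v = φ u v) ∧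
        ∀ u v, G.Adj u v → ψ u v = none → φ u v = none ∧ u ≠ x := by
  obtain ⟨R, hR⟩ := exists_augmentation_radius (V := V) hf D
  refine ⟨R, fun G hG φ hφ x => ?_⟩
  have hfin : ∀ φ : V → V → Option (Fin (D + 1)), {y | G.Adj x y ∧ φ x y = none}.Finite := fun φ =>
    (hG.finite_neighborSet x).subset fun y hy => hy.1
  induction hk : {y | G.Adj x y ∧ φ x y = none}.ncard using Nat.strong_induction_on
    generalizing φ with
  | _ k ih =>
    by_cases hex : ∃ y, G.Adj x y ∧ φ x y = none
    · obtain ⟨y, hxy, hn⟩ := hex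
      obtain ⟨ψ, h1, h2, h3⟩ := hR G hG φ hφ x y hxy hn
      have hlt : {y | G.Adj x y ∧ ψ x y = none}.ncard < k := by
        rw [← hk]
        refine Set.ncard_lt_ncard ⟨fun z hz => ⟨hz.1, (h3 x z hz.1 hz.2).1⟩, fun hsub => ?_⟩
          (hfin φ)
        have hy := hsub (show y ∈ {y | G.Adj x y ∧ φ x y = none} from ⟨hxy, hn⟩)
        exact (h3 x y hxy hy.2).2 rfl
      obtain ⟨χ, g1, g2, g3⟩ := ih _ hlt ψ h1 rfl
      refine ⟨χ, g1, fun u v huv => (g2 u v huv).trans (h2 u v huv), fun u v huv h => ?_⟩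
      obtain ⟨h, hu⟩ := g3 u v huv h
      exact ⟨(h3 u v huv h).1, hu⟩
    · refine ⟨φ, hφ, fun _ _ _ => rfl, fun u v huv h => ⟨h, ?_⟩⟩
      rintro rfl
      exact hex ⟨v, huv, h⟩

end LocalRecoloring

/-! ### Local functions of graphs on the natural numbers -/

section Locality

variable {α : Type*}

/-- `G` and `G'` have the same edges at all vertices of the ball of radius `r` around `x`. -/
def AgreeOn (G G' : SimpleGraph ℕ) (x r : ℕ) : Prop :=
  ∀ a ∈ graphBall G x r, ∀ b, G.Adj a b ↔ G'.Adj a b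

/-- A function that assigns to every graph on `ℕ` a labelling of the vertices is local with radius
`r` if the label of `x` depends only on the edges at the vertices of the ball of radius `r` around
`x`. -/
def IsLocal (r : ℕ) (X : SimpleGraph ℕ → ℕ → α) : Prop :=
  ∀ G G' x, AgreeOn G G' x r → X G x = X G' x

theorem mem_graphBall_zero {V : Type*} {G : SimpleGraph V} {x y : V} :
    y ∈ graphBall G x 0 ↔ y = x := by
  constructor
  · rintro ⟨p, hp⟩
    exact (SimpleGraph.Walk.eq_of_length_eq_zero (Nat.le_zero.1 hp)).symm
  · rintro rfl; exact mem_graphBall_self _ _ _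

theorem mem_graphBall_succ {V : Type*} {G : SimpleGraph V} {x y : V} {r : ℕ} :
    y ∈ graphBall G x (r + 1) ↔ y ∈ graphBall G x r ∨ ∃ z ∈ graphBall G x r, G.Adj z y := by
  constructor
  · intro h
    obtain ⟨p, hp⟩ := graphBall_symm h
    cases p with
    | nil => exact Or.inl (mem_graphBall_self _ _ _)
    | @cons _ z _ hz p =>
      rw [SimpleGraph.Walk.length_cons] at hp
      exact Or.inr ⟨z, graphBall_symm ⟨p, by omega⟩, hz.symm⟩
  · rintro (h | ⟨z, hz, h⟩)
    exacts [graphBall_mono _ _ (by omega) h, graphBall_adj hz h]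

variable {G G' : SimpleGraph ℕ} {x y r s : ℕ}

theorem AgreeOn.ball_eq (h : AgreeOn G G' x r) (hs : s ≤ r + 1) :
    graphBall G x s = graphBall G' x s := by
  induction s with
  | zero => ext y; rw [mem_graphBall_zero, mem_graphBall_zero]
  | succ s ih =>
    have ih := ih (by omega)
    ext y
    rw [mem_graphBall_succ, mem_graphBall_succ, ← ih]
    refine or_congr Iff.rfl (exists_congr fun z => and_congr_right fun hz => ?_)
    exact h z (graphBall_mono _ _ (by omega) hz) y

theorem AgreeOn.mono (h : AgreeOn G G' x r) (hs : s ≤ r) : AgreeOn G G' x s :=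
  fun a ha => h a (graphBall_mono _ _ hs ha)

theorem AgreeOn.of_mem {t : ℕ} (h : AgreeOn G G' x r) (hy : y ∈ graphBall G x s) (ht : s + t ≤ r) :
    AgreeOn G G' y t := fun a ha => h a (graphBall_mono _ _ ht (graphBall_trans hy ha))

theorem IsLocal.mono {X : SimpleGraph ℕ → ℕ → α} (h : IsLocal r X) (hs : r ≤ s) : IsLocal s X :=
  fun G G' x hG => h G G' x (hG.mono hs)

end Locality

/-! ### Colour reduction -/

section ColorReduction

/-- The least position at which the binary expansions of `a` and `b` differ. -/
noncomputable def firstDiff (a b : ℕ) : ℕ := sInf {i | a.testBit i ≠ b.testBit i}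

/-- The bits of `a`, with their positions, that distinguish `a` from the elements of `S`; the bit
`b` at position `i` is encoded as `2 * i + b`. -/
def distinguishingBits (a : ℕ) (S : Set ℕ) : Set ℕ :=
  (fun s => 2 * firstDiff a s + (a.testBit (firstDiff a s)).toNat) '' S

open Classical in
/-- An encoding of finite sets of natural numbers as natural numbers. -/
noncomputable def codeSet (A : Set ℕ) : ℕ :=
  if h : A.Finite then Encodable.encode (h.toFinset.sort (· ≤ ·)) else 0

/-- The new colour of a vertex of colour `a` whose neighbours have the colours in `S`. -/
noncomputable def reduceColor (a : ℕ) (S : Set ℕ) : ℕ := codeSet (distinguishingBits a S)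

theorem testBit_firstDiff {a b : ℕ} (h : a ≠ b) :
    a.testBit (firstDiff a b) ≠ b.testBit (firstDiff a b) := by
  have hne : {i | a.testBit i ≠ b.testBit i}.Nonempty := by
    by_contra hcon
    rw [Set.not_nonempty_iff_eq_empty, Set.eq_empty_iff_forall_notMem] at hcon
    exact h (Nat.eq_of_testBit_eq fun i => not_not.1 (hcon i))
  exact Nat.sInf_mem hne

theorem firstDiff_lt {a b L : ℕ} (h : a ≠ b) (ha : a < 2 ^ L) (hb : b < 2 ^ L) :
    firstDiff a b < L := by
  by_contra! hL
  have hpow : 2 ^ L ≤ 2 ^ firstDiff a b := Nat.pow_le_pow_right two_pos hL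
  refine testBit_firstDiff h ?_
  rw [Nat.testBit_lt_two_pow (ha.trans_le hpow), Nat.testBit_lt_two_pow (hb.trans_le hpow)]

theorem codeSet_injOn {A B : Set ℕ} (hA : A.Finite) (hB : B.Finite) (h : codeSet A = codeSet B) :
    A = B := by
  rw [codeSet, codeSet, dif_pos hA, dif_pos hB] at h
  have h1 := Encodable.encode_injective h
  have h2 := congrArg List.toFinset h1
  rw [Finset.sort_toFinset, Finset.sort_toFinset] at h2
  exact Set.Finite.toFinset_inj.1 h2

/-- Adjacent vertices get different new colours: the first bit in which `a` differs from `b`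
belongs to the new colour of `a`, but not to that of `b`, where this bit has another value. -/
theorem reduceColor_ne {a b : ℕ} {S S' : Set ℕ} (hS : S.Finite) (hS' : S'.Finite) (hab : a ≠ b)
    (hb : b ∈ S) : reduceColor a S ≠ reduceColor b S' := by
  intro h
  have h1 := codeSet_injOn (hS.image _) (hS'.image _) h
  have h2 : 2 * firstDiff a b + (a.testBit (firstDiff a b)).toNat ∈ distinguishingBits a S :=
    Set.mem_image_of_mem _ hb
  change distinguishingBits a S = distinguishingBits b S' at h1
  rw [h1] at h2
  obtain ⟨s, -, hs⟩ := h2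
  simp only at hs
  have e1 := Bool.toNat_lt (b.testBit (firstDiff b s))
  have e2 := Bool.toNat_lt (a.testBit (firstDiff a b))
  have e3 : firstDiff b s = firstDiff a b := by omega
  rw [e3] at hs
  have e4 : (b.testBit (firstDiff a b)).toNat = (a.testBit (firstDiff a b)).toNat := by omega
  refine testBit_firstDiff hab ?_
  cases h5 : a.testBit (firstDiff a b) <;> cases h6 : b.testBit (firstDiff a b) <;>
    simp_all

theorem encode_list_lt {B d : ℕ} (l : List ℕ) (hl : ∀ a ∈ l, a < B) (hd : l.length ≤ d) :
    Encodable.encode l < (B + 2) ^ 4 ^ d := by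
  induction l generalizing d with
  | nil => simp
  | cons a l ih =>
    obtain ⟨d, rfl⟩ : ∃ k, d = k + 1 := ⟨d - 1, by rw [List.length_cons] at hd; omega⟩
    have h1 := ih (d := d) (fun b hb => hl b (List.mem_cons_of_mem _ hb))
      (by rw [List.length_cons] at hd; omega)
    have ha := hl a List.mem_cons_self
    rw [Encodable.encode_list_cons, Encodable.encode_nat]
    set X := (B + 2) ^ 4 ^ d with hX
    have hBX : B + 2 ≤ X := Nat.le_self_pow (by positivity) _
    have h2 := Nat.pair_lt_max_add_one_sq a (Encodable.encode l)
    have h3 : max a (Encodable.encode l) + 1 ≤ X := by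
      rcases max_cases a (Encodable.encode l) with ⟨h, _⟩ | ⟨h, _⟩ <;> rw [h] <;> omega
    have h4 : (max a (Encodable.encode l) + 1) ^ 2 ≤ X ^ 2 := Nat.pow_le_pow_left h3 2
    have h5 : X ^ 2 < X ^ 4 := Nat.pow_lt_pow_right (by omega) (by norm_num)
    have h6 : (B + 2) ^ 4 ^ (d + 1) = X ^ 4 := by rw [hX, ← pow_mul, pow_succ]
    rw [h6]
    omega

/-- One round of colour reduction replaces colours with `L` bits by polynomially many in `L`. -/
theorem reduceColor_lt {a L d : ℕ} {S : Set ℕ} (ha : a < 2 ^ L) (hS : ∀ s ∈ S, s < 2 ^ L ∧ s ≠ a)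
    (hfin : S.Finite) (hd : S.ncard ≤ d) : reduceColor a S < (2 * L + 2) ^ 4 ^ d := by
  have hfin' : (distinguishingBits a S).Finite := hfin.image _
  rw [reduceColor, codeSet, dif_pos hfin']
  refine encode_list_lt _ (fun n hn => ?_) ?_
  · rw [Finset.mem_sort, Set.Finite.mem_toFinset] at hn
    obtain ⟨s, hs, rfl⟩ := hn
    have h1 := firstDiff_lt (hS s hs).2.symm ha (hS s hs).1
    have h2 := Bool.toNat_lt (a.testBit (firstDiff a s))
    simp only
    omega
  · rw [Finset.length_sort, ← Set.ncard_eq_toFinset_card _ hfin']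
    exact (Set.ncard_image_le hfin).trans hd

/-- Colours of the vertices after `j` rounds of colour reduction on the `r`-th power of the graph,
starting with the identifiers. -/
noncomputable def reducedColor (r : ℕ) : ℕ → SimpleGraph ℕ → ℕ → ℕ
  | 0, _, x => x
  | j + 1, G, x =>
    reduceColor (reducedColor r j G x) (reducedColor r j G '' (graphBall G x r \ {x}))

theorem isLocal_reducedColor (r j : ℕ) : IsLocal (r * j) (reducedColor r j) := by
  induction j with
  | zero => exact fun G G' x _ => rfl
  | succ j ih =>
    intro G G' x h
    rw [Nat.mul_succ] at h
    rw [reducedColor, reducedColor, ih G G' x (h.mono (by omega)),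
      ← h.ball_eq (s := r) (by omega)]
    congr 1
    exact Set.image_congr fun y hy => ih G G' y (h.of_mem hy.1 (by omega))

theorem reducedColor_ne {G : SimpleGraph ℕ} {r : ℕ} (hfin : ∀ x, (graphBall G x r).Finite) (j : ℕ)
    {x y : ℕ} (hy : y ∈ graphBall G x r) (hne : x ≠ y) :
    reducedColor r j G x ≠ reducedColor r j G y := by
  induction j generalizing x y with
  | zero => exact hne
  | succ j ih =>
    exact reduceColor_ne (((hfin x).sdiff).image _) (((hfin y).sdiff).image _) (ih hy hne)
      (Set.mem_image_of_mem _ ⟨hy, hne.symm⟩)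

/-- A constant `K` for which a bound `K * Λ ^ E` on the number of colours turns, in one round of
colour reduction, into the bound `K * (max 1 (log Λ)) ^ E`. -/
theorem exists_color_bound (E : ℕ) :
    ∃ K : ℝ, 1 ≤ K ∧ (3 * Real.log K + 3 * E + 4) ^ E ≤ K := by
  have h1 := (Real.tendsto_pow_mul_exp_neg_atTop_nhds_zero E).const_mul ((4 : ℝ) ^ E)
  rw [mul_zero] at h1
  obtain ⟨s, hs1, hs2⟩ := ((h1.eventually_lt_const one_pos).and
    (Filter.eventually_ge_atTop (3 * E + 4 : ℝ))).exists
  have hs0 : 0 ≤ s := le_trans (by positivity) hs2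
  refine ⟨Real.exp s, Real.one_le_exp hs0, ?_⟩
  rw [Real.log_exp]
  have h2 : (3 * s + 3 * E + 4) ^ E ≤ (4 * s) ^ E :=
    pow_le_pow_left₀ (by positivity) (by linarith) E
  refine h2.trans ?_
  rw [Real.exp_neg, ← mul_assoc, ← mul_pow] at hs1
  have := Real.exp_pos s
  rw [← div_eq_mul_inv, div_lt_one this] at hs1
  exact hs1.le

theorem one_lt_iterate_log {n : ℝ} {j : ℕ} (hj : j < logStar n) : 1 < Real.log^[j] n := by
  by_contra! h
  exact Nat.notMem_of_lt_sInf hj h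

theorem iterate_log_logStar_le (n : ℝ) : Real.log^[logStar n] n ≤ 1 :=
  Nat.sInf_mem (exists_iterate_log_le_one n)

/-- After `log* n` rounds of colour reduction, the number of colours is bounded by a constant. -/
theorem exists_reducedColor_lt (F r : ℕ) : ∃ K : ℕ, ∀ (G : SimpleGraph ℕ) (n : ℕ),
    (∀ x y, G.Adj x y → y ≤ n) → (∀ x, (graphBall G x r).Finite) →
    (∀ x, (graphBall G x r).ncard ≤ F + 1) →
    ∀ x ≤ n, reducedColor r (logStar n) G x < K := by
  obtain ⟨K, hK1, hK⟩ := exists_color_bound (4 ^ F)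
  set E : ℕ := 4 ^ F with hE
  have hE1 : 1 ≤ E := Nat.one_le_pow _ _ (by norm_num)
  refine ⟨⌊K⌋₊ + 1, fun G n hn hfin hF => ?_⟩
  have hball : ∀ x ≤ n, ∀ s, ∀ y ∈ graphBall G x s, y ≤ n := by
    intro x hx s
    induction s with
    | zero => intro y hy; rwa [mem_graphBall_zero.1 hy]
    | succ s ih =>
      intro y hy
      rcases mem_graphBall_succ.1 hy with h | ⟨z, _, h⟩
      exacts [ih y h, hn z y h]
  -- the bound on the colours follows the iterated logarithm of `n`
  have key : ∀ j ≤ logStar n, ∀ x ≤ n,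
      (reducedColor r j G x : ℝ) ≤ K * (max 1 (Real.log^[j] n)) ^ E := by
    intro j
    induction j with
    | zero =>
      intro _ x hx
      have h1 : (x : ℝ) ≤ n := by exact_mod_cast hx
      have h2 : (1 : ℝ) ≤ max 1 (n : ℝ) := le_max_left _ _
      calc (x : ℝ) ≤ max 1 (n : ℝ) := h1.trans (le_max_right _ _)
        _ ≤ (max 1 (n : ℝ)) ^ E := le_self_pow₀ h2 (by omega)
        _ ≤ K * (max 1 (n : ℝ)) ^ E := le_mul_of_one_le_left (by positivity) hK1
    | succ j ih =>
      intro hj x hx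
      have hΛ := one_lt_iterate_log (n := n) (j := j) (by omega)
      have ih := ih (by omega)
      rw [max_eq_right hΛ.le] at ih
      rw [Function.iterate_succ_apply']
      set Λ := Real.log^[j] n
      set Λ' := max 1 (Real.log Λ) with hΛ'
      have hK0 : 0 < K := by linarith
      have hΛ0 : 0 < Λ := by linarith
      have hlogK : 0 ≤ Real.log K := Real.log_nonneg hK1
      have hlogΛ : 0 ≤ Real.log Λ := Real.log_nonneg hΛ.le
      set q := Real.log (K * Λ ^ E) / Real.log 2 with hq
      have hlog2 := Real.log_two_gt_d9
      have hlogq : Real.log (K * Λ ^ E) = Real.log K + E * Real.log Λ := by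
        rw [Real.log_mul hK0.ne' (pow_pos hΛ0 _).ne', Real.log_pow]
      have hnum : 0 ≤ Real.log K + E * Real.log Λ := by positivity
      have hq0 : 0 ≤ q := by rw [hq, hlogq]; positivity
      -- the colours before this round have at most `L` bits
      set L := ⌊q⌋₊ + 1 with hL
      have hlt : ∀ y ≤ n, reducedColor r j G y < 2 ^ L := by
        intro y hy
        have h1 : K * Λ ^ E < (2 : ℝ) ^ L := by
          rw [← Real.log_lt_log_iff (by positivity) (by positivity), Real.log_pow, hL]
          have := Nat.lt_floor_add_one q
          rw [hq, div_lt_iff₀ (by linarith)] at this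
          push_cast
          exact this
        exact_mod_cast (ih y hy).trans_lt h1
      have hstep : reducedColor r (j + 1) G x < (2 * L + 2) ^ 4 ^ F := by
        refine reduceColor_lt (hlt x hx) ?_ ((hfin x).sdiff.image _) ?_
        · rintro s ⟨y, hy, rfl⟩
          exact ⟨hlt y (hball x hx r y hy.1), (reducedColor_ne hfin j hy.1 (Ne.symm hy.2)).symm⟩
        · refine (Set.ncard_image_le (hfin x).sdiff).trans ?_
          have h1 := Set.ncard_sdiff_singleton_add_one (mem_graphBall_self G x r) (hfin x)
          have h2 := hF x
          omega
      have hL2 : (2 * L + 2 : ℝ) ≤ (3 * Real.log K + 3 * E + 4) * Λ' := by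
        have h1 : (⌊q⌋₊ : ℝ) ≤ q := Nat.floor_le hq0
        have h2 : 2 * q ≤ 3 * (Real.log K + E * Real.log Λ) := by
          rw [hq, hlogq, mul_div_assoc', div_le_iff₀ (by linarith)]
          nlinarith
        have h3 : 1 ≤ Λ' := le_max_left _ _
        have h4 : Real.log Λ ≤ Λ' := le_max_right _ _
        have h5 : (L : ℝ) = ⌊q⌋₊ + 1 := by rw [hL]; push_cast; ring
        have h6 : (E : ℝ) * Real.log Λ ≤ E * Λ' := mul_le_mul_of_nonneg_left h4 (by positivity)
        have h7 : Real.log K ≤ Real.log K * Λ' := le_mul_of_one_le_right hlogK h3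
        rw [h5]
        nlinarith
      calc (reducedColor r (j + 1) G x : ℝ) ≤ (2 * L + 2 : ℝ) ^ E := by
            exact_mod_cast hstep.le
        _ ≤ ((3 * Real.log K + 3 * E + 4) * Λ') ^ E := pow_le_pow_left₀ (by positivity) hL2 E
        _ = (3 * Real.log K + 3 * E + 4) ^ E * Λ' ^ E := mul_pow _ _ _
        _ ≤ K * Λ' ^ E := mul_le_mul_of_nonneg_right hK (by positivity)
  intro x hx
  have h := key _ le_rfl x hx
  rw [max_eq_left (iterate_log_logStar_le _), one_pow, mul_one] at h
  exact Nat.lt_succ_of_le (Nat.le_floor h)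

end ColorReduction

/-! ### Recolouring the classes of a distance colouring one after the other -/

section Phases

variable {D : ℕ}

/-- The edges of `G` at the vertices of the ball of radius `r` around `x`. -/
def truncateGraph (G : SimpleGraph ℕ) (x r : ℕ) : SimpleGraph ℕ where
  Adj a b := G.Adj a b ∧ (a ∈ graphBall G x r ∨ b ∈ graphBall G x r)
  symm := ⟨fun _ _ h => ⟨h.1.symm, h.2.symm⟩⟩
  loopless := ⟨fun a h => G.loopless.irrefl a h.1⟩

open Classical in
/-- The restriction of a partial edge-colouring to the edges of `H`. -/
noncomputable def restrictColoring (H : SimpleGraph ℕ) (ξ : ℕ → ℕ → Option (Fin (D + 1))) :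
    ℕ → ℕ → Option (Fin (D + 1)) := fun u v => if H.Adj u v then ξ u v else none

/-- `ψ` is a partial colouring of `H` that differs from `η` only in the ball of radius `R` around
`x` and also colours all edges at `x`. -/
structure IsPatch (H : SimpleGraph ℕ) (η : ℕ → ℕ → Option (Fin (D + 1))) (x R : ℕ)
    (ψ : ℕ → ℕ → Option (Fin (D + 1))) : Prop where
  coloring : IsPartialColoring H ψ
  off : ∀ u v, ¬(u ∈ graphBall H x R ∧ v ∈ graphBall H x R) → ψ u v = η u v
  cover : ∀ u v, H.Adj u v → ψ u v = none → η u v = none ∧ u ≠ x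

/-- The recolouring around `x`. It is chosen in terms of the edges and their colours near `x` only,
so that all vertices that know this part of the graph choose the same one. -/
noncomputable def patch (R : ℕ) (G : SimpleGraph ℕ) (ξ : ℕ → ℕ → Option (Fin (D + 1))) (x : ℕ) :
    ℕ → ℕ → Option (Fin (D + 1)) :=
  Classical.epsilon (IsPatch (truncateGraph G x R) (restrictColoring (truncateGraph G x R) ξ) x R)

/-- The vertex `x` has colour `i` under `c`, and `a`, `b` lie in the ball around `x`. -/
def IsActive (R i : ℕ) (c : ℕ → ℕ) (G : SimpleGraph ℕ) (a b x : ℕ) : Prop :=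
  c x = i ∧ a ∈ graphBall G x R ∧ b ∈ graphBall G x R

open Classical in
/-- The simultaneous recolouring around all vertices of colour `i`. -/
noncomputable def recolorClass (R i : ℕ) (c : ℕ → ℕ) (G : SimpleGraph ℕ)
    (ξ : ℕ → ℕ → Option (Fin (D + 1))) : ℕ → ℕ → Option (Fin (D + 1)) := fun a b =>
  if ∃ x, IsActive R i c G a b x then patch R G ξ (Classical.epsilon (IsActive R i c G a b)) a b
  else ξ a b

/-- The partial edge-colouring after the colour classes `0, …, i - 1` have been processed. -/
noncomputable def phases (D R : ℕ) (c : SimpleGraph ℕ → ℕ → ℕ) :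
    ℕ → SimpleGraph ℕ → ℕ → ℕ → Option (Fin (D + 1))
  | 0, _ => fun _ _ => none
  | i + 1, G => recolorClass R i (c G) G (phases D R c i G)

variable {G G' : SimpleGraph ℕ} {R i : ℕ} {x a b : ℕ}

theorem truncateGraph_le : truncateGraph G x R ≤ G := fun _ _ h => h.1

theorem truncateGraph_adj_of_mem (ha : a ∈ graphBall G x R) :
    (truncateGraph G x R).Adj a b ↔ G.Adj a b := ⟨fun h => h.1, fun h => ⟨h, Or.inl ha⟩⟩

theorem graphBall_truncateGraph : graphBall (truncateGraph G x R) x R = graphBall G x R :=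
  (AgreeOn.ball_eq (G := G) (G' := truncateGraph G x R) (r := R)
    (fun _ ha _ => (truncateGraph_adj_of_mem ha).symm) (Nat.le_succ R)).symm

theorem AgreeOn.truncateGraph_eq (h : AgreeOn G G' x R) :
    truncateGraph G x R = truncateGraph G' x R := by
  ext u v
  have hb := h.ball_eq (s := R) (by omega)
  simp only [truncateGraph, ← hb]
  constructor
  · rintro ⟨h1, h2 | h2⟩
    · exact ⟨(h u h2 v).1 h1, Or.inl h2⟩
    · exact ⟨((h v h2 u).1 h1.symm).symm, Or.inr h2⟩
  · rintro ⟨h1, h2 | h2⟩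
    · exact ⟨(h u h2 v).2 h1, Or.inl h2⟩
    · exact ⟨((h v h2 u).2 h1.symm).symm, Or.inr h2⟩

theorem patch_congr {ξ ξ' : ℕ → ℕ → Option (Fin (D + 1))} (h : AgreeOn G G' x R)
    (hξ : ∀ u ∈ graphBall G x (R + 1), ξ u = ξ' u) : patch R G ξ x = patch R G' ξ' x := by
  have : restrictColoring (truncateGraph G x R) ξ = restrictColoring (truncateGraph G x R) ξ' := by
    funext u v
    unfold restrictColoring
    by_cases ha : (truncateGraph G x R).Adj u v
    · rw [if_pos ha, if_pos ha]
      have hu : u ∈ graphBall G x (R + 1) := by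
        rcases ha.2 with h2 | h2
        · exact graphBall_mono _ _ (by omega) h2
        · exact graphBall_adj h2 ha.1.symm
      rw [hξ u hu]
    · rw [if_neg ha, if_neg ha]
  rw [patch, patch, this, h.truncateGraph_eq]

theorem isLocal_phases {c : SimpleGraph ℕ → ℕ → ℕ} {ρ : ℕ} (hc : IsLocal ρ c) (i : ℕ) :
    IsLocal (ρ + i * (2 * R + 1)) (phases D R c i) := by
  induction i with
  | zero => exact fun G G' x _ => rfl
  | succ i ih =>
    intro G G' a h
    rw [Nat.succ_mul] at h
    funext b
    have hbR : graphBall G a R = graphBall G' a R := h.ball_eq (by omega)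
    have hact : IsActive R i (c G) G a b = IsActive R i (c G') G' a b := by
      have hx : ∀ x ∈ graphBall G a R, c G x = c G' x ∧ graphBall G x R = graphBall G' x R :=
        fun x hx => ⟨hc G G' x (h.of_mem hx (by omega)),
          (h.of_mem hx (t := R) (by omega)).ball_eq (by omega)⟩
      funext x
      refine propext ⟨fun hax => ?_, fun hax => ?_⟩
      · have h1 := hx x (graphBall_symm hax.2.1)
        rwa [IsActive, ← h1.1, ← h1.2]
      · have h1 := hx x (by rw [hbR]; exact graphBall_symm hax.2.1)
        rwa [IsActive, h1.1, h1.2]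
    rw [phases, phases]
    unfold recolorClass
    rw [← hact]
    by_cases hex : ∃ x, IsActive R i (c G) G a b x
    · rw [if_pos hex, if_pos hex]
      have hx0 := graphBall_symm (Classical.epsilon_spec hex).2.1
      rw [patch_congr (h.of_mem hx0 (by omega)) fun u hu => ih G G' u
        (h.of_mem (graphBall_trans hx0 hu) (by omega))]
    · rw [if_neg hex, if_neg hex, ih G G' a (h.mono (by omega))]

theorem IsPartialColoring.restrict {H : SimpleGraph ℕ} {ξ : ℕ → ℕ → Option (Fin (D + 1))}
    (hξ : IsPartialColoring G ξ) : IsPartialColoring H (restrictColoring H ξ) := by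
  have key : ∀ {u v d}, restrictColoring H ξ u v = some d → H.Adj u v ∧ ξ u v = some d := by
    intro u v d h
    unfold restrictColoring at h
    split_ifs at h with ha
    exact ⟨ha, h⟩
  refine ⟨fun u v => ?_, fun h => (key h).1, fun h h' => hξ.inj (key h).2 (key h').2⟩
  unfold restrictColoring
  by_cases h : H.Adj u v
  · rw [if_pos h, if_pos h.symm, hξ.symm]
  · rw [if_neg h, if_neg fun h' => h h'.symm]

/-- All edges at a vertex can be coloured by changes within the radius `R`, for graphs of
maximum degree `D` and growth `f`. -/
def IsRecoloringRadius (f : ℕ → ℕ) (D R : ℕ) : Prop :=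
  ∀ (G : SimpleGraph ℕ), HasGrowth G D f → ∀ φ : ℕ → ℕ → Option (Fin (D + 1)),
    IsPartialColoring G φ → ∀ x, ∃ ψ, IsPartialColoring G ψ ∧
      (∀ u v, ¬(u ∈ graphBall G x R ∧ v ∈ graphBall G x R) → ψ u v = φ u v) ∧
      ∀ u v, G.Adj u v → ψ u v = none → φ u v = none ∧ u ≠ x

theorem isPatch_patch {f : ℕ → ℕ} (hR : IsRecoloringRadius f D R) (hG : HasGrowth G D f)
    {ξ : ℕ → ℕ → Option (Fin (D + 1))} (hξ : IsPartialColoring G ξ) (x : ℕ) :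
    IsPatch (truncateGraph G x R) (restrictColoring (truncateGraph G x R) ξ) x R
      (patch R G ξ x) := by
  obtain ⟨ψ, h1, h2, h3⟩ := hR _ (hG.of_le truncateGraph_le)
    (restrictColoring (truncateGraph G x R) ξ) hξ.restrict x
  exact Classical.epsilon_spec (p := IsPatch (truncateGraph G x R)
    (restrictColoring (truncateGraph G x R) ξ) x R) ⟨ψ, h1, h2, h3⟩

/-- Since vertices of the same colour are far apart, the recolourings around them do not interfere:
a vertex in the ball around `x` sees the recolouring around `x`. -/
theorem recolorClass_eq_patch {f : ℕ → ℕ} (hR : IsRecoloringRadius f D R) (hG : HasGrowth G D f)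
    {ξ : ℕ → ℕ → Option (Fin (D + 1))} (hξ : IsPartialColoring G ξ) {c : ℕ → ℕ}
    (hc : ∀ x y, y ∈ graphBall G x (2 * R) → x ≠ y → c x ≠ c y) (hx : c x = i)
    (ha : a ∈ graphBall G x R) : recolorClass R i c G ξ a = patch R G ξ x a := by
  have huniq : ∀ b x', IsActive R i c G a b x' → x' = x := by
    intro b x' h
    by_contra hne
    refine hc x x' ?_ (Ne.symm hne) (hx.trans h.1.symm)
    rw [two_mul]
    exact graphBall_trans ha (graphBall_symm h.2.1)
  funext b
  have hP := isPatch_patch hR hG hξ x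
  by_cases hb : b ∈ graphBall G x R
  · have hex : ∃ x', IsActive R i c G a b x' := ⟨x, hx, ha, hb⟩
    rw [recolorClass, if_pos hex, huniq b _ (Classical.epsilon_spec hex)]
  · have hex : ¬ ∃ x', IsActive R i c G a b x' := by
      rintro ⟨x', h⟩
      obtain rfl := huniq b x' h
      exact hb h.2.2
    rw [recolorClass, if_neg hex,
      hP.off a b (by rw [graphBall_truncateGraph]; exact fun h => hb h.2), restrictColoring]
    split_ifs with hadj
    · rfl
    · rw [truncateGraph_adj_of_mem ha] at hadj
      cases h : ξ a b with
      | none => rfl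
      | some d => exact absurd (hξ.adj h) hadj

theorem recolorClass_eq_self {ξ : ℕ → ℕ → Option (Fin (D + 1))} {c : ℕ → ℕ}
    (ha : ∀ x, c x = i → a ∉ graphBall G x R) : recolorClass R i c G ξ a = ξ a := by
  funext b
  rw [recolorClass, if_neg]
  rintro ⟨x, h⟩
  exact ha x h.1 h.2.1

theorem recolorClass_spec {f : ℕ → ℕ} (hR : IsRecoloringRadius f D R) (hG : HasGrowth G D f)
    {ξ : ℕ → ℕ → Option (Fin (D + 1))} (hξ : IsPartialColoring G ξ) {c : ℕ → ℕ}
    (hc : ∀ x y, y ∈ graphBall G x (2 * R) → x ≠ y → c x ≠ c y) (i : ℕ) :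
    IsPartialColoring G (recolorClass R i c G ξ) ∧
      ∀ u v, G.Adj u v → recolorClass R i c G ξ u v = none → ξ u v = none ∧ c u ≠ i := by
  have hrow : ∀ a, (∃ x, c x = i ∧ a ∈ graphBall G x R ∧
      recolorClass R i c G ξ a = patch R G ξ x a) ∨
      ((∀ x, c x = i → a ∉ graphBall G x R) ∧ recolorClass R i c G ξ a = ξ a) := by
    intro a
    by_cases h : ∃ x, c x = i ∧ a ∈ graphBall G x R
    · obtain ⟨x, hx, ha⟩ := h
      exact Or.inl ⟨x, hx, ha, recolorClass_eq_patch hR hG hξ hc hx ha⟩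
    · push Not at h
      exact Or.inr ⟨h, recolorClass_eq_self h⟩
  refine ⟨⟨fun u v => ?_, fun {u v d} h => ?_, fun {u v w d} h h' => ?_⟩, fun u v huv h => ?_⟩
  · have hact : IsActive R i c G u v = IsActive R i c G v u := by
      funext x
      exact propext (and_congr_right fun _ => and_comm)
    unfold recolorClass
    rw [hact]
    split_ifs
    · exact (isPatch_patch hR hG hξ _).coloring.symm _ _
    · exact hξ.symm _ _
  · rcases hrow u with ⟨x, -, -, he⟩ | ⟨-, he⟩ <;> rw [he] at h
    · exact ((isPatch_patch hR hG hξ x).coloring.adj h).1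
    · exact hξ.adj h
  · rcases hrow u with ⟨x, -, -, he⟩ | ⟨-, he⟩ <;> rw [he] at h h'
    · exact (isPatch_patch hR hG hξ x).coloring.inj h h'
    · exact hξ.inj h h'
  · rcases hrow u with ⟨x, hx, hu, he⟩ | ⟨hfar, he⟩ <;> rw [he] at h
    · have hadj := (truncateGraph_adj_of_mem (b := v) hu).2 huv
      obtain ⟨h1, h2⟩ := (isPatch_patch hR hG hξ x).cover u v hadj h
      rw [restrictColoring, if_pos hadj] at h1
      refine ⟨h1, fun hcu => hc x u (graphBall_mono _ _ (by omega) hu) (Ne.symm h2) ?_⟩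
      rw [hx, hcu]
    · exact ⟨h, fun hcu => hfar u hcu (mem_graphBall_self _ _ _)⟩

theorem phases_spec {f : ℕ → ℕ} (hR : IsRecoloringRadius f D R) (hG : HasGrowth G D f)
    {c : SimpleGraph ℕ → ℕ → ℕ}
    (hc : ∀ x y, y ∈ graphBall G x (2 * R) → x ≠ y → c G x ≠ c G y) (i : ℕ) :
    IsPartialColoring G (phases D R c i G) ∧
      ∀ u v, G.Adj u v → phases D R c i G u v = none → i ≤ c G u := by
  induction i with
  | zero =>
    refine ⟨⟨fun _ _ => rfl, fun {u v d} h => ?_, fun {u v w d} h => ?_⟩,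
      fun _ _ _ _ => Nat.zero_le _⟩ <;> cases h
  | succ i ih =>
    obtain ⟨h1, h2⟩ := recolorClass_spec hR hG ih.1 hc i
    refine ⟨h1, fun u v huv h => ?_⟩
    obtain ⟨h3, h4⟩ := h2 u v huv h
    have := ih.2 u v huv h3
    omega

/-- In the form of local functions: edge-colourings with `D + 1` colours of graphs of subexponential
growth on the numbers up to `n` can be found with radius less than a constant times `log* n`. -/
theorem exists_local_coloring {f : ℕ → ℕ} (hf : Subexponential f) (D : ℕ) :
    ∃ (a : ℕ) (F : ℕ → SimpleGraph ℕ → ℕ → ℕ → Fin (D + 1)), 1 ≤ a ∧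
      (∀ k, 1 ≤ k → IsLocal (a * k - 1) (F k)) ∧
      ∀ (G : SimpleGraph ℕ) (n : ℕ), HasGrowth G D f → (∀ x y, G.Adj x y → y ≤ n) →
        (∀ u v, F (logStar n) G u v = F (logStar n) G v u) ∧
        ∀ u v w, G.Adj u v → G.Adj u w → v ≠ w →
          F (logStar n) G u v ≠ F (logStar n) G u w := by
  obtain ⟨R, hR⟩ := exists_recoloring_radius (V := ℕ) hf D
  obtain ⟨K, hK⟩ := exists_reducedColor_lt (f (2 * R)) (2 * R)
  refine ⟨2 * R + K * (2 * R + 1) + 1,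
    fun k G u v => (phases D R (reducedColor (2 * R) k) K G u v).getD 0, by omega, ?_, ?_⟩
  · intro k hk
    have h1 := (isLocal_phases (D := D) (R := R) (isLocal_reducedColor (2 * R) k) K).mono
      (s := (2 * R + K * (2 * R + 1) + 1) * k - 1) (by
        have : K * (2 * R + 1) ≤ K * (2 * R + 1) * k := Nat.le_mul_of_pos_right _ hk
        rw [Nat.add_mul, Nat.add_mul]
        omega)
    intro G G' x hG
    simp only [h1 G G' x hG]
  · intro G n hG hn
    obtain ⟨h1, h2⟩ := phases_spec (c := reducedColor (2 * R) (logStar n)) hR hG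
      (fun x y hy hne => reducedColor_ne (fun x => hG.finite_ball x _) _ hy hne) K
    have hsome : ∀ u v, G.Adj u v →
        ∃ d, phases D R (reducedColor (2 * R) (logStar n)) K G u v = some d := by
      intro u v huv
      cases h : phases D R (reducedColor (2 * R) (logStar n)) K G u v with
      | some d => exact ⟨d, rfl⟩
      | none =>
        have h3 := h2 u v huv h
        have h4 := hK G n hn (fun x => hG.finite_ball x _) (fun x => hG.ball_le x _) u
          (hn v u huv.symm)
        omega
    refine ⟨fun u v => by dsimp only; rw [h1.symm], fun u v w hv hw hne he => hne ?_⟩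
    obtain ⟨d, hd⟩ := hsome u v hv
    obtain ⟨d', hd'⟩ := hsome u w hw
    simp only [hd, hd', Option.getD_some] at he
    subst he
    exact h1.inj hd hd'

end Phases

/-! ### Collecting the neighbourhood in the LOCAL model -/

section Translation

variable {V : Type*} {G : SimpleGraph V} {ident : V → ℕ}

theorem graphBall_map {W : Type*} (G : SimpleGraph V) (e : V ↪ W) (v : V) (r : ℕ) :
    graphBall (G.map e) (e v) r = e '' graphBall G v r := by
  induction r with
  | zero =>
    ext y
    rw [mem_graphBall_zero]
    constructor
    · rintro rfl; exact Set.mem_image_of_mem _ (mem_graphBall_self _ _ _)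
    · rintro ⟨a, ha, rfl⟩; rw [mem_graphBall_zero.1 ha]
  | succ r ih =>
    ext y
    rw [mem_graphBall_succ, ih]
    constructor
    · rintro (⟨a, ha, rfl⟩ | ⟨_, ⟨a, ha, rfl⟩, h⟩)
      · exact ⟨a, graphBall_mono _ _ (by omega) ha, rfl⟩
      · obtain ⟨a', b, hab, h1, rfl⟩ := (SimpleGraph.map_adj _ _ _ _).1 h
        rw [e.injective h1] at hab
        exact ⟨b, graphBall_adj ha hab, rfl⟩
    · rintro ⟨a, ha, rfl⟩
      rcases mem_graphBall_succ.1 ha with h | ⟨z, hz, h⟩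
      · exact Or.inl ⟨a, h, rfl⟩
      · exact Or.inr ⟨e z, ⟨z, hz, rfl⟩, (SimpleGraph.map_adj _ _ _ _).2 ⟨z, a, h, rfl, rfl⟩⟩

theorem graphBall_eq_closedNeighborhood (G : SimpleGraph V) (v : V) (r : ℕ) :
    graphBall G v r = closedNeighborhood G v r := by
  classical
  ext u
  constructor
  · rintro ⟨p, hp⟩
    exact ⟨p.bypass, p.bypass_isPath, p.length_bypass_le_length.trans hp⟩
  · rintro ⟨p, -, hp⟩
    exact ⟨p, hp⟩

/-- An output in which both ends of every edge name the same colour, and every vertex names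
different colours for its edges, encodes a proper edge-colouring. -/
theorem encodesProperEdgeColoring_of {q : ℕ} {out : V → ℕ → Fin q}
    (hsymm : ∀ u v, G.Adj u v → out u (ident v) = out v (ident u))
    (hne : ∀ u v w, G.Adj u v → G.Adj u w → v ≠ w → out u (ident v) ≠ out u (ident w)) :
    EncodesProperEdgeColoring G ident q out := by
  have hval : ∀ (e : Sym2 V) (u v : V), G.Adj u v → e = s(u, v) →
      out e.out.1 (ident e.out.2) = out u (ident v) := by
    rintro e u v huv rfl
    have h : s((s(u, v) : Sym2 V).out.1, (s(u, v) : Sym2 V).out.2) = s(u, v) :=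
      Quot.out_eq (s(u, v) : Sym2 V)
    rcases Sym2.eq_iff.1 h with ⟨h1, h2⟩ | ⟨h1, h2⟩
    · rw [h1, h2]
    · rw [h1, h2, hsymm v u huv.symm]
  refine ⟨SimpleGraph.Coloring.mk (fun e => out e.1.out.1 (ident e.1.out.2)) ?_,
    fun v u h => (hval _ v u h rfl).symm⟩
  rintro ⟨e₁, he₁⟩ ⟨e₂, he₂⟩ hadj
  rw [SimpleGraph.lineGraph_adj_iff_exists] at hadj
  obtain ⟨hne', u, h1, h2⟩ := hadj
  obtain ⟨v, rfl⟩ := Sym2.mem_iff_exists.1 h1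
  obtain ⟨w, rfl⟩ := Sym2.mem_iff_exists.1 h2
  have hv : G.Adj u v := he₁
  have hw : G.Adj u w := he₂
  simp only [hval _ u v hv rfl, hval _ u w hw rfl]
  refine hne u v w hv hw ?_
  rintro rfl
  exact hne' rfl

theorem logStar_pos {n : ℕ} (hn : 2 ≤ n) : 1 ≤ logStar n := by
  by_contra h
  have h0 : logStar n = 0 := by omega
  have := iterate_log_logStar_le (n : ℝ)
  rw [h0] at this
  have h2 : (2 : ℝ) ≤ n := by exact_mod_cast hn
  simp only [Function.iterate_zero, id_eq] at this
  linarith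

end Translation

section Gathering

variable {Out : Type}

/-- The algorithm in which every vertex collects all edges that it hears of and counts the rounds;
when it is stopped, it applies the function `F` to the number of rounds, the graph that it has
collected, and its identifier. -/
def gatherAlgorithm (F : ℕ → SimpleGraph ℕ → ℕ → Out) : LocalAlgorithm Out where
  State := ℕ × ℕ × Set (ℕ × ℕ)
  Msg := ℕ × Set (ℕ × ℕ)
  init i := (i, 0, ∅)
  send s := (s.1, s.2.2)
  update s M := (s.1, s.2.1 + 1, s.2.2 ∪ {p | ∃ m ∈ M, p ∈ m.2 ∨ p = (s.1, m.1)})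
  output s := F s.2.1 (SimpleGraph.fromRel fun a b => (a, b) ∈ s.2.2) s.1

variable {V : Type*} [Fintype V] {G : SimpleGraph V} [DecidableRel G.Adj] {ident : V → ℕ}
  (F : ℕ → SimpleGraph ℕ → ℕ → Out)

theorem gather_state_fst (t : ℕ) (v : V) :
    ((gatherAlgorithm F).stateAfter G ident t v).1 = ident v := by
  induction t with
  | zero => rfl
  | succ t ih => exact ih

theorem gather_state_snd (t : ℕ) (v : V) :
    ((gatherAlgorithm F).stateAfter G ident t v).2.1 = t := by
  induction t with
  | zero => rfl
  | succ t ih => exact congrArg (· + 1) ih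

theorem mem_gather_succ {t : ℕ} {v : V} {p : ℕ × ℕ} :
    p ∈ ((gatherAlgorithm F).stateAfter G ident (t + 1) v).2.2 ↔
      p ∈ ((gatherAlgorithm F).stateAfter G ident t v).2.2 ∨ ∃ u, G.Adj v u ∧
        (p ∈ ((gatherAlgorithm F).stateAfter G ident t u).2.2 ∨ p = (ident v, ident u)) := by
  refine or_congr Iff.rfl ⟨?_, ?_⟩
  · rintro ⟨m, hm, h⟩
    obtain ⟨u, hu, rfl⟩ := Multiset.mem_map.1 hm
    refine ⟨u, (G.mem_neighborFinset v u).1 hu, h.imp id fun h => ?_⟩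
    rw [h]
    exact Prod.ext (gather_state_fst F t v) (gather_state_fst F t u)
  · rintro ⟨u, hu, h⟩
    refine ⟨_, Multiset.mem_map.2 ⟨u, (G.mem_neighborFinset v u).2 hu, rfl⟩, h.imp id fun h => ?_⟩
    rw [h]
    exact (Prod.ext (gather_state_fst F t v) (gather_state_fst F t u)).symm

theorem exists_adj_of_mem_gather {t : ℕ} {v : V} {p : ℕ × ℕ}
    (h : p ∈ ((gatherAlgorithm F).stateAfter G ident t v).2.2) :
    ∃ a b, G.Adj a b ∧ p = (ident a, ident b) := by
  induction t generalizing v with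
  | zero => exact absurd h (Set.notMem_empty p)
  | succ t ih =>
    rcases (mem_gather_succ F).1 h with h | ⟨u, hu, h | h⟩
    exacts [ih h, ih h, ⟨v, u, hu, h⟩]

theorem mem_gather_of_walk {t : ℕ} {v a b : V} (p : G.Walk v a) (hp : p.length < t)
    (hab : G.Adj a b) : (ident a, ident b) ∈ ((gatherAlgorithm F).stateAfter G ident t v).2.2 := by
  induction t generalizing v with
  | zero => omega
  | succ t ih =>
    cases p with
    | nil => exact (mem_gather_succ F).2 (Or.inr ⟨b, hab, Or.inr rfl⟩)
    | @cons _ u _ hu p =>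
      rw [SimpleGraph.Walk.length_cons] at hp
      exact (mem_gather_succ F).2 (Or.inr ⟨u, hu, Or.inl (ih p (by omega))⟩)

/-- Within `t` rounds, local functions of radius less than `t` can be computed. -/
theorem outputAfter_gatherAlgorithm (e : V ↪ ℕ) {t : ℕ} (ht : 1 ≤ t)
    (hF : IsLocal (t - 1) (F t)) (v : V) :
    (gatherAlgorithm F).outputAfter G e t v = F t (G.map e) (e v) := by
  change F ((gatherAlgorithm F).stateAfter G e t v).2.1 (SimpleGraph.fromRel fun a b =>
    (a, b) ∈ ((gatherAlgorithm F).stateAfter G e t v).2.2)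
      ((gatherAlgorithm F).stateAfter G e t v).1 = _
  rw [gather_state_fst, gather_state_snd]
  refine (hF _ _ _ fun a ha b => ?_).symm
  rw [graphBall_map] at ha
  obtain ⟨a, ⟨p, hp⟩, rfl⟩ := ha
  rw [SimpleGraph.fromRel_adj, SimpleGraph.map_adj]
  constructor
  · rintro ⟨a', b, hab, h, rfl⟩
    rw [e.injective h] at hab
    exact ⟨e.injective.ne hab.ne, Or.inl (mem_gather_of_walk F p (by omega) hab)⟩
  · rintro ⟨-, h | h⟩
    · obtain ⟨a', b', hab, he⟩ := exists_adj_of_mem_gather F h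
      exact ⟨a', b', hab, (Prod.mk.inj he).1.symm, (Prod.mk.inj he).2.symm⟩
    · obtain ⟨a', b', hab, he⟩ := exists_adj_of_mem_gather F h
      exact ⟨b', a', hab.symm, (Prod.mk.inj he).2.symm, (Prod.mk.inj he).1.symm⟩

/-- The graph on the identifiers: the numbers that are not identifiers become isolated vertices. -/
theorem InGrowthClass.hasGrowth_map {Δ : ℕ} {f : ℕ → ℕ} (hG : InGrowthClass Δ f G) (e : V ↪ ℕ) :
    HasGrowth (G.map e) (min Δ (f 1)) f := by
  have hball : ∀ v r, (graphBall G v r).ncard ≤ f r := fun v r => by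
    have := hG.2 v r
    rw [← graphBall_eq_closedNeighborhood, ← Set.Finite.cast_ncard_eq (Set.toFinite _)] at this
    exact_mod_cast this
  have hdeg : ∀ v, G.degree v ≤ min Δ (f 1) := by
    refine fun v => le_min ((G.degree_le_maxDegree v).trans hG.1) (le_trans ?_ (hball v 1))
    rw [← G.card_neighborFinset_eq_degree, ← Set.ncard_coe_finset]
    refine Set.ncard_le_ncard (fun u hu => ?_) (Set.toFinite _)
    exact mem_graphBall_one (by simpa using hu)
  have hnb : ∀ v, (G.map e).neighborSet (e v) = e '' G.neighborSet v := by
    intro v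
    ext y
    rw [SimpleGraph.mem_neighborSet, SimpleGraph.map_adj]
    constructor
    · rintro ⟨a, b, hab, h, rfl⟩
      rw [e.injective h] at hab
      exact ⟨b, hab, rfl⟩
    · rintro ⟨b, hb, rfl⟩
      exact ⟨v, b, hb, rfl, rfl⟩
  -- vertices that are not identifiers are isolated
  have hiso : ∀ x, x ∉ Set.range e → ∀ y, ¬ (G.map e).Adj x y := by
    intro x hx y h
    obtain ⟨a, b, -, rfl, -⟩ := (SimpleGraph.map_adj _ _ _ _).1 h
    exact hx ⟨a, rfl⟩
  have hiso_nb : ∀ x, x ∉ Set.range e → (G.map e).neighborSet x = ∅ := fun x hx =>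
    Set.eq_empty_of_forall_notMem (hiso x hx)
  have hiso_ball : ∀ x, x ∉ Set.range e → ∀ r, graphBall (G.map e) x r = {x} := by
    intro x hx r
    refine Set.Subset.antisymm ?_ (Set.singleton_subset_iff.2 (mem_graphBall_self _ _ _))
    rintro y ⟨p, -⟩
    cases p with
    | nil => rfl
    | cons h _ => exact absurd h (hiso x hx _)
  refine ⟨fun x => ?_, fun x => ?_, fun x r => ?_, fun x r => ?_⟩ <;>
    by_cases hx : x ∈ Set.range e
  · obtain ⟨v, rfl⟩ := hx
    rw [hnb]; exact Set.toFinite _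
  · rw [hiso_nb x hx]; exact Set.finite_empty
  · obtain ⟨v, rfl⟩ := hx
    rw [hnb, Set.ncard_image_of_injective _ e.injective, ← G.coe_neighborFinset,
      Set.ncard_coe_finset, G.card_neighborFinset_eq_degree]
    exact hdeg v
  · rw [hiso_nb x hx, Set.ncard_empty]; exact Nat.zero_le _
  · obtain ⟨v, rfl⟩ := hx
    rw [graphBall_map]; exact Set.toFinite _
  · rw [hiso_ball x hx]; exact Set.finite_singleton _
  · obtain ⟨v, rfl⟩ := hx
    rw [graphBall_map, Set.ncard_image_of_injective _ e.injective]
    exact (hball v r).trans (Nat.le_succ _)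
  · rw [hiso_ball x hx, Set.ncard_singleton]; omega

end Gathering

theorem theorem1p6 (f : ℕ → ℕ) (hf : Subexponential f) :
    ∃ C : ℝ, 0 < C ∧ ∀ Δ : ℕ,
      ∃ (A : LocalAlgorithm (ℕ → Fin (Δ + 1))) (T : ℕ → ℕ),
        (∀ n : ℕ, (T n : ℝ) ≤ C * (logStar n : ℝ)) ∧
        ∀ (V : Type*) [Fintype V] (G : SimpleGraph V) [DecidableRel G.Adj],
          InGrowthClass Δ f G →
          ∀ ident : V → ℕ, IsIdAssignment ident →
            EncodesProperEdgeColoring G ident (Δ + 1)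
              (A.outputAfter G ident (T (Fintype.card V))) := by
  choose a F ha hloc hF using exists_local_coloring hf
  -- the degrees are at most `f 1`, so finitely many values of `a` suffice for all `Δ`
  refine ⟨(∑ D ∈ Finset.range (f 1 + 1), a D : ℕ), ?_, fun Δ => ?_⟩
  · refine Nat.cast_pos.2 ((ha 0).trans (Finset.single_le_sum (f := a) (fun _ _ => Nat.zero_le _)
      (Finset.mem_range.2 (Nat.succ_pos _))))
  set D := min Δ (f 1) with hD
  have hDΔ : D + 1 ≤ Δ + 1 := Nat.succ_le_succ (min_le_left _ _)
  -- the algorithm does not know `n`, but it can compute `log* n` from the number `t` of rounds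
  set F' : ℕ → SimpleGraph ℕ → ℕ → ℕ → Fin (Δ + 1) :=
    fun t G u v => Fin.castLE hDΔ (F D (t / a D) G u v) with hF'
  refine ⟨gatherAlgorithm F', fun n => a D * logStar n, fun n => ?_, ?_⟩
  · have h : a D ≤ ∑ D ∈ Finset.range (f 1 + 1), a D :=
      Finset.single_le_sum (f := a) (fun _ _ => Nat.zero_le _)
        (Finset.mem_range.2 (Nat.lt_succ_of_le (min_le_right _ _)))
    push_cast
    exact mul_le_mul_of_nonneg_right (by exact_mod_cast h) (Nat.cast_nonneg _)
  intro V _ G _ hG ident hid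
  rcases Nat.lt_or_ge (Fintype.card V) 2 with hcard | hcard
  -- here no rounds are available, and there are no edges
  · have hsub : Subsingleton V := Fintype.card_le_one_iff_subsingleton.1 (by omega)
    have hno : ∀ u v, ¬ G.Adj u v := fun u v h => h.ne (Subsingleton.elim u v)
    exact encodesProperEdgeColoring_of (fun u v h => absurd h (hno u v))
      fun u v _ h => absurd h (hno u v)
  set e : V ↪ ℕ := ⟨ident, hid.1⟩ with he
  have hk := logStar_pos hcard
  have hdiv : a D * logStar (Fintype.card V) / a D = logStar (Fintype.card V) :=
    Nat.mul_div_cancel_left _ (ha D)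
  have hlocal : IsLocal (a D * logStar (Fintype.card V) - 1)
      (F' (a D * logStar (Fintype.card V))) := by
    intro G G' x h
    simp only [hF', hdiv, hloc D _ hk G G' x h]
  have hout : ∀ v, (gatherAlgorithm F').outputAfter G ident (a D * logStar (Fintype.card V)) v =
      fun y => Fin.castLE hDΔ (F D (logStar (Fintype.card V)) (G.map e) (ident v) y) := by
    intro v
    have := outputAfter_gatherAlgorithm (G := G) F' e (Nat.mul_pos (ha D) hk) hlocal v
    simp only [hF', hdiv] at this
    exact this
  obtain ⟨hsymm, hne⟩ := hF D (G.map e) (Fintype.card V) (hG.hasGrowth_map e) (by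
    intro x y h
    obtain ⟨u, v, -, -, rfl⟩ := (SimpleGraph.map_adj _ _ _ _).1 h
    exact (hid.2 v).2)
  have hadj : ∀ u v, G.Adj u v → (G.map e).Adj (ident u) (ident v) := fun u v h =>
    (SimpleGraph.map_adj _ _ _ _).2 ⟨u, v, h, rfl, rfl⟩
  refine encodesProperEdgeColoring_of (fun u v _ => ?_) fun u v w hv hw hvw => ?_
  · rw [hout, hout]
    exact congrArg _ (hsymm _ _)
  · rw [hout]
    exact fun h => hne _ _ _ (hadj u v hv) (hadj u w hw) (hid.1.ne hvw) (Fin.castLE_injective hDΔ h)
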